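/- Let $\Bbbk$ be a field, let $m\ge N\ge 2$ be integers, and let $V$ be an $n$-dimensional $\Bbbk$-vector space with basis $v_1,\dots,v_n$ and dual basis $\theta_1,\dots,\theta_n$ of $V^*$. An $m$-linear form $t$ on a finite-dimensional space $Z$ is *preregular* if (i) $t(z_1,z_2,\dots,z_m)=0$ for all $z_2,\dots,z_m$ implies $z_1=0$, and (ii) there is $\phi\in GL(Z)$ with $t(z_1,\dots,z_m)=t(\phi(z_m),z_1,\dots,z_{m-1})$ for all $z_i$. For a subspace $U$ of $Z^{\otimes j}$ let $\partial U\subseteq Z^{\otimes (j-1)}$ be the span of the elements $(\nu\otimes \mathrm{id}^{\otimes (j-1)})(u)$, $\nu\in Z^*$, $u\in U$. For a homogeneous quotient $A=TZ/(R)$, $R\subseteq Z^{\otimes N}$, *$N$-Koszul* means that the Koszul complex $\cdots\to A\otimes W_{2N}\to A\otimes W_{N+1}\to A\otimes W_N\to A\otimes W_1\to A\to\Bbbk\to 0$ is exact, where $W_j=\bigcap_{r+N+s=j}Z^{\otimes r}\otimes R\otimes Z^{\otimes s}$ (and $W_j=Z^{\otimes j}$ for $j<N$); its $i$-th term is $A\otimes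 W_{\nu(i)}$ with $\nu(2p)=pN$, $\nu(2p+1)=pN+1$. *Artin–Schelter regular of dimension $d$* means that $A$ has global dimension $d$ and self-injective dimension $d$ on both sides and $\mathrm{Ext}^i_A({}_A\Bbbk,{}_AA)\cong \mathrm{Ext}^i_A(\Bbbk_A,A_A)\cong\delta_{i,d}\,\Bbbk$. The homological codeterminant. Let a Hopf algebra $K$ with antipode $S$ coact on $A$, preserving the grading, from the left (resp. right) by $\rho$. Compute $\mathrm{Ext}_A({}_A\Bbbk,{}_A\Bbbk)$ by the bar resolution of $\Bbbk$, with the diagonal coaction, and let $K$ coact on cochains through the antipode: a cochain $f$ is sent to $(a_1,\dots,a_i)\mapsto\sum f(a_{1(0)},\dots,a_{i(0)})\,S(a_{1(-1)}\cdots a_{i(-1)})$ (resp. $\sum f(a_{1(0)},\dots,a_{i(0)})\,S(a_{1(1)}\cdots a_{i(1)})$). The homological codeterminant is the element ${\sf D}\in K$ such that a basis element $\mathfrak e$ of the one-dimensional space $\mathrm{Ext}^d_A(\Bbbk,\Bbbk)$ is sent to $\mathfrak e\otimes{\sf D}^{-1}$ (resp. ${\sf D}\otimes\mathfrak e$). **Theorem,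 left version.** Let ${\sf e}:V^{\otimes m}\to\Bbbk$ be a preregular form, ${\sf e}_{i_1\cdots i_m}={\sf e}(v_{i_1},\dots,v_{i_m})$, ${\sf e}^*=\sum {\sf e}_{i_1\cdots i_m}\theta_{i_1}\cdots\theta_{i_m}\in (V^*)^{\otimes m}$, $R=\partial^{m-N}(\Bbbk{\sf e}^*)\subseteq (V^*)^{\otimes N}$ and $A({\sf e},N)=TV^*/(R)$. Assume that $A({\sf e},N)$ is $N$-Koszul and Artin–Schelter regular of dimension $d$, and that $m=\nu(d)$ (so $m=d$ if $N=2$). Let $M_{\sf e}$ be a one-dimensional space with basis $m_{\sf e}$ and $\hat{\sf e}:V^{\otimes m}\to M_{\sf e}$, $\hat{\sf e}(v_{i_1}\otimes\cdots\otimes v_{i_m})={\sf e}_{i_1\cdots i_m}m_{\sf e}$. Let $K$ be a Hopf algebra such that $TV^*$ is a left $K$-comodule algebra via $\rho$ with $\rho(\theta_i)=\sum_j a_{ij}\otimes\theta_j$, $a_{ij}\in K$. The following are equivalent: (a) $\rho$ induces a left $K$-comodule algebra structure on $A({\sf e},N)$; (b) $\rho(R)\subseteq K\otimes R$; that is, $\sum_{i,j}{\sf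 e}_{\lambda_1\cdots\lambda_{m-N}i_1\cdots i_N}\mu_{j_1\cdots j_N}a_{i_1j_1}\cdots a_{i_Nj_N}=0$ for all $\lambda$ and all scalars $\mu_{j_1\cdots j_N}$ with $\sum_i{\sf e}_{\lambda'_1\cdots\lambda'_{m-N}i_1\cdots i_N}\mu_{i_1\cdots i_N}=0$ for all $\lambda'$; (c) there is a unique grouplike $g\in K$ such that the inclusion $\Bbbk{\sf e}^*\hookrightarrow(V^*)^{\otimes m}$ is a left $K$-comodule map for the coactions $g\otimes-$ and $\rho$; (d) there is a unique grouplike $g\in K$ such that $\hat{\sf e}$ is a right $K$-comodule map for $v_j\mapsto\sum_i v_i\otimes a_{ij}$ on $V$ and $-\otimes g$ on $M_{\sf e}$; (e) there is a unique grouplike $g\in K$ with $\sum_{i_1,\dots,i_m}{\sf e}_{i_1\cdots i_m}a_{i_1j_1}\cdots a_{i_mj_m}={\sf e}_{j_1\cdots j_m}g$ for all $j_1,\dots,j_m$. If these hold, the elements $g$ of (c), (d), (e) coincide, $g={\sf e}_{j_1\cdots j_m}^{-1}\sum_{i}{\sf e}_{i_1\cdots i_m}a_{i_1j_1}\cdots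 a_{i_mj_m}$ for every $j_1,\dots,j_m$ with ${\sf e}_{j_1\cdots j_m}\ne0$, and the homological codeterminant of the $K$-coaction on $A({\sf e},N)$ is $g$. **Theorem, right version.** Let ${\sf f}:(V^*)^{\otimes m}\to\Bbbk$ be preregular, ${\sf f}_{i_1\cdots i_m}={\sf f}(\theta_{i_1},\dots,\theta_{i_m})$, ${\sf f}^*=\sum{\sf f}_{i_1\cdots i_m}v_{i_1}\cdots v_{i_m}$, $R=\partial^{m-N}(\Bbbk{\sf f}^*)\subseteq V^{\otimes N}$, $A({\sf f},N)=TV/(R)$, with the same assumptions on $A({\sf f},N)$, $d$ and $m$; let $\hat{\sf f}:(V^*)^{\otimes m}\to M_{\sf f}$, $\hat{\sf f}(\theta_{i_1}\otimes\cdots\otimes\theta_{i_m})={\sf f}_{i_1\cdots i_m}m_{\sf f}$, with $M_{\sf f}=\Bbbk m_{\sf f}$ one-dimensional. Let $K$ be a Hopf algebra such that $TV$ is a right $K$-comodule algebra via $\rho$ with $\rho(v_j)=\sum_i v_i\otimes a_{ij}$. The following are equivalent: (a) $\rho$ induces a right $K$-comodule algebra structure on $A({\sf f},N)$; (b) $\rho(R)\subseteq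 R\otimes K$; that is, $\sum_{i,j}{\sf f}_{\lambda_1\cdots\lambda_{m-N}j_1\cdots j_N}\nu_{i_1\cdots i_N}a_{i_1j_1}\cdots a_{i_Nj_N}=0$ for all $\lambda$ and all scalars $\nu_{i_1\cdots i_N}$ with $\sum_j{\sf f}_{\lambda'_1\cdots\lambda'_{m-N}j_1\cdots j_N}\nu_{j_1\cdots j_N}=0$ for all $\lambda'$; (c) there is a unique grouplike $g\in K$ such that the inclusion $\Bbbk{\sf f}^*\hookrightarrow V^{\otimes m}$ is a right $K$-comodule map for the coactions $-\otimes g$ and $\rho$; (d) there is a unique grouplike $g\in K$ such that $\hat{\sf f}$ is a left $K$-comodule map for $\theta_i\mapsto\sum_j a_{ij}\otimes\theta_j$ on $V^*$ and $g\otimes-$ on $M_{\sf f}$; (e) there is a unique grouplike $g\in K$ with $\sum_{j_1,\dots,j_m}{\sf f}_{j_1\cdots j_m}a_{i_1j_1}\cdots a_{i_mj_m}={\sf f}_{i_1\cdots i_m}g$ for all $i_1,\dots,i_m$. If these hold, the elements $g$ of (c), (d), (e) coincide, $g={\sf f}_{i_1\cdots i_m}^{-1}\sum_{j}{\sf f}_{j_1\cdots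 j_m}a_{i_1j_1}\cdots a_{i_mj_m}$ for every $i_1,\dots,i_m$ with ${\sf f}_{i_1\cdots i_m}\neq0$, and the homological codeterminant of the $K$-coaction on $A({\sf f},N)$ is $g^{-1}$. -/

import Mathlib

open scoped TensorProduct

noncomputable section

namespace Preregular

universe u v w

/-! ### Preregular forms and superpotential algebras -/

section Forms

variable {k : Type u} [Field k] {Z : Type v} [AddCommGroup Z] [Module k Z]

/-- An `m`-linear form `t` on `Z` is preregular if it is nondegenerate in its first argument and
there is `φ ∈ GL(Z)` with `t (z₁, …, z_m) = t (φ z_m, z₁, …, z_{m-1})`.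
The value at position `s ≥ 1` of `w ∘ (finRotate m).symm` is `w (s - 1)`, and the value at
position `0` is the last entry of `w`. -/
def IsPreregular {m : ℕ} (t : MultilinearMap k (fun _ : Fin m => Z) k) : Prop :=
  (∀ z : Z, (∀ w : Fin m → Z, (∀ s : Fin m, (s : ℕ) = 0 → w s = z) → t w = 0) → z = 0) ∧
  ∃ φ : Z ≃ₗ[k] Z, ∀ w : Fin m → Z,
    t w = t (fun s => if (s : ℕ) = 0 then φ (w ((finRotate m).symm s))
      else w ((finRotate m).symm s))

variable (k Z) in
/-- The map `Z → End (T × (Z ⊗ T))`, `z ↦ ((t, u) ↦ (z t, z ⊗ t))`, with `T` the tensor algebra. -/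
def splitStep :
    Z →ₗ[k] Module.End k (TensorAlgebra k Z × (Z ⊗[k] TensorAlgebra k Z)) :=
  LinearMap.mk₂ k
    (fun z p => (TensorAlgebra.ι k z * p.1, z ⊗ₜ[k] p.1))
    (by intro z z' p; simp [add_mul, TensorProduct.add_tmul])
    (by intro c z p; simp [TensorProduct.smul_tmul'])
    (by intro z p q; simp [mul_add, TensorProduct.tmul_add])
    (by intro c z p; simp)

variable (k Z) in
/-- Splitting off the first letter: the linear map `T(Z) → Z ⊗ T(Z)` with
`1 ↦ 0` and `z t ↦ z ⊗ t`. -/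
def splitFirst : TensorAlgebra k Z →ₗ[k] Z ⊗[k] TensorAlgebra k Z :=
  (LinearMap.snd k _ _) ∘ₗ
    (LinearMap.applyₗ ((1, 0) : TensorAlgebra k Z × (Z ⊗[k] TensorAlgebra k Z))) ∘ₗ
    (TensorAlgebra.lift k (splitStep k Z)).toLinearMap

theorem splitStep_apply (z : Z) (p : TensorAlgebra k Z × (Z ⊗[k] TensorAlgebra k Z)) :
    splitStep k Z z p = (TensorAlgebra.ι k z * p.1, z ⊗ₜ[k] p.1) := rfl

theorem lift_splitStep_fst (t : TensorAlgebra k Z)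
    (p : TensorAlgebra k Z × (Z ⊗[k] TensorAlgebra k Z)) :
    (TensorAlgebra.lift k (splitStep k Z) t p).1 = t * p.1 := by
  induction t using TensorAlgebra.induction generalizing p with
  | algebraMap r => simp [Algebra.smul_def]
  | ι z => simp [splitStep_apply]
  | mul x y hx hy => simp [hx, hy, mul_assoc]
  | add x y hx hy => simp [hx, hy, add_mul]

theorem splitFirst_one : splitFirst k Z 1 = 0 := by
  simp [splitFirst]

theorem splitFirst_ι_mul (z : Z) (t : TensorAlgebra k Z) :
    splitFirst k Z (TensorAlgebra.ι k z * t) = z ⊗ₜ[k] t := by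
  have h := lift_splitStep_fst (k := k) (Z := Z) t (1, 0)
  simp only [mul_one] at h
  simp [splitFirst, splitStep_apply, h]

/-- Contraction of the first letter with a functional: `ν ⊗ id ⊗ ⋯ ⊗ id`. -/
def contractFirst (ν : Module.Dual k Z) : TensorAlgebra k Z →ₗ[k] TensorAlgebra k Z :=
  (TensorProduct.lid k (TensorAlgebra k Z)).toLinearMap ∘ₗ
    (LinearMap.rTensor (TensorAlgebra k Z) ν) ∘ₗ splitFirst k Z

theorem contractFirst_ι_mul (ν : Module.Dual k Z) (z : Z) (t : TensorAlgebra k Z) :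
    contractFirst ν (TensorAlgebra.ι k z * t) = ν z • t := by
  simp [contractFirst, splitFirst_ι_mul]

variable (k Z) in
/-- The space of generators `Z`, as the degree one part of the tensor algebra; its `j`-th power
is the degree `j` part `Z^{⊗ j}`. -/
def deg1 : Submodule k (TensorAlgebra k Z) := LinearMap.range (TensorAlgebra.ι k (M := Z))

/-- `∂ U`, the span of the elements `(ν ⊗ id ⊗ ⋯ ⊗ id) u` for `ν ∈ Z^*` and `u ∈ U`. -/
def partialSpace (U : Submodule k (TensorAlgebra k Z)) : Submodule k (TensorAlgebra k Z) :=
  Submodule.span k {y | ∃ ν : Module.Dual k Z, ∃ u ∈ U, y = contractFirst ν u}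

/-- The element `∑ c_{i₁ ⋯ i_m} b_{i₁} ⋯ b_{i_m}` of `Z^{⊗ m} ⊆ T(Z)`. -/
def tensorOf {n m : ℕ} (b : Module.Basis (Fin n) k Z) (c : (Fin m → Fin n) → k) :
    TensorAlgebra k Z :=
  ∑ i : Fin m → Fin n, c i • TensorAlgebra.tprod k Z m (fun s => b (i s))

/-- The relation space `∂^{m-N}(k s)`, where `s = ∑ c_{i₁ ⋯ i_m} b_{i₁} ⋯ b_{i_m}`. -/
def relSpace {n m : ℕ} (b : Module.Basis (Fin n) k Z) (c : (Fin m → Fin n) → k) (N : ℕ) :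
    Submodule k (TensorAlgebra k Z) :=
  partialSpace^[m - N] (Submodule.span k {tensorOf b c})

/-- The quotient of the tensor algebra by the two-sided ideal generated by a subspace `R`. -/
abbrev QuotAlg (R : Submodule k (TensorAlgebra k Z)) : Type (max u v) :=
  RingQuot (fun x y : TensorAlgebra k Z => x ∈ R ∧ y = 0)

/-- The projection `T(Z) → T(Z)/(R)`. -/
def quotMk (R : Submodule k (TensorAlgebra k Z)) : TensorAlgebra k Z →ₐ[k] QuotAlg R :=
  RingQuot.mkAlgHom k _

/-- The augmentation `T(Z)/(R) → k` that kills the generators, for `R` in positive degree. -/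
def augmentation (R : Submodule k (TensorAlgebra k Z))
    (hR : ∀ x ∈ R, TensorAlgebra.algebraMapInv x = 0) : QuotAlg R →ₐ[k] k :=
  RingQuot.liftAlgHom k ⟨TensorAlgebra.algebraMapInv, by
    rintro x y ⟨hx, rfl⟩
    rw [hR x hx, map_zero]⟩

theorem partialSpace_le {U : Submodule k (TensorAlgebra k Z)} {j : ℕ}
    (h : U ≤ deg1 k Z ^ (j + 1)) : partialSpace U ≤ deg1 k Z ^ j := by
  refine Submodule.span_le.2 ?_
  rintro y ⟨ν, u, hu, rfl⟩
  have hu' := h hu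
  clear hu
  rw [pow_succ'] at hu'
  induction hu' using Submodule.mul_induction_on' with
  | mem_mul_mem x hx t ht =>
    obtain ⟨z, rfl⟩ := hx
    rw [contractFirst_ι_mul]
    exact Submodule.smul_mem _ _ ht
  | add x _ y _ hx hy =>
    rw [map_add]
    exact Submodule.add_mem _ hx hy

theorem tensorOf_mem {n m : ℕ} (b : Module.Basis (Fin n) k Z) (c : (Fin m → Fin n) → k) :
    tensorOf b c ∈ deg1 k Z ^ m := by
  refine Submodule.sum_mem _ fun i _ => Submodule.smul_mem _ _ ?_
  rw [TensorAlgebra.tprod_apply]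
  have h : ∀ (l : ℕ) (z : Fin l → Z),
      (List.ofFn fun s => TensorAlgebra.ι k (z s)).prod ∈ deg1 k Z ^ l := by
    intro l
    induction l with
    | zero => intro z; simp [Submodule.one_le.1 le_rfl]
    | succ l ih =>
      intro z
      rw [List.ofFn_succ, List.prod_cons, pow_succ']
      exact Submodule.mul_mem_mul ⟨_, rfl⟩ (ih _)
  exact h m _

theorem relSpace_le {n m N : ℕ} (b : Module.Basis (Fin n) k Z) (c : (Fin m → Fin n) → k)
    (h : N ≤ m) : relSpace b c N ≤ deg1 k Z ^ N := by
  have key : ∀ (r : ℕ) (U : Submodule k (TensorAlgebra k Z)),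
      U ≤ deg1 k Z ^ (N + r) → partialSpace^[r] U ≤ deg1 k Z ^ N := by
    intro r
    induction r with
    | zero => intro U hU; simpa using hU
    | succ r ih =>
      intro U hU
      rw [Function.iterate_succ_apply]
      exact ih _ (partialSpace_le hU)
  refine key _ _ ?_
  rw [Nat.add_sub_cancel' h, Submodule.span_singleton_le_iff_mem]
  exact tensorOf_mem b c

theorem relSpace_augmented {n m N : ℕ} (b : Module.Basis (Fin n) k Z)
    (c : (Fin m → Fin n) → k) (hN : 2 ≤ N) (h : N ≤ m) :
    ∀ x ∈ relSpace b c N, TensorAlgebra.algebraMapInv x = 0 := by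
  intro x hx
  have hx' := relSpace_le b c h hx
  clear hx
  obtain ⟨l, rfl⟩ : ∃ l, N = l + 1 := ⟨N - 1, by omega⟩
  rw [pow_succ'] at hx'
  clear h hN
  induction hx' using Submodule.mul_induction_on' with
  | mem_mul_mem x hx t ht =>
    obtain ⟨z, rfl⟩ := hx
    simp [TensorAlgebra.algebraMapInv]
  | add x _ y _ hx hy => rw [map_add, hx, hy, add_zero]

/-- The augmentation of the superpotential algebra `T(Z)/(∂^{m-N}(k s))`. -/
abbrev superAug {n m N : ℕ} (b : Module.Basis (Fin n) k Z) (c : (Fin m → Fin n) → k)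
    (hN : 2 ≤ N) (h : N ≤ m) : QuotAlg (relSpace b c N) →ₐ[k] k :=
  augmentation _ (relSpace_augmented b c hN h)

/-! ### `N`-Koszulity -/

/-- The degrees `0, 1, N, N + 1, 2N, 2N + 1, …` of the terms of the `N`-Koszul complex. -/
def koszulDegree (N i : ℕ) : ℕ := N * (i / 2) + i % 2

/-- `W_j = ⋂_{r+N+s=j} Z^{⊗ r} ⊗ R ⊗ Z^{⊗ s} ⊆ Z^{⊗ j}` (all of `Z^{⊗ j}` when `j < N`). -/
def koszulSpace (N : ℕ) (R : Submodule k (TensorAlgebra k Z)) (j : ℕ) :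
    Submodule k (TensorAlgebra k Z) :=
  deg1 k Z ^ j ⊓ ⨅ (r : ℕ) (s : ℕ) (_ : r + N + s = j), deg1 k Z ^ r * R * deg1 k Z ^ s

/-- `A ⊗ W_j` as a subspace of `A ⊗ T(Z)`, where `A = T(Z)/(R)`. -/
def koszulTerm (N : ℕ) (R : Submodule k (TensorAlgebra k Z)) (j : ℕ) :
    Submodule k (QuotAlg R ⊗[k] TensorAlgebra k Z) :=
  LinearMap.range (LinearMap.lTensor (QuotAlg R) (koszulSpace N R j).subtype)

/-- The map `A ⊗ T(Z) → A ⊗ T(Z)`, `a ⊗ z t ↦ a z ⊗ t`, `a ⊗ 1 ↦ 0`. -/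
def koszulD (R : Submodule k (TensorAlgebra k Z)) :
    QuotAlg R ⊗[k] TensorAlgebra k Z →ₗ[k] QuotAlg R ⊗[k] TensorAlgebra k Z :=
  (LinearMap.rTensor (TensorAlgebra k Z)
      (LinearMap.mul' k (QuotAlg R) ∘ₗ
        LinearMap.lTensor (QuotAlg R) ((quotMk R).toLinearMap ∘ₗ TensorAlgebra.ι k))) ∘ₗ
    (TensorProduct.assoc k (QuotAlg R) Z (TensorAlgebra k Z)).symm.toLinearMap ∘ₗ
    LinearMap.lTensor (QuotAlg R) (splitFirst k Z)

/-- `T(Z)/(R)`, with `R ⊆ Z^{⊗ N}`, is `N`-Koszul if its Koszul complex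
`⋯ → A ⊗ W_{2N} → A ⊗ W_{N+1} → A ⊗ W_N → A ⊗ Z → A`, with differentials alternately
`d` and `d^{N-1}`, is exact in every positive homological degree. -/
def IsNKoszul (N : ℕ) (R : Submodule k (TensorAlgebra k Z)) : Prop :=
  ∀ i : ℕ, ∀ x ∈ koszulTerm N R (koszulDegree N (i + 1)),
    ((koszulD R) ^ (koszulDegree N (i + 1) - koszulDegree N i)) x = 0 →
    ∃ y ∈ koszulTerm N R (koszulDegree N (i + 2)),
      ((koszulD R) ^ (koszulDegree N (i + 2) - koszulDegree N (i + 1))) y = x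

end Forms

/-! ### Artin-Schelter regularity -/

section Regular

variable {k : Type u} [Field k] {A : Type u} [Ring A] [Algebra k A]

/-- The trivial left module `k` of an augmented algebra. -/
def trivialLeft (ε : A →ₐ[k] k) : ModuleCat.{u} A :=
  (ModuleCat.restrictScalars ε.toRingHom).obj (ModuleCat.of k k)

/-- The trivial right module `k` of an augmented algebra. -/
def trivialRight (ε : A →ₐ[k] k) : ModuleCat.{u} Aᵐᵒᵖ :=
  (ModuleCat.restrictScalars
    (AlgHom.fromOpposite ε (fun _ _ => Commute.all _ _)).toRingHom).obj (ModuleCat.of k k)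

/-- Artin-Schelter regularity of dimension `d` for a connected graded algebra `A` with
augmentation `ε`: on both sides the global dimension of `A` is `d`, the injective dimension of
`A` over itself is `d`, and `Ext^i_A(k, A)` is `k` for `i = d` and zero for `i ≠ d`. -/
structure IsASRegular (ε : A →ₐ[k] k) (d : ℕ) : Prop where
  gldim_left : ⨆ M : ModuleCat.{u} A, CategoryTheory.projectiveDimension M = d
  gldim_right : ⨆ M : ModuleCat.{u} Aᵐᵒᵖ, CategoryTheory.projectiveDimension M = d
  injdim_left : CategoryTheory.injectiveDimension (ModuleCat.of A A) = d
  injdim_right : CategoryTheory.injectiveDimension (ModuleCat.of Aᵐᵒᵖ A) = d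
  ext_left_of_ne : ∀ i : ℕ, i ≠ d →
    Subsingleton (CategoryTheory.Abelian.Ext.{u} (trivialLeft ε) (ModuleCat.of A A) i)
  ext_left : Module.finrank k
    (CategoryTheory.Abelian.Ext.{u} (trivialLeft ε) (ModuleCat.of A A) d) = 1
  ext_right_of_ne : ∀ i : ℕ, i ≠ d →
    Subsingleton (CategoryTheory.Abelian.Ext.{u} (trivialRight ε) (ModuleCat.of Aᵐᵒᵖ A) i)
  ext_right : Module.finrank k
    (CategoryTheory.Abelian.Ext.{u} (trivialRight ε) (ModuleCat.of Aᵐᵒᵖ A) d) = 1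

end Regular

/-! ### Comodules -/

section Comodules

variable {k : Type u} [Field k] {K : Type v} [Ring K] [HopfAlgebra k K]

/-- `ρ : X → K ⊗ X` is a left `K`-comodule structure. -/
structure IsLeftCoaction {X : Type w} [AddCommGroup X] [Module k X] (ρ : X →ₗ[k] K ⊗[k] X) :
    Prop where
  coassoc : (TensorProduct.assoc k K K X).toLinearMap ∘ₗ
    LinearMap.rTensor X (Coalgebra.comul (R := k) (A := K)) ∘ₗ ρ = LinearMap.lTensor K ρ ∘ₗ ρ
  counit : (TensorProduct.lid k X).toLinearMap ∘ₗ
    LinearMap.rTensor X (Coalgebra.counit (R := k) (A := K)) ∘ₗ ρ = LinearMap.id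

/-- `ρ : X → X ⊗ K` is a right `K`-comodule structure. -/
structure IsRightCoaction {X : Type w} [AddCommGroup X] [Module k X] (ρ : X →ₗ[k] X ⊗[k] K) :
    Prop where
  coassoc : (TensorProduct.assoc k X K K).symm.toLinearMap ∘ₗ
    LinearMap.lTensor X (Coalgebra.comul (R := k) (A := K)) ∘ₗ ρ = LinearMap.rTensor K ρ ∘ₗ ρ
  counit : (TensorProduct.rid k X).toLinearMap ∘ₗ
    LinearMap.lTensor X (Coalgebra.counit (R := k) (A := K)) ∘ₗ ρ = LinearMap.id

/-- `φ : X → Y` is a map of left `K`-comodules. -/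
def IsLeftComoduleMap {X : Type*} {Y : Type*} [AddCommGroup X] [Module k X] [AddCommGroup Y]
    [Module k Y] (ρX : X →ₗ[k] K ⊗[k] X) (ρY : Y →ₗ[k] K ⊗[k] Y) (φ : X →ₗ[k] Y) : Prop :=
  ρY ∘ₗ φ = LinearMap.lTensor K φ ∘ₗ ρX

/-- `φ : X → Y` is a map of right `K`-comodules. -/
def IsRightComoduleMap {X : Type*} {Y : Type*} [AddCommGroup X] [Module k X] [AddCommGroup Y]
    [Module k Y] (ρX : X →ₗ[k] X ⊗[k] K) (ρY : Y →ₗ[k] Y ⊗[k] K) (φ : X →ₗ[k] Y) : Prop :=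
  ρY ∘ₗ φ = LinearMap.rTensor K φ ∘ₗ ρX

variable (k) in
/-- The map `g ⊗ - : X → K ⊗ X`. -/
def leftBy (g : K) (X : Type*) [AddCommGroup X] [Module k X] : X →ₗ[k] K ⊗[k] X :=
  TensorProduct.mk k K X g

variable (k) in
/-- The map `- ⊗ g : X → X ⊗ K`. -/
def rightBy (g : K) (X : Type*) [AddCommGroup X] [Module k X] : X →ₗ[k] X ⊗[k] K :=
  (TensorProduct.mk k X K).flip g

/-- The projection of the tensor algebra onto its degree `m` component. -/
def tensorComponent (k : Type u) [Field k] (X : Type w) [AddCommGroup X] [Module k X] (m : ℕ) :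
    TensorAlgebra k X →ₗ[k] ⨂[k]^m X :=
  DirectSum.component k ℕ (fun j => ⨂[k]^j X) m ∘ₗ TensorAlgebra.toDirectSum.toLinearMap

/-- The diagonal left coaction on `X^{⊗ m}`:
`x₁ ⊗ ⋯ ⊗ x_m ↦ ∑ x₁₍₋₁₎ ⋯ x_m₍₋₁₎ ⊗ (x₁₍₀₎ ⊗ ⋯ ⊗ x_m₍₀₎)`, computed as a product in
`K ⊗ T(X)`. -/
def leftTensorCoaction {X : Type w} [AddCommGroup X] [Module k X] (ρ : X →ₗ[k] K ⊗[k] X)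
    (m : ℕ) : ⨂[k]^m X →ₗ[k] K ⊗[k] (⨂[k]^m X) :=
  PiTensorProduct.lift
    ((LinearMap.lTensor K (tensorComponent k X m)).compMultilinearMap
      ((MultilinearMap.mkPiAlgebraFin k m (K ⊗[k] TensorAlgebra k X)).compLinearMap
        (fun _ => LinearMap.lTensor K (TensorAlgebra.ι k) ∘ₗ ρ)))

/-- The diagonal right coaction on `X^{⊗ m}`. -/
def rightTensorCoaction {X : Type w} [AddCommGroup X] [Module k X] (ρ : X →ₗ[k] X ⊗[k] K)
    (m : ℕ) : ⨂[k]^m X →ₗ[k] (⨂[k]^m X) ⊗[k] K :=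
  PiTensorProduct.lift
    ((LinearMap.rTensor K (tensorComponent k X m)).compMultilinearMap
      ((MultilinearMap.mkPiAlgebraFin k m (TensorAlgebra k X ⊗[k] K)).compLinearMap
        (fun _ => LinearMap.rTensor K (TensorAlgebra.ι k) ∘ₗ ρ)))

/-- The left coaction `ρ` on `T(Z)` induces a left comodule algebra structure on `T(Z)/(R)`:
`ρ'` is that structure. -/
def IsInducedLeft {Z : Type w} [AddCommGroup Z] [Module k Z]
    (R : Submodule k (TensorAlgebra k Z))
    (ρ : TensorAlgebra k Z →ₐ[k] K ⊗[k] TensorAlgebra k Z)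
    (ρ' : QuotAlg R →ₐ[k] K ⊗[k] QuotAlg R) : Prop :=
  IsLeftCoaction ρ'.toLinearMap ∧
    ∀ x, ρ' (quotMk R x) = LinearMap.lTensor K (quotMk R).toLinearMap (ρ x)

/-- The right coaction `ρ` on `T(Z)` induces a right comodule algebra structure on `T(Z)/(R)`:
`ρ'` is that structure. -/
def IsInducedRight {Z : Type w} [AddCommGroup Z] [Module k Z]
    (R : Submodule k (TensorAlgebra k Z))
    (ρ : TensorAlgebra k Z →ₐ[k] TensorAlgebra k Z ⊗[k] K)
    (ρ' : QuotAlg R →ₐ[k] QuotAlg R ⊗[k] K) : Prop :=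
  IsRightCoaction ρ'.toLinearMap ∧
    ∀ x, ρ' (quotMk R x) = LinearMap.rTensor K (quotMk R).toLinearMap (ρ x)

end Comodules

/-! ### The homological codeterminant

`Ext^i_A(k, k)`, for the trivial left module `k` of an augmented algebra `(A, ε)`, is the `i`-th
cohomology of `Hom_A(B, k)` with `B` the bar resolution of `k`, `B_i = A ⊗ A^{⊗ i}`; an element of
`Hom_A(B_i, Y)` for a trivial module `Y` is an `i`-linear map `A × ⋯ × A → Y`. -/

section Codeterminant

variable {k : Type u} [Field k] {A : Type w} [Ring A] [Algebra k A]

/-- `i`-cochains of the bar complex with values in the trivial module `Y`. -/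
abbrev BarCochain (k : Type u) [Field k] (A : Type w) [Ring A] [Algebra k A] (Y : Type*)
    [AddCommGroup Y] [Module k Y] (i : ℕ) :=
  MultilinearMap k (fun _ : Fin i => A) Y

/-- The bar differential:
`ε(a₀) f(a₁, …, a_i) + ∑_{j<i} (-1)^{j+1} f(…, a_j a_{j+1}, …) + (-1)^{i+1} f(a₀, …) ε(a_i)`. -/
def barDiff (ε : A →ₐ[k] k) {Y : Type*} [AddCommGroup Y] [Module k Y] {i : ℕ}
    (f : BarCochain k A Y i) (a : Fin (i + 1) → A) : Y :=
  ε (a 0) • f (fun s => a s.succ) +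
    (∑ j : Fin i, (-1 : k) ^ ((j : ℕ) + 1) • f (Fin.contractNth j.castSucc (· * ·) a)) +
    (-1 : k) ^ (i + 1) • ε (a (Fin.last i)) • f (fun s => a s.castSucc)

/-- Cocycles of the bar complex. -/
def IsBarCocycle (ε : A →ₐ[k] k) {Y : Type*} [AddCommGroup Y] [Module k Y] {i : ℕ}
    (f : BarCochain k A Y i) : Prop :=
  ∀ a : Fin (i + 1) → A, barDiff ε f a = 0

/-- Coboundaries of the bar complex. -/
def IsBarCoboundary (ε : A →ₐ[k] k) {Y : Type*} [AddCommGroup Y] [Module k Y] :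
    {i : ℕ} → BarCochain k A Y i → Prop
  | 0, f => f = 0
  | i + 1, f => ∃ b : BarCochain k A Y i, ∀ a : Fin (i + 1) → A, f a = barDiff ε b a

variable {K : Type v} [Ring K] [HopfAlgebra k K]

/-- For a left coaction on `A`, the coaction on cochains, through the antipode: the cochain
`(a₁, …, a_i) ↦ ∑ S(a₁₍₋₁₎ ⋯ a_i₍₋₁₎) f(a₁₍₀₎, …, a_i₍₀₎)` with values in `K`. -/
def leftBarCoaction (ρ : A →ₗ[k] K ⊗[k] A) {i : ℕ} (f : BarCochain k A k i) :
    BarCochain k A K i :=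
  (HopfAlgebra.antipode k (A := K) ∘ₗ (TensorProduct.rid k K).toLinearMap ∘ₗ
    LinearMap.lTensor K (PiTensorProduct.lift f) ∘ₗ
    leftTensorCoaction ρ i).compMultilinearMap (PiTensorProduct.tprod k)

/-- For a right coaction on `A`, the coaction on cochains, through the antipode: the cochain
`(a₁, …, a_i) ↦ ∑ f(a₁₍₀₎, …, a_i₍₀₎) S(a₁₍₁₎ ⋯ a_i₍₁₎)` with values in `K`. -/
def rightBarCoaction (ρ : A →ₗ[k] A ⊗[k] K) {i : ℕ} (f : BarCochain k A k i) :
    BarCochain k A K i :=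
  (HopfAlgebra.antipode k (A := K) ∘ₗ (TensorProduct.lid k K).toLinearMap ∘ₗ
    LinearMap.rTensor K (PiTensorProduct.lift f) ∘ₗ
    rightTensorCoaction ρ i).compMultilinearMap (PiTensorProduct.tprod k)

/-- `D` is the homological codeterminant of a left coaction on `A`: `D` is invertible,
`Ext^d_A(k, k)` is nonzero, and the coaction takes each class `𝔢` in it to `𝔢 ⊗ D⁻¹`. -/
def IsLeftHomCodet (ε : A →ₐ[k] k) (ρ : A →ₗ[k] K ⊗[k] A) (d : ℕ) (D : K) : Prop :=
  ∃ D' : K, D * D' = 1 ∧ D' * D = 1 ∧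
    (∃ f : BarCochain k A k d, IsBarCocycle ε f ∧ ¬ IsBarCoboundary ε f) ∧
    ∀ f : BarCochain k A k d, IsBarCocycle ε f →
      IsBarCoboundary ε (leftBarCoaction ρ f - f.smulRight D')

/-- `D` is the homological codeterminant of a right coaction on `A`: `Ext^d_A(k, k)` is nonzero,
and the coaction takes each class `𝔢` in it to `D ⊗ 𝔢`. -/
def IsRightHomCodet (ε : A →ₐ[k] k) (ρ : A →ₗ[k] A ⊗[k] K) (d : ℕ) (D : K) : Prop :=
  (∃ f : BarCochain k A k d, IsBarCocycle ε f ∧ ¬ IsBarCoboundary ε f) ∧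
    ∀ f : BarCochain k A k d, IsBarCocycle ε f →
      IsBarCoboundary ε (rightBarCoaction ρ f - f.smulRight D)

end Codeterminant

/-! ### Index notation -/

/-- The multi-index `(l₁, …, l_{m-N}, i₁, …, i_N)`. -/
def joinIdx {n m N : ℕ} (h : N ≤ m) (l : Fin (m - N) → Fin n) (i : Fin N → Fin n) :
    Fin m → Fin n :=
  fun s => Fin.append l i (Fin.cast (by omega) s)

/-- The product `a_{i₁ j₁} ⋯ a_{i_m j_m}`. -/
def wordProd {K : Type v} [Ring K] {n m : ℕ} (a : Fin n → Fin n → K) (i j : Fin m → Fin n) : K :=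
  (List.ofFn fun s => a (i s) (j s)).prod

/-- The coefficients `t(b_{i₁}, …, b_{i_m})` of an `m`-linear form. -/
def coeff {k : Type u} [Field k] {Z : Type w} [AddCommGroup Z] [Module k Z] {n m : ℕ}
    (b : Module.Basis (Fin n) k Z) (t : MultilinearMap k (fun _ : Fin m => Z) k)
    (i : Fin m → Fin n) : k :=
  t (fun s => b (i s))

end Preregular

end

open Preregular

/-! Write `Z` for the space of generators, `A = T(Z)/(R)`, `W_j` for the Koszul spaces and `s` for
the tensor `e^*` or `f^*`. Everything rests on one fact: the last Koszul space `W_m` is the line `k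
s` (`koszulSpace_eq_span_tensorOf`). It contains `s` because a preregular form is cyclic up to a
twist, so that contracting letters of `s` at both ends gives nothing beyond contracting them at one
end (`tensorOf_mem_koszulSpace`). It is no larger because `Ext^d(k, A)` is one-dimensional: since
the global dimension is `d`, every functional on `W_m` is the augmentation of a `d`-cocycle with
values in `A`; two such cocycles are dependent modulo coboundaries; and coboundaries die under the
augmentation, the Koszul complex being minimal (`koszulSpace_eq_span`).

Conditions (a) and (b) agree because the ideal `(R)` meets degree `N` in `R` only
(`mem_of_quotMk_eq_zero`). If `R` is stable under the coaction, then so are the spaces `Z^r R Z^s`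
and their intersection `W_m = k s`; hence `ρ(s) = g ⊗ s`, and the coaction axioms make `g`
grouplike. Conversely, the antipode inverts the matrix `a`, so contractions of a stable space are
stable, and `R` is an iterated contraction of `s`. As `K` is not commutative and its antipode need
not be bijective, the side matters: in the left version the inverse is suited to last letters, and
cyclicity is used again (`coaction_relSpace_mem_of_right_inverse`); in the right version it is
suited to first letters (`coaction_relSpace_mem_of_left_inverse`). Conditions (c), (d), (e) are one
system of equations in coordinates.

For the codeterminant, the Koszul and the bar complex both resolve `k`, and cutting words into
blocks is a chain map between them (`barD_wordToBarLin`) that respects the coactions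
(`leftTensorCoaction_wordToBar`). A `d`-cocycle of the bar complex is therefore determined, up to
coboundaries, by its value on `s`, and the coaction through the antipode multiplies this value by
`S(g) = g⁻¹` (`isBarCoboundary_leftBarCoaction_sub_iff`). By the two conventions this is `D⁻¹` on
the left and `D` on the right. -/

noncomputable section

namespace Preregular

universe u v w

/-! ### Dimension shifting along a projective resolution -/

section Syzygies

open CategoryTheory CategoryTheory.Abelian

variable {C : Type v} [Category.{w} C] [Abelian C] [HasExt.{u} C]

/-- A projective resolution of `Ω 0`, cut into the short exact sequences of its syzygies. -/
structure SyzygyResolution (C : Type v) [Category.{w} C] [Abelian C] where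
  /-- the terms -/
  P : ℕ → C
  /-- the syzygies -/
  Ω : ℕ → C
  /-- the covering of each syzygy -/
  cov : ∀ i, P i ⟶ Ω i
  /-- the inclusion of the next syzygy -/
  inc : ∀ i, Ω (i + 1) ⟶ P i
  zero : ∀ i, inc i ≫ cov i = 0
  exact : ∀ i, (ShortComplex.mk (inc i) (cov i) (zero i)).ShortExact
  proj : ∀ i, Projective (P i)

namespace SyzygyResolution

variable (S T : SyzygyResolution C)

instance (i : ℕ) : Projective (S.P i) := S.proj i

instance (i : ℕ) : Epi (S.cov i) := (S.exact i).epi_g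

/-- The iterated extension class in `Ext^i(Ω 0, Ω i)`. -/
def ext : (i : ℕ) → Ext.{u} (S.Ω 0) (S.Ω i) i
  | 0 => Ext.mk₀ (𝟙 _)
  | i + 1 => (ext i).comp (S.exact i).extClass rfl

/-- The obstruction lies in `Ext^{1+j}(P i, Y)`, which vanishes because `P i` is projective and the
degree is positive. -/
theorem extClass_comp_surjective (i j : ℕ) (Y : C) (x : Ext.{u} (S.Ω i) Y (1 + j)) :
    ∃ y : Ext.{u} (S.Ω (i + 1)) Y j, (S.exact i).extClass.comp y rfl = x :=
  Ext.contravariant_sequence_exact₃ (S.exact i) Y x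
    (Ext.eq_zero_of_hasProjectiveDimensionLT _ 1 (by omega)) rfl

/-- The kernel of the connecting map comes from `Ext^{j+1}(P i, Y) = 0`. A positive degree is
essential: in degree zero the kernel consists of the maps that extend to `P i`, which is what
`exists_extension` exploits. -/
theorem extClass_comp_eq_zero (i j : ℕ) (Y : C) (y : Ext.{u} (S.Ω (i + 1)) Y (j + 1))
    (h : (S.exact i).extClass.comp y rfl = 0) : y = 0 := by
  obtain ⟨x, rfl⟩ := Ext.contravariant_sequence_exact₁ (S.exact i) Y y rfl h
  rw [Ext.eq_zero_of_hasProjectiveDimensionLT x 1 (by omega), Ext.comp_zero]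

theorem ext_comp_surjective {i j l : ℕ} (hl : i + j = l) {Y : C} (x : Ext.{u} (S.Ω 0) Y l) :
    ∃ y : Ext.{u} (S.Ω i) Y j, (S.ext i).comp y hl = x := by
  induction i generalizing j with
  | zero =>
    obtain rfl : l = j := by omega
    exact ⟨x, Ext.mk₀_id_comp x⟩
  | succ i ih =>
    obtain ⟨y, hy⟩ := ih (j := 1 + j) (by omega)
    obtain ⟨z, rfl⟩ := S.extClass_comp_surjective i j Y y
    refine ⟨z, ?_⟩
    rw [← hy]
    exact Ext.comp_assoc _ _ _ _ _ (by omega)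

theorem ext_comp_eq_zero {i j l : ℕ} (hl : i + (j + 1) = l) {Y : C}
    (y : Ext.{u} (S.Ω i) Y (j + 1)) (h : (S.ext i).comp y hl = 0) : y = 0 := by
  induction i generalizing j with
  | zero =>
    obtain rfl : l = j + 1 := by omega
    simpa [ext] using h
  | succ i ih =>
    refine S.extClass_comp_eq_zero i j Y y ?_
    have h' : (S.ext i).comp ((S.exact i).extClass.comp y rfl) (show i + _ = l by omega) = 0 := by
      rw [← h]
      exact (Ext.comp_assoc _ _ _ _ _ (by omega)).symm
    obtain ⟨q, hq⟩ : ∃ q, q = 1 + (j + 1) := ⟨_, rfl⟩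
    obtain rfl : q = (j + 1) + 1 := by omega
    -- The degrees `1 + (j + 1)` and `(j + 1) + 1` are not definitionally equal, so the induction
    -- hypothesis is restated for a variable degree `q`.
    have h'' : ∀ (q : ℕ) (z : Ext.{u} (S.Ω i) Y q) (hz : i + q = l), q = (j + 1) + 1 →
        (S.ext i).comp z hz = 0 → z = 0 := by
      rintro q z hz rfl h
      exact ih _ z h
    exact h'' _ _ _ (by omega) h'

/-- Every class in `Ext^i(Ω 0, Y)` is induced by a morphism from the `i`-th syzygy. -/
theorem exists_hom {i : ℕ} {Y : C} (x : Ext.{u} (S.Ω 0) Y i) :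
    ∃ h : S.Ω i ⟶ Y, (S.ext i).comp (Ext.mk₀ h) (add_zero i) = x := by
  obtain ⟨y, hy⟩ := S.ext_comp_surjective (add_zero i) x
  exact ⟨Ext.homEquiv₀ y, by rw [Ext.mk₀_homEquiv₀_apply, hy]⟩

/-- A morphism from a syzygy that induces the zero class extends to the resolution. -/
theorem exists_extension {i : ℕ} {Y : C} (h : S.Ω (i + 1) ⟶ Y)
    (h0 : (S.ext.{u} (i + 1)).comp (Ext.mk₀ h) (add_zero (i + 1)) = 0) :
    ∃ l : S.P i ⟶ Y, S.inc i ≫ l = h := by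
  -- The class `ext i` can be cancelled in positive degree, so the obstruction to extending `h`
  -- vanishes already in `Ext^1(Ω i, Y)`.
  have h1 : (S.exact i).extClass.comp (Ext.mk₀ h) (add_zero 1) = 0 := by
    refine S.ext_comp_eq_zero.{u} (i := i) (j := 0) rfl _ ?_
    rw [← h0]
    exact (Ext.comp_assoc _ _ _ _ _ (by omega)).symm
  obtain ⟨x, hx⟩ := Ext.contravariant_sequence_exact₁ (S.exact i) Y _ _ h1
  refine ⟨Ext.homEquiv₀ x, ?_⟩
  rw [← Ext.mk₀_homEquiv₀_apply x] at hx
  exact (Ext.mk₀_bijective _ _).1 (by rw [← hx, Ext.mk₀_comp_mk₀])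

/-- A chain map between resolutions is compatible with the iterated extension classes. -/
theorem exists_syzygy_map (c : ∀ i, S.P i ⟶ T.P i) (s : S.Ω 0 ⟶ T.Ω 0)
    (h0 : S.cov 0 ≫ s = c 0 ≫ T.cov 0)
    (hc : ∀ i, S.cov (i + 1) ≫ S.inc i ≫ c i = c (i + 1) ≫ T.cov (i + 1) ≫ T.inc i) (i : ℕ) :
    ∃ t : S.Ω i ⟶ T.Ω i, S.cov i ≫ t = c i ≫ T.cov i ∧
      (S.ext.{u} i).comp (Ext.mk₀ t) (add_zero i) =
        (Ext.mk₀ s).comp (T.ext i) (zero_add i) := by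
  induction i with
  | zero => exact ⟨s, h0, by simp [ext]⟩
  | succ i ih =>
    obtain ⟨t, ht, he⟩ := ih
    have := (T.exact i).mono_f
    have hw : (S.inc i ≫ c i) ≫ T.cov i = 0 := by
      rw [Category.assoc, ← ht, ← Category.assoc, S.zero, Limits.zero_comp]
    -- The chain map carries the kernel of `S.cov i` into that of `T.cov i`, and these kernels are
    -- the next syzygies.
    let t' : S.Ω (i + 1) ⟶ T.Ω (i + 1) := (T.exact i).exact.lift (S.inc i ≫ c i) hw
    have ht' : t' ≫ T.inc i = S.inc i ≫ c i := (T.exact i).exact.lift_f _ hw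
    refine ⟨t', ?_, ?_⟩
    · rw [← cancel_mono (T.inc i)]
      simp only [Category.assoc, ht', hc]
    · have hn := ShortComplex.ShortExact.extClass_naturality.{u} (S.exact i) (T.exact i)
        { τ₁ := t', τ₂ := c i, τ₃ := t, comm₁₂ := ht', comm₂₃ := ht.symm }
      simp only [ext] at hn ⊢
      rw [Ext.comp_assoc_of_third_deg_zero, hn, ← Ext.comp_assoc_of_second_deg_zero, he]
      exact Ext.comp_assoc _ _ _ _ _ (by omega)

-- Passing to the next syzygy lowers a bound on the projective dimension by one, because the terms
-- are projective; after `i` steps the bound is that of a projective object.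
omit [HasExt.{u} C] in
theorem projective_syzygy {i : ℕ} (h : HasProjectiveDimensionLT (S.Ω 0) (i + 1)) :
    Projective (S.Ω i) := by
  have key : ∀ j l, j + l = i → HasProjectiveDimensionLT (S.Ω j) (l + 1) := by
    intro j
    induction j with
    | zero => intro l hl; obtain rfl : l = i := by omega
              exact h
    | succ j ih =>
      intro l hl
      exact ((S.exact j).hasProjectiveDimensionLT_X₃_iff l (S.proj j)).1 (ih (l + 1) (by omega))
  have := key i 0 (by omega)
  infer_instance

/-- The differentials of the resolution. -/
def d (i : ℕ) : S.P (i + 1) ⟶ S.P i := S.cov (i + 1) ≫ S.inc i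

omit [HasExt.{u} C] in
theorem exists_desc {i : ℕ} {Y : C} (f : S.P i ⟶ Y) (hf : S.d i ≫ f = 0) :
    ∃ h : S.Ω i ⟶ Y, S.cov i ≫ h = f := by
  have h0 : S.inc i ≫ f = 0 := by
    rw [← cancel_epi (S.cov (i + 1)), ← Category.assoc]
    exact hf.trans Limits.comp_zero.symm
  have := (S.exact i).epi_g
  exact (S.exact i).exact.desc' f h0

omit [HasExt.{u} C] in
/-- A cocycle whose restriction along a comparison map vanishes is a coboundary. -/
theorem exists_eq_d_comp (c : ∀ i, S.P i ⟶ T.P i) (s : S.Ω 0 ≅ T.Ω 0)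
    (h0 : S.cov 0 ≫ s.hom = c 0 ≫ T.cov 0) (hc : ∀ i, S.d i ≫ c i = c (i + 1) ≫ T.d i)
    {i : ℕ} {Y : C} (f : T.P (i + 1) ⟶ Y) (hf : T.d (i + 1) ≫ f = 0) (hcf : c (i + 1) ≫ f = 0) :
    ∃ l : T.P i ⟶ Y, T.d i ≫ l = f := by
  -- Any choice of `Ext` groups serves, since they occur only inside the argument.
  let := HasExt.standard C
  obtain ⟨h, rfl⟩ := T.exists_desc f hf
  obtain ⟨t, ht, he⟩ := S.exists_syzygy_map T c s.hom h0
    (fun i => by simpa [d] using hc i) (i + 1)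
  have hth : t ≫ h = 0 := by
    rw [← cancel_epi (S.cov (i + 1)), ← Category.assoc, ht, Category.assoc, hcf, Limits.comp_zero]
  obtain ⟨l, hl⟩ := T.exists_extension h (by
    -- Naturality of the iterated classes turns the class of `h`, pulled back along `s`, into the
    -- class of `t ≫ h = 0`; as `s` is invertible, the class of `h` is zero.
    have h1 : (Ext.mk₀ s.hom).comp ((T.ext (i + 1)).comp (Ext.mk₀ h) (add_zero (i + 1)))
        (zero_add (i + 1)) = 0 := by
      rw [← Ext.comp_assoc_of_third_deg_zero, ← he, Ext.comp_assoc_of_third_deg_zero,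
        Ext.mk₀_comp_mk₀, hth, Ext.mk₀_zero, Ext.comp_zero]
    have h2 := congrArg (fun x => (Ext.mk₀ s.inv).comp x (zero_add (i + 1))) h1
    simpa using h2)
  exact ⟨l, by rw [d, Category.assoc, hl]⟩

omit [HasExt.{u} C] in
/-- Every cocycle is, up to a coboundary, the restriction of a cocycle along a comparison map. -/
theorem exists_restrict (c : ∀ i, S.P i ⟶ T.P i) (s : S.Ω 0 ≅ T.Ω 0)
    (h0 : S.cov 0 ≫ s.hom = c 0 ≫ T.cov 0) (hc : ∀ i, S.d i ≫ c i = c (i + 1) ≫ T.d i)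
    {i : ℕ} {Y : C} (g : S.P (i + 1) ⟶ Y) (hg : S.d (i + 1) ≫ g = 0) :
    ∃ f : T.P (i + 1) ⟶ Y, T.d (i + 1) ≫ f = 0 ∧
      ∃ l : S.P i ⟶ Y, c (i + 1) ≫ f - g = S.d i ≫ l := by
  let := HasExt.standard C
  obtain ⟨h, rfl⟩ := S.exists_desc g hg
  obtain ⟨t, ht, he⟩ := S.exists_syzygy_map T c s.hom h0
    (fun i => by simpa [d] using hc i) (i + 1)
  -- The class of the given cocycle is carried over along `s⁻¹` and represented on the syzygy of
  -- `T`.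
  obtain ⟨f, hf⟩ := T.exists_hom ((Ext.mk₀ s.inv).comp
    ((S.ext (i + 1)).comp (Ext.mk₀ h) (add_zero (i + 1))) (zero_add (i + 1)))
  refine ⟨T.cov (i + 1) ≫ f, ?_, ?_⟩
  · rw [d, Category.assoc, ← Category.assoc (T.inc _), T.zero, Limits.zero_comp,
      Limits.comp_zero]
  -- By the choice of `f`, the maps `t ≫ f` and `h` induce the same class, so their difference
  -- extends to `P i`.
  · obtain ⟨l, hl⟩ := S.exists_extension (t ≫ f - h) (by
      rw [sub_eq_add_neg, Ext.mk₀_add, Ext.comp_add, ← Ext.mk₀_comp_mk₀,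
        ← Ext.comp_assoc_of_third_deg_zero, he, Ext.comp_assoc_of_third_deg_zero, hf,
        Ext.mk₀_comp_mk₀_assoc, s.hom_inv_id, Ext.mk₀_id_comp, ← Ext.comp_add, ← Ext.mk₀_add,
        add_neg_cancel, Ext.mk₀_zero, Ext.comp_zero])
    refine ⟨l, ?_⟩
    rw [d, Category.assoc, hl, Preadditive.comp_sub, ← Category.assoc, ← Category.assoc, ht]

/-- If `Ext^{i+1}(Ω 0, Y)` is one-dimensional, two cocycles are dependent up to a coboundary. -/
theorem exists_dependent {k : Type*} [Field k] [Linear k C] {i : ℕ} {Y : C}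
    (h1 : Module.finrank k (Ext.{u} (S.Ω 0) Y (i + 1)) = 1)
    (f g : S.P (i + 1) ⟶ Y) (hf : S.d (i + 1) ≫ f = 0) (hg : S.d (i + 1) ≫ g = 0) :
    ∃ α β : k, (α ≠ 0 ∨ β ≠ 0) ∧ ∃ l : S.P i ⟶ Y, α • f + β • g = S.d i ≫ l := by
  obtain ⟨f, rfl⟩ := S.exists_desc f hf
  obtain ⟨g, rfl⟩ := S.exists_desc g hg
  obtain ⟨α, β, hne, hz⟩ : ∃ α β : k, (α ≠ 0 ∨ β ≠ 0) ∧
      α • (S.ext.{u} (i + 1)).comp (Ext.mk₀ f) (add_zero (i + 1)) +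
        β • (S.ext.{u} (i + 1)).comp (Ext.mk₀ g) (add_zero (i + 1)) = 0 := by
    set x := (S.ext.{u} (i + 1)).comp (Ext.mk₀ f) (add_zero (i + 1))
    set y := (S.ext.{u} (i + 1)).comp (Ext.mk₀ g) (add_zero (i + 1))
    obtain ⟨v, -, hv⟩ := finrank_eq_one_iff'.1 h1
    obtain ⟨a, ha⟩ := hv x
    obtain ⟨b, hb⟩ := hv y
    by_cases h : a = 0
    · exact ⟨1, 0, by simp, by rw [← ha, h]; simp⟩
    · exact ⟨b, -a, Or.inr (neg_ne_zero.2 h), by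
        rw [← ha, ← hb, smul_smul, smul_smul, ← add_smul]; simp [mul_comm]⟩
  refine ⟨α, β, hne, ?_⟩
  obtain ⟨l, hl⟩ := S.exists_extension.{u} (α • f + β • g) (by
    rw [Ext.mk₀_add, Ext.mk₀_smul, Ext.mk₀_smul, Ext.comp_add, Ext.comp_smul, Ext.comp_smul, hz])
  exact ⟨l, by rw [d, Category.assoc, hl]; simp⟩

theorem exists_ne_zero {i : ℕ} {Y : C} (x : Ext.{u} (S.Ω 0) Y i) (hx : x ≠ 0) :
    ∃ f : S.P i ⟶ Y, f ≠ 0 := by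
  obtain ⟨h, rfl⟩ := S.exists_hom x
  refine ⟨S.cov i ≫ h, fun h0 => hx ?_⟩
  obtain rfl : h = 0 := by rw [← cancel_epi (S.cov i), h0, Limits.comp_zero]
  simp

-- The map `r` is the idempotent of `P i` that belongs to a splitting of the projective syzygy `Ω
-- i`. Composition with it turns every map from `P i` into a cocycle.
omit [HasExt.{u} C] in
theorem exists_split {i : ℕ} (h : HasProjectiveDimensionLT (S.Ω 0) (i + 1)) :
    ∃ r : S.P i ⟶ S.P i, S.d i ≫ r = 0 ∧ r ≫ S.cov i = S.cov i := by
  have := S.projective_syzygy h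
  refine ⟨S.cov i ≫ Projective.factorThru (𝟙 _) (S.cov i), ?_, ?_⟩
  · rw [d, Category.assoc, ← Category.assoc (S.inc i), S.zero, Limits.zero_comp, Limits.comp_zero]
  · rw [Category.assoc, Projective.factorThru_comp, Category.comp_id]

end SyzygyResolution

/-! ### Exact complexes of projective modules -/

section Modules

variable {A : Type u} [Ring A] (P : ℕ → Type u) [∀ i, AddCommGroup (P i)] [∀ i, Module A (P i)]
  [∀ i, Module.Projective A (P i)] (d : ∀ i, P (i + 1) →ₗ[A] P i) {M : ModuleCat.{u} A}
  (π : P 0 →ₗ[A] M)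

/-- The successive kernels in a complex of modules over `M`. -/
def syzygyModule : ℕ → ModuleCat.{u} A
  | 0 => M
  | 1 => ModuleCat.of A (LinearMap.ker π)
  | i + 2 => ModuleCat.of A (LinearMap.ker (d i))

variable {P d π} in
/-- The syzygy resolution of an exact complex of projective modules. -/
def SyzygyResolution.ofExact (hπ : Function.Surjective π)
    (h0 : Function.Exact (d 0) π) (h : ∀ i, Function.Exact (d (i + 1)) (d i)) :
    SyzygyResolution (ModuleCat.{u} A) where
  P i := ModuleCat.of A (P i)
  Ω := syzygyModule P d π
  cov
    | 0 => ModuleCat.ofHom π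
    | 1 => ModuleCat.ofHom ((d 0).codRestrict _ fun x => h0.apply_apply_eq_zero x)
    | i + 2 => ModuleCat.ofHom ((d (i + 1)).codRestrict _ fun x => (h i).apply_apply_eq_zero x)
  inc
    | 0 => ModuleCat.ofHom (LinearMap.ker π).subtype
    | i + 1 => ModuleCat.ofHom (LinearMap.ker (d i)).subtype
  zero
    | 0 => by ext x; exact x.2
    | 1 => by ext x; exact Subtype.ext x.2
    | i + 2 => by ext x; exact Subtype.ext x.2
  exact := by
    rintro (_ | _ | i)
    · exact ModuleCat.shortComplex_shortExact _ (LinearMap.exact_subtype_ker_map _)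
        (Submodule.subtype_injective _) hπ
    · refine ModuleCat.shortComplex_shortExact _ (fun x => ?_) (Submodule.subtype_injective _)
        (fun x => ?_)
      · exact Subtype.ext_iff.trans (LinearMap.exact_subtype_ker_map (d 0) x)
      · obtain ⟨y, hy⟩ := (h0 x.1).1 x.2
        exact ⟨y, Subtype.ext hy⟩
    · refine ModuleCat.shortComplex_shortExact _ (fun x => ?_) (Submodule.subtype_injective _)
        (fun x => ?_)
      · exact Subtype.ext_iff.trans (LinearMap.exact_subtype_ker_map (d (i + 1)) x)
      · obtain ⟨y, hy⟩ := (h i x.1).1 x.2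
        exact ⟨y, Subtype.ext hy⟩
  proj i := by
    rw [← IsProjective.iff_projective]
    infer_instance

variable {P d π}

theorem SyzygyResolution.ofExact_d (hπ : Function.Surjective π)
    (h0 : Function.Exact (d 0) π) (h : ∀ i, Function.Exact (d (i + 1)) (d i)) (i : ℕ) :
    (SyzygyResolution.ofExact hπ h0 h).d i = ModuleCat.ofHom (d i) := by
  cases i <;> rfl

variable {Q : ℕ → Type u} [∀ i, AddCommGroup (Q i)] [∀ i, Module A (Q i)]
  [∀ i, Module.Projective A (Q i)] {e : ∀ i, Q (i + 1) →ₗ[A] Q i}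
  {τ : Q 0 →ₗ[A] M}

section Comparison

variable (hπ : Function.Surjective π)
    (h0 : Function.Exact (d 0) π) (h : ∀ i, Function.Exact (d (i + 1)) (d i))
    (hτ : Function.Surjective τ)
    (h0' : Function.Exact (e 0) τ) (h' : ∀ i, Function.Exact (e (i + 1)) (e i))
    (c : ∀ i, P i →ₗ[A] Q i) (hc0 : τ ∘ₗ c 0 = π) (hc : ∀ i, c i ∘ₗ d i = e i ∘ₗ c (i + 1))
    {Y : Type u} [AddCommGroup Y] [Module A Y] {i : ℕ}

include hπ h0 h hτ h0' h' hc0 hc in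
theorem exists_eq_comp_of_comparison (f : Q (i + 1) →ₗ[A] Y) (hf : f ∘ₗ e (i + 1) = 0)
    (hcf : f ∘ₗ c (i + 1) = 0) : ∃ l : Q i →ₗ[A] Y, l ∘ₗ e i = f := by
  obtain ⟨l, hl⟩ := (SyzygyResolution.ofExact hπ h0 h).exists_eq_d_comp
    (SyzygyResolution.ofExact hτ h0' h') (fun i => ModuleCat.ofHom (c i)) (Iso.refl _)
    (by ext x; exact (LinearMap.congr_fun hc0 x).symm)
    (fun i => by
      rw [SyzygyResolution.ofExact_d, SyzygyResolution.ofExact_d]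
      ext x; exact LinearMap.congr_fun (hc i) x)
    (i := i) (ModuleCat.ofHom f)
    (by rw [SyzygyResolution.ofExact_d]; ext x; exact LinearMap.congr_fun hf x)
    (by ext x; exact LinearMap.congr_fun hcf x)
  rw [SyzygyResolution.ofExact_d] at hl
  exact ⟨l.hom, congrArg ModuleCat.Hom.hom hl⟩

include hπ h0 h hτ h0' h' hc0 hc in
theorem exists_restrict_of_comparison (g : P (i + 1) →ₗ[A] Y) (hg : g ∘ₗ d (i + 1) = 0) :
    ∃ f : Q (i + 1) →ₗ[A] Y, f ∘ₗ e (i + 1) = 0 ∧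
      ∃ l : P i →ₗ[A] Y, f ∘ₗ c (i + 1) - g = l ∘ₗ d i := by
  obtain ⟨f, hf, l, hl⟩ := (SyzygyResolution.ofExact hπ h0 h).exists_restrict
    (SyzygyResolution.ofExact hτ h0' h') (fun i => ModuleCat.ofHom (c i)) (Iso.refl _)
    (by ext x; exact (LinearMap.congr_fun hc0 x).symm)
    (fun i => by
      rw [SyzygyResolution.ofExact_d, SyzygyResolution.ofExact_d]
      ext x; exact LinearMap.congr_fun (hc i) x)
    (i := i) (ModuleCat.ofHom g)
    (by rw [SyzygyResolution.ofExact_d]; ext x; exact LinearMap.congr_fun hg x)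
  rw [SyzygyResolution.ofExact_d] at hf hl
  exact ⟨f.hom, congrArg ModuleCat.Hom.hom hf, l.hom, congrArg ModuleCat.Hom.hom hl⟩

end Comparison

section OneDimensional

variable {k : Type u} [Field k] [Algebra k A] (hπ : Function.Surjective π)
    (h0 : Function.Exact (d 0) π) (h : ∀ i, Function.Exact (d (i + 1)) (d i))
    {Y : Type u} [AddCommGroup Y] [Module A Y] [Module k Y] [IsScalarTower k A Y] {i : ℕ}

include hπ h0 h in
theorem exists_dependent_of_finrank_ext
    (h1 : Module.finrank k (Ext.{u} M (ModuleCat.of A A) (i + 1)) = 1)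
    (f g : P (i + 1) →ₗ[A] A) (hf : f ∘ₗ d (i + 1) = 0) (hg : g ∘ₗ d (i + 1) = 0) :
    ∃ α β : k, (α ≠ 0 ∨ β ≠ 0) ∧ ∃ l : P i →ₗ[A] A, ∀ x,
      α • f x + β • g x = l (d i x) := by
  obtain ⟨α, β, hne, l, hl⟩ := (SyzygyResolution.ofExact hπ h0 h).exists_dependent (k := k)
    (Y := ModuleCat.of A A) h1 (ModuleCat.ofHom f) (ModuleCat.ofHom g)
    (by rw [SyzygyResolution.ofExact_d]; ext x; exact LinearMap.congr_fun hf x)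
    (by rw [SyzygyResolution.ofExact_d]; ext x; exact LinearMap.congr_fun hg x)
  rw [SyzygyResolution.ofExact_d] at hl
  refine ⟨α, β, hne, l.hom, fun x => ?_⟩
  rw [Algebra.smul_def, Algebra.smul_def]
  exact LinearMap.congr_fun (congrArg ModuleCat.Hom.hom hl) x

include hπ h0 h in
theorem exists_ne_zero_of_finrank_ext
    (h1 : Module.finrank k (Ext.{u} M (ModuleCat.of A A) i) = 1) :
    ∃ f : P i →ₗ[A] A, f ≠ 0 := by
  have : Nontrivial (Ext.{u} M (ModuleCat.of A A) i) :=
    Module.nontrivial_of_finrank_pos (R := k) (by omega)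
  obtain ⟨x, hx⟩ := exists_ne (0 : Ext.{u} M (ModuleCat.of A A) i)
  obtain ⟨f, hf⟩ := (SyzygyResolution.ofExact hπ h0 h).exists_ne_zero x hx
  exact ⟨f.hom, fun h => hf (ModuleCat.hom_ext h)⟩

-- Since `r` induces the identity on the syzygy, `x - r x` is a cycle, hence a boundary.
include hπ h0 h in
theorem exists_split_of_projectiveDimension
    (hM : HasProjectiveDimensionLT M (i + 1 + 1)) :
    ∃ r : P (i + 1) →ₗ[A] P (i + 1), r ∘ₗ d (i + 1) = 0 ∧
      ∀ x, x - r x ∈ LinearMap.range (d (i + 1)) := by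
  obtain ⟨r, hr, hr'⟩ := (SyzygyResolution.ofExact hπ h0 h).exists_split (i := i + 1) hM
  rw [SyzygyResolution.ofExact_d] at hr
  let r' : P (i + 1) →ₗ[A] P (i + 1) := r.hom
  refine ⟨r', congrArg ModuleCat.Hom.hom hr, fun x => ?_⟩
  have hx : d i (r' x) = d i x := by
    have h2 : r ≫ (SyzygyResolution.ofExact hπ h0 h).d i =
        (SyzygyResolution.ofExact hπ h0 h).d i := by
      rw [SyzygyResolution.d, ← Category.assoc, hr']
    rw [SyzygyResolution.ofExact_d] at h2
    exact LinearMap.congr_fun (congrArg ModuleCat.Hom.hom h2) x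
  exact (h i _).1 (by rw [map_sub, hx, sub_self])

end OneDimensional

end Modules

end Syzygies

/-! ### The bar resolution, built recursively -/

section Bar

variable {k : Type u} [Field k] {A : Type w} [Ring A] [Algebra k A]

/-- The `A`-linear map `a ⊗ x ↦ a • l x`. -/
def extendScalars {X Y : Type*} [AddCommGroup X] [Module k X] [AddCommGroup Y] [Module k Y]
    [Module A Y] [IsScalarTower k A Y] (l : X →ₗ[k] Y) : A ⊗[k] X →ₗ[A] Y :=
  have : SMulCommClass k A Y := IsScalarTower.to_smulCommClass
  have : SMulCommClass A k Y := SMulCommClass.symm _ _ _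
  TensorProduct.AlgebraTensorModule.lift (LinearMap.toSpanSingleton A _ l)

@[simp]
theorem extendScalars_tmul {X Y : Type*} [AddCommGroup X] [Module k X] [AddCommGroup Y]
    [Module k Y] [Module A Y] [IsScalarTower k A Y] (l : X →ₗ[k] Y) (a : A) (x : X) :
    extendScalars (A := A) l (a ⊗ₜ x) = a • l x := rfl

theorem hom_ext_one_tmul {X Y : Type*} [AddCommGroup X] [Module k X] [AddCommGroup Y]
    [Module A Y] {f g : A ⊗[k] X →ₗ[A] Y} (h : ∀ x, f (1 ⊗ₜ x) = g (1 ⊗ₜ x)) : f = g := by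
  ext y
  induction y with
  | zero => simp
  | add x y hx hy => simp [hx, hy]
  | tmul a x =>
    have : a ⊗ₜ[k] x = a • ((1 : A) ⊗ₜ[k] x) := by simp [TensorProduct.smul_tmul']
    rw [this, map_smul, map_smul, h]

/-- The pairing `a ⊗ x ↦ ε a • f x`. -/
def augPair (ε : A →ₐ[k] k) {X Y : Type*} [AddCommMonoid X] [Module k X] [AddCommGroup Y]
    [Module k Y] (f : X →ₗ[k] Y) : A ⊗[k] X →ₗ[k] Y :=
  (TensorProduct.lid k Y).toLinearMap ∘ₗ TensorProduct.map ε.toLinearMap f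

@[simp]
theorem augPair_tmul (ε : A →ₐ[k] k) {X Y : Type*} [AddCommMonoid X] [Module k X]
    [AddCommGroup Y] [Module k Y] (f : X →ₗ[k] Y) (a : A) (x : X) :
    augPair ε f (a ⊗ₜ x) = ε a • f x := rfl

theorem augPair_smul (ε : A →ₐ[k] k) {X Y : Type*} [AddCommMonoid X] [Module k X]
    [AddCommGroup Y] [Module k Y] (f : X →ₗ[k] Y) (a : A) (y : A ⊗[k] X) :
    augPair ε f (a • y) = ε a • augPair ε f y := by
  induction y with
  | zero => simp
  | add x y hx hy => simp [hx, hy]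
  | tmul b x => simp [TensorProduct.smul_tmul', mul_smul]

variable (k A) in
/-- The isomorphism `A ⊗ A^{⊗ i} ≃ A^{⊗ (i+1)}`. -/
def tensorCons (i : ℕ) : A ⊗[k] (⨂[k]^i A) ≃ₗ[k] ⨂[k]^(i + 1) A :=
  LinearEquiv.ofLinearMap
    (TensorProduct.lift ((PiTensorProduct.lift (R := k)
      (s := fun _ : Fin i => A)).toLinearMap ∘ₗ
        (MultilinearMap.curryLeft (PiTensorProduct.tprod k (s := fun _ : Fin (i + 1) => A)))))
    (PiTensorProduct.lift (LinearMap.uncurryLeft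
      { toFun a := (TensorProduct.mk k A (⨂[k]^i A) a).compMultilinearMap (PiTensorProduct.tprod k)
        map_add' a b := by ext x; simp
        map_smul' c a := by ext x; simp [TensorProduct.smul_tmul'] }))
    (by
      ext x
      simp)
    (by
      ext a x
      simp)

theorem tensorCons_tprod {i : ℕ} (a : A) (x : Fin i → A) :
    tensorCons k A i (a ⊗ₜ PiTensorProduct.tprod k x) = PiTensorProduct.tprod k (Fin.cons a x) := by
  simp [tensorCons]

theorem tensorCons_symm_tprod {i : ℕ} (x : Fin (i + 1) → A) :
    (tensorCons k A i).symm (PiTensorProduct.tprod k x) =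
      x 0 ⊗ₜ PiTensorProduct.tprod k (Fin.tail x) := by
  rw [LinearEquiv.symm_apply_eq, tensorCons_tprod, Fin.cons_self_tail]

/-- From `D : A ⊗ X_i → X_i`, the differential `a ⊗ x ↦ a • (x - 1 ⊗ D x)` from `A ⊗ X_{i+1}` to
`A ⊗ X_i`, where `X_{i+1} = A ⊗ X_i`. -/
def barStep {i : ℕ} (D : A ⊗[k] (⨂[k]^i A) →ₗ[k] ⨂[k]^i A) :
    A ⊗[k] (⨂[k]^(i + 1) A) →ₗ[A] A ⊗[k] (⨂[k]^i A) :=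
  extendScalars ((LinearMap.id - TensorProduct.mk k A (⨂[k]^i A) 1 ∘ₗ D) ∘ₗ
    (tensorCons k A i).symm.toLinearMap)

theorem barStep_tmul {i : ℕ} (D : A ⊗[k] (⨂[k]^i A) →ₗ[k] ⨂[k]^i A) (a : A)
    (y : A ⊗[k] (⨂[k]^i A)) :
    barStep D (a ⊗ₜ tensorCons k A i y) = a • (y - 1 ⊗ₜ D y) := by
  simp [barStep]

/-- The part `a₀ ⊗ ⋯ ⊗ a_i ↦ ∑_j (-1)^j ⋯ ⊗ a_j a_{j+1} ⊗ ⋯ + (-1)^i a₀ ⊗ ⋯ ε(a_i)` of the bar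
differential. -/
def barTail (ε : A →ₐ[k] k) : (i : ℕ) → A ⊗[k] (⨂[k]^i A) →ₗ[k] ⨂[k]^i A
  | 0 => augPair ε LinearMap.id
  | i + 1 => (tensorCons k A i).toLinearMap ∘ₗ (barStep (barTail ε i)).restrictScalars k

/-- The differential of the bar resolution. -/
def barD (ε : A →ₐ[k] k) (i : ℕ) : A ⊗[k] (⨂[k]^(i + 1) A) →ₗ[A] A ⊗[k] (⨂[k]^i A) :=
  barStep (barTail ε i)

variable (ε : A →ₐ[k] k)

theorem barTail_succ (i : ℕ) (y : A ⊗[k] (⨂[k]^(i + 1) A)) :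
    barTail ε (i + 1) y = tensorCons k A i (barD ε i y) := rfl

/-- This is the contracting homotopy `y ↦ 1 ⊗ y`: up to `tensorCons`, the next `barTail` is `barD`,
so the formula reads `d(1 ⊗ y) + 1 ⊗ d y = y`. Exactness of the bar complex follows at once. -/
theorem barD_one_tmul (i : ℕ) (y : A ⊗[k] (⨂[k]^i A)) :
    barD ε i (1 ⊗ₜ tensorCons k A i y) = y - 1 ⊗ₜ barTail ε i y := by
  rw [barD, barStep_tmul, one_smul]

/-- The property climbs one degree at a time: if the tail kills boundaries in degree `i`, the
homotopy formula gives `d ∘ d = 0` there, and that is the same property of the tail in degree `i +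
1`. -/
theorem barTail_barD (i : ℕ) (y : A ⊗[k] (⨂[k]^(i + 1) A)) :
    barTail ε i (barD ε i y) = 0 := by
  have aux : ∀ (i : ℕ), (∀ y, barTail ε i (barD ε i y) = 0) →
      barD ε i ∘ₗ barD ε (i + 1) = 0 := by
    intro i h
    refine hom_ext_one_tmul fun x => ?_
    obtain ⟨y, rfl⟩ := (tensorCons k A (i + 1)).surjective x
    rw [LinearMap.comp_apply, barD_one_tmul, map_sub, barTail_succ, barD_one_tmul, h]
    simp
  induction i with
  | zero =>
    induction y with
    | zero => simp
    | add x y hx hy => simp [hx, hy]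
    | tmul a x =>
      obtain ⟨y, rfl⟩ := (tensorCons k A 0).surjective x
      rw [barD, barStep_tmul, barTail, augPair_smul, map_sub]
      simp
  | succ i ih => rw [barTail_succ, ← LinearMap.comp_apply, aux i ih]; simp

theorem barD_barD (i : ℕ) (y : A ⊗[k] (⨂[k]^(i + 2) A)) : barD ε i (barD ε (i + 1) y) = 0 := by
  have := barTail_barD ε (i + 1) y
  rwa [barTail_succ, LinearEquiv.map_eq_zero_iff] at this

theorem barD_exact (i : ℕ) : Function.Exact (barD ε (i + 1)) (barD ε i) := by
  refine fun y => ⟨fun h => ⟨1 ⊗ₜ tensorCons k A (i + 1) y, ?_⟩, ?_⟩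
  · rw [barD_one_tmul, barTail_succ, h]
    simp
  · rintro ⟨y, rfl⟩
    exact barD_barD ε i y

/-- Links the recursion to the alternating sum in `barDiff`: the product of the first two letters
comes from `a • x`, and all later terms come, with a change of sign, from the tail of the shorter
word. -/
theorem barTail_tprod (i : ℕ) (a : Fin (i + 1) → A) :
    barTail ε i (a 0 ⊗ₜ PiTensorProduct.tprod k (Fin.tail a)) =
      ∑ j : Fin i, (-1 : k) ^ (j : ℕ) •
          PiTensorProduct.tprod k (Fin.contractNth j.castSucc (· * ·) a) +
        (-1 : k) ^ i • ε (a (Fin.last i)) • PiTensorProduct.tprod k (fun s => a s.castSucc) := by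
  induction i with
  | zero =>
    simp only [barTail, augPair_tmul]
    simp only [Finset.univ_eq_empty, Finset.sum_empty, pow_zero, one_smul, zero_add]
    rw [LinearMap.id_apply, Subsingleton.elim (Fin.tail a) fun s : Fin 0 => a s.castSucc]
    rfl
  | succ i ih =>
    have ht : PiTensorProduct.tprod k (Fin.tail a) =
        tensorCons k A i (a 1 ⊗ₜ PiTensorProduct.tprod k (Fin.tail (Fin.tail a))) := by
      rw [tensorCons_tprod]
      congr 1
      exact (Fin.cons_self_tail (Fin.tail a)).symm
    have ih' := ih (Fin.tail a)
    rw [show Fin.tail a 0 = a 1 from rfl] at ih'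
    rw [barTail_succ, ht, barD, barStep_tmul, ih', smul_sub, map_sub, TensorProduct.smul_tmul',
      smul_eq_mul, TensorProduct.smul_tmul', smul_eq_mul, mul_one, tensorCons_tprod,
      Fin.sum_univ_succ]
    simp only [TensorProduct.tmul_add, TensorProduct.tmul_sum, map_add, map_sum,
      TensorProduct.tmul_smul, map_smul, tensorCons_tprod]
    have e1 : Fin.contractNth (Fin.castSucc 0) (· * ·) a =
        Fin.cons (a 0 * a 1) (Fin.tail (Fin.tail a)) := by
      ext s
      refine Fin.cases ?_ (fun s => ?_) s <;> simp [Fin.contractNth, Fin.tail]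
    have e2 : ∀ j : Fin i, Fin.contractNth j.succ.castSucc (· * ·) a =
        Fin.cons (a 0) (Fin.contractNth j.castSucc (· * ·) (Fin.tail a)) := by
      intro j
      ext s
      refine Fin.cases ?_ (fun s => ?_) s <;> simp [Fin.contractNth, Fin.tail]
    have e3 : (fun s : Fin (i + 1) => a s.castSucc) =
        Fin.cons (a 0) fun s : Fin i => Fin.tail a s.castSucc := by
      ext s
      refine Fin.cases ?_ (fun s => ?_) s <;> simp [Fin.tail]
    have e4 : Fin.tail a (Fin.last i) = a (Fin.last (i + 1)) := rfl
    simp only [e1, e2, e3, e4, Fin.val_zero, pow_zero, one_smul, Fin.val_succ, pow_succ, mul_neg,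
      mul_one, neg_smul, Finset.sum_neg_distrib]
    abel

/-- The bar differential of a cochain, in terms of `barTail`. -/
theorem barDiff_eq {Y : Type*} [AddCommGroup Y] [Module k Y] {i : ℕ} (f : BarCochain k A Y i)
    (a : Fin (i + 1) → A) :
    barDiff ε f a = (augPair ε (PiTensorProduct.lift f) - PiTensorProduct.lift f ∘ₗ barTail ε i)
      ((tensorCons k A i).symm (PiTensorProduct.tprod k a)) := by
  rw [tensorCons_symm_tprod, LinearMap.sub_apply, LinearMap.comp_apply, barTail_tprod]
  simp only [augPair_tmul, PiTensorProduct.lift.tprod, map_add, map_sum, map_smul, barDiff,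
    pow_succ, mul_neg, mul_one, neg_smul, Finset.sum_neg_distrib]
  rw [show (Fin.tail a) = fun s : Fin i => a s.succ from rfl]
  abel

end Bar

/-! ### The degrees of the Koszul complex -/

section KoszulDegree

variable {N : ℕ}

theorem koszulDegree_zero : koszulDegree N 0 = 0 := by simp [koszulDegree]

theorem koszulDegree_one : koszulDegree N 1 = 1 := by simp [koszulDegree]

theorem koszulDegree_add_two (i : ℕ) : koszulDegree N (i + 2) = koszulDegree N i + N := by
  simp only [koszulDegree, Nat.add_mod_right]
  rw [show (i + 2) / 2 = i / 2 + 1 by omega]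
  ring

theorem koszulDegree_lt (hN : 2 ≤ N) (i : ℕ) : koszulDegree N i < koszulDegree N (i + 1) := by
  induction i using Nat.twoStepInduction with
  | zero => simp [koszulDegree]
  | one => simp only [koszulDegree]; omega
  | more i ih _ => rw [koszulDegree_add_two, koszulDegree_add_two]; omega

end KoszulDegree

/-! ### The Koszul complex as a complex of projective modules -/

section Koszul

variable {k : Type u} [Field k] {Z : Type v} [AddCommGroup Z] [Module k Z]
  {N : ℕ} {R : Submodule k (TensorAlgebra k Z)}

theorem quotMk_eq_zero {x : TensorAlgebra k Z} (hx : x ∈ R) : quotMk R x = 0 := by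
  have h := RingQuot.mkAlgHom_rel k (s := fun x y : TensorAlgebra k Z => x ∈ R ∧ y = 0)
    (x := x) (y := 0) ⟨hx, rfl⟩
  rwa [map_zero] at h

theorem quotMk_surjective : Function.Surjective (quotMk R) := RingQuot.mkAlgHom_surjective k _

theorem augmentation_quotMk (hR : ∀ x ∈ R, TensorAlgebra.algebraMapInv x = 0)
    (t : TensorAlgebra k Z) : augmentation R hR (quotMk R t) = TensorAlgebra.algebraMapInv t :=
  RingQuot.liftAlgHom_mkAlgHom_apply k _ _ t

theorem contractFirst_mem_of_mem_mul (ν : Module.Dual k Z) {S : Submodule k (TensorAlgebra k Z)}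
    {x : TensorAlgebra k Z} (hx : x ∈ deg1 k Z * S) : contractFirst ν x ∈ S := by
  induction hx using Submodule.mul_induction_on' with
  | mem_mul_mem x hx t ht =>
    obtain ⟨z, rfl⟩ := hx
    rw [contractFirst_ι_mul]
    exact Submodule.smul_mem _ _ ht
  | add x _ y _ hx hy =>
    rw [map_add]
    exact Submodule.add_mem _ hx hy

/-- Removing the first letter turns the padding `Z^{⊗ (r+1)}` on the left into `Z^{⊗ r}`, so each
condition in degree `j` follows from one in degree `j + 1`. -/
theorem contractFirst_koszulSpace (ν : Module.Dual k Z) {j : ℕ} {x : TensorAlgebra k Z}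
    (hx : x ∈ koszulSpace N R (j + 1)) : contractFirst ν x ∈ koszulSpace N R j := by
  simp only [koszulSpace, Submodule.mem_inf, Submodule.mem_iInf] at hx ⊢
  refine ⟨contractFirst_mem_of_mem_mul ν (by rw [← pow_succ']; exact hx.1), fun r s h => ?_⟩
  refine contractFirst_mem_of_mem_mul ν ?_
  rw [← mul_assoc, ← mul_assoc, ← pow_succ']
  exact hx.2 (r + 1) s (by omega)

theorem koszulD_ι_mul (a : QuotAlg R) (z : Z) (t : TensorAlgebra k Z) :
    koszulD R (a ⊗ₜ (TensorAlgebra.ι k z * t)) = (a * quotMk R (TensorAlgebra.ι k z)) ⊗ₜ t := by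
  simp [koszulD, splitFirst_ι_mul]

/-- A power of the differential multiplies the first `e` letters into `A` as one block. Both `d^N =
0` on the Koszul terms and the cutting of words into blocks rest on this. -/
theorem koszulD_pow_mul {e : ℕ} {s : TensorAlgebra k Z} (hs : s ∈ deg1 k Z ^ e) (a : QuotAlg R)
    (t : TensorAlgebra k Z) : (koszulD R ^ e) (a ⊗ₜ (s * t)) = (a * quotMk R s) ⊗ₜ t := by
  induction e generalizing s a with
  | zero =>
    rw [pow_zero, Submodule.one_eq_range] at hs
    obtain ⟨c, rfl⟩ := hs
    simp [Algebra.algebraMap_eq_smul_one, TensorProduct.smul_tmul']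
  | succ e ih =>
    rw [pow_succ'] at hs
    induction hs using Submodule.mul_induction_on' with
    | mem_mul_mem x hx y hy =>
      obtain ⟨z, rfl⟩ := hx
      rw [pow_succ, Module.End.mul_apply, mul_assoc, koszulD_ι_mul, ih hy, map_mul, mul_assoc]
    | add x _ y _ hx hy =>
      rw [add_mul, TensorProduct.tmul_add, map_add, hx, hy, map_add, mul_add,
        TensorProduct.add_tmul]

theorem splitFirst_eq_sum {n : ℕ} (b : Module.Basis (Fin n) k Z) (t : TensorAlgebra k Z) :
    splitFirst k Z t = ∑ l, b l ⊗ₜ contractFirst (b.coord l) t := by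
  have key : ∀ u : Z ⊗[k] TensorAlgebra k Z, u = ∑ l, b l ⊗ₜ
      (TensorProduct.lid k (TensorAlgebra k Z)) (LinearMap.rTensor _ (b.coord l) u) := by
    intro u
    induction u with
    | zero => simp
    | add x y hx hy =>
      simp only [map_add, TensorProduct.tmul_add, Finset.sum_add_distrib, ← hx, ← hy]
    | tmul z t =>
      simp only [LinearMap.rTensor_tmul, TensorProduct.lid_tmul, TensorProduct.tmul_smul]
      simp only [Module.Basis.coord_apply, TensorProduct.smul_tmul']
      rw [← TensorProduct.sum_tmul, b.sum_repr]
  exact key _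

theorem koszulD_smul (a : QuotAlg R) (y : QuotAlg R ⊗[k] TensorAlgebra k Z) :
    koszulD R (a • y) = a • koszulD R y := by
  have key : ∀ (a c : QuotAlg R) (u : Z ⊗[k] TensorAlgebra k Z),
      LinearMap.rTensor (TensorAlgebra k Z) (LinearMap.mul' k (QuotAlg R) ∘ₗ
        LinearMap.lTensor (QuotAlg R) ((quotMk R).toLinearMap ∘ₗ TensorAlgebra.ι k))
        ((TensorProduct.assoc k (QuotAlg R) Z (TensorAlgebra k Z)).symm ((a * c) ⊗ₜ u)) =
      a • LinearMap.rTensor (TensorAlgebra k Z) (LinearMap.mul' k (QuotAlg R) ∘ₗ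
        LinearMap.lTensor (QuotAlg R) ((quotMk R).toLinearMap ∘ₗ TensorAlgebra.ι k))
        ((TensorProduct.assoc k (QuotAlg R) Z (TensorAlgebra k Z)).symm (c ⊗ₜ u)) := by
    intro a c u
    induction u with
    | zero => simp
    | add x y hx hy => simp only [TensorProduct.tmul_add, map_add, hx, hy, smul_add]
    | tmul z t => simp [TensorProduct.smul_tmul', mul_assoc]
  induction y with
  | zero => simp
  | add x y hx hy => simp only [smul_add, map_add, hx, hy]
  | tmul c t =>
    rw [TensorProduct.smul_tmul', smul_eq_mul]
    simp only [koszulD, LinearMap.comp_apply, LinearMap.lTensor_tmul]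
    exact key a c _

variable (R) in
/-- The Koszul differential as an `A`-linear map. -/
def koszulLin : Module.End (QuotAlg R) (QuotAlg R ⊗[k] TensorAlgebra k Z) where
  toFun := koszulD R
  map_add' := map_add _
  map_smul' := koszulD_smul

theorem koszulLin_pow_apply (e : ℕ) (y : QuotAlg R ⊗[k] TensorAlgebra k Z) :
    (koszulLin R ^ e) y = (koszulD R ^ e) y := by
  induction e generalizing y with
  | zero => rfl
  | succ e ih => rw [pow_succ, pow_succ, Module.End.mul_apply, ih]; rfl

variable (N R) in
/-- `A ⊗ W_j` as an `A`-submodule of `A ⊗ T(Z)`. -/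
def koszulMod (j : ℕ) : Submodule (QuotAlg R) (QuotAlg R ⊗[k] TensorAlgebra k Z) :=
  { koszulTerm N R j with
    smul_mem' := by
      rintro a _ ⟨y, rfl⟩
      refine ⟨a • y, ?_⟩
      rw [← LinearMap.baseChange_eq_ltensor, map_smul] }

theorem tmul_mem_koszulMod {j : ℕ} (a : QuotAlg R) {w : TensorAlgebra k Z}
    (hw : w ∈ koszulSpace N R j) : a ⊗ₜ w ∈ koszulMod N R j :=
  ⟨a ⊗ₜ ⟨w, hw⟩, rfl⟩

/-- Since `A ⊗ W_j` is generated over `A` by `1 ⊗ W_j`, identities of `A`-linear maps need to be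
checked only on words of `W_j`. -/
theorem koszulMod_le {j : ℕ} {S : Submodule (QuotAlg R) (QuotAlg R ⊗[k] TensorAlgebra k Z)}
    (h : ∀ w ∈ koszulSpace N R j, (1 : QuotAlg R) ⊗ₜ[k] w ∈ S) : koszulMod N R j ≤ S := by
  rintro _ ⟨y, rfl⟩
  induction y with
  | zero => simp
  | add x y hx hy => rw [map_add]; exact S.add_mem hx hy
  | tmul a w =>
    have := S.smul_mem a (h w w.2)
    simpa [TensorProduct.smul_tmul'] using this

/-- Over a field `W_j` has a linear retraction `p` from `T(Z)`, which makes `A ⊗ W_j` a direct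
summand of the free module `A ⊗ T(Z)`. -/
instance projective_koszulMod (j : ℕ) : Module.Projective (QuotAlg R) (koszulMod N R j) := by
  obtain ⟨p, hp⟩ := (koszulSpace N R j).subtype.exists_leftInverse_of_injective
    (Submodule.ker_subtype _)
  have hp' : ∀ w (hw : w ∈ koszulSpace N R j), p w = ⟨w, hw⟩ := fun w hw =>
    LinearMap.congr_fun hp ⟨w, hw⟩
  let P : QuotAlg R ⊗[k] TensorAlgebra k Z →ₗ[QuotAlg R] koszulMod N R j :=
    (LinearMap.baseChange (QuotAlg R) ((koszulSpace N R j).subtype ∘ₗ p)).codRestrict _ (by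
      intro y
      induction y with
      | zero => simp
      | add x y hx hy => rw [map_add]; exact Submodule.add_mem _ hx hy
      | tmul a t => exact tmul_mem_koszulMod a (p t).2)
  refine Module.Projective.of_split (koszulMod N R j).subtype P ?_
  ext ⟨y, hy⟩
  have : koszulMod N R j ≤ LinearMap.eqLocus ((koszulMod N R j).subtype ∘ₗ P) LinearMap.id := by
    refine koszulMod_le fun w hw => ?_
    simp [P, LinearMap.mem_eqLocus, hp' w hw]
  exact this hy

theorem koszulLin_tmul {n : ℕ} (b : Module.Basis (Fin n) k Z) (t : TensorAlgebra k Z) :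
    koszulLin R (1 ⊗ₜ t) = ∑ l, quotMk R (TensorAlgebra.ι k (b l)) •
      ((1 : QuotAlg R) ⊗ₜ[k] contractFirst (b.coord l) t) := by
  change koszulD R _ = _
  simp [koszulD, splitFirst_eq_sum b, TensorProduct.tmul_sum, TensorProduct.smul_tmul']

/-- The Koszul differential takes values in `A₊ ⊗ W_j`. -/
theorem koszulLin_mem_span {n : ℕ} (b : Module.Basis (Fin n) k Z) {j : ℕ}
    {y : QuotAlg R ⊗[k] TensorAlgebra k Z} (hy : y ∈ koszulMod N R (j + 1)) :
    koszulLin R y ∈ Submodule.span (QuotAlg R)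
      {x | ∃ (z : Z) (x' : _), x' ∈ koszulMod N R j ∧
        x = quotMk R (TensorAlgebra.ι k z) • x'} := by
  rw [← Submodule.mem_comap]
  refine koszulMod_le (fun w hw => ?_) hy
  rw [Submodule.mem_comap, koszulLin_tmul b]
  exact Submodule.sum_mem _ fun l _ => Submodule.subset_span
    ⟨b l, _, tmul_mem_koszulMod 1 (contractFirst_koszulSpace _ hw), rfl⟩

theorem koszulLin_mem {n : ℕ} (b : Module.Basis (Fin n) k Z) {j : ℕ}
    {y : QuotAlg R ⊗[k] TensorAlgebra k Z} (hy : y ∈ koszulMod N R (j + 1)) :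
    koszulLin R y ∈ koszulMod N R j := by
  refine Submodule.span_le.2 ?_ (koszulLin_mem_span b hy)
  rintro _ ⟨z, x, hx, rfl⟩
  exact Submodule.smul_mem _ _ hx

theorem koszulLin_pow_mem {n : ℕ} (b : Module.Basis (Fin n) k Z) {i j e : ℕ} (h : i = j + e)
    {y : QuotAlg R ⊗[k] TensorAlgebra k Z} (hy : y ∈ koszulMod N R i) :
    (koszulLin R ^ e) y ∈ koszulMod N R j := by
  subst h
  induction e generalizing y with
  | zero => exact hy
  | succ e ih =>
    rw [pow_succ, Module.End.mul_apply]
    exact ih (koszulLin_mem b hy)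

/-- By the condition with `r = 0` in the intersection, elements of `W_{j+N}` lie in `R Z^{⊗ j}`; the
`N`-th power multiplies the leading relation into `A`, where it is zero. -/
theorem koszulLin_pow_eq_zero (hR : R ≤ deg1 k Z ^ N) {j : ℕ}
    {y : QuotAlg R ⊗[k] TensorAlgebra k Z} (hy : y ∈ koszulMod N R (j + N)) :
    (koszulLin R ^ N) y = 0 := by
  refine koszulMod_le (S := LinearMap.ker (koszulLin R ^ N)) (fun w hw => ?_) hy
  rw [LinearMap.mem_ker, koszulLin_pow_apply]
  simp only [koszulSpace, Submodule.mem_inf, Submodule.mem_iInf] at hw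
  have h := hw.2 0 j (by omega)
  rw [pow_zero, one_mul] at h
  clear hw
  induction h using Submodule.mul_induction_on' with
  | mem_mul_mem r hr t ht =>
    rw [koszulD_pow_mul (hR hr), quotMk_eq_zero hr]
    simp
  | add x _ y _ hx hy => rw [TensorProduct.tmul_add, map_add, hx, hy, add_zero]

theorem one_mem_koszulSpace (hN : 2 ≤ N) : (1 : TensorAlgebra k Z) ∈ koszulSpace N R 0 := by
  simp only [koszulSpace, Submodule.mem_inf, Submodule.mem_iInf]
  exact ⟨by simp [Submodule.one_le.1 le_rfl], fun r s h => by omega⟩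

theorem ι_mem_koszulSpace (hN : 2 ≤ N) (z : Z) : TensorAlgebra.ι k z ∈ koszulSpace N R 1 := by
  simp only [koszulSpace, Submodule.mem_inf, Submodule.mem_iInf]
  exact ⟨by rw [pow_one]; exact ⟨z, rfl⟩, fun r s h => by omega⟩

theorem exists_of_mem_koszulMod_zero {y : QuotAlg R ⊗[k] TensorAlgebra k Z}
    (hy : y ∈ koszulMod N R 0) : ∃ a : QuotAlg R, y = a ⊗ₜ 1 := by
  obtain ⟨y, rfl⟩ := hy
  induction y with
  | zero => exact ⟨0, by simp⟩
  | add x y hx hy =>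
    obtain ⟨a, ha⟩ := hx
    obtain ⟨c, hc⟩ := hy
    exact ⟨a + c, by rw [map_add, ha, hc, TensorProduct.add_tmul]⟩
  | tmul a w =>
    obtain ⟨w, hw⟩ := w
    have hw' : w ∈ deg1 k Z ^ 0 := hw.1
    rw [pow_zero, Submodule.one_eq_range] at hw'
    obtain ⟨c, rfl⟩ := hw'
    exact ⟨c • a, by simp [Algebra.algebraMap_eq_smul_one, TensorProduct.smul_tmul']⟩

/-- Needed for exactness at the term of homological degree zero, about which `IsNKoszul` says
nothing: modulo boundaries an element of `A` equals its constant term. -/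
theorem quotMk_mem_add_range (t : TensorAlgebra k Z) (hN : 2 ≤ N) :
    ∃ y ∈ koszulMod N R 1, (quotMk R t) ⊗ₜ 1 =
      (TensorAlgebra.algebraMapInv t) • ((1 : QuotAlg R) ⊗ₜ[k] (1 : TensorAlgebra k Z)) +
        koszulLin R y := by
  -- The additional left factor `a` lets the induction pass through products: it absorbs the factor
  -- `s` of `s * t`.
  have key : ∀ (t : TensorAlgebra k Z) (a : QuotAlg R), ∃ y ∈ koszulMod N R 1,
      (a * quotMk R t) ⊗ₜ 1 = (TensorAlgebra.algebraMapInv t) • (a ⊗ₜ[k] (1 : TensorAlgebra k Z)) +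
        koszulLin R y := by
    intro t
    induction t using TensorAlgebra.induction with
    | algebraMap r =>
      exact fun a => ⟨0, Submodule.zero_mem _, by
        simp [TensorAlgebra.algebraMapInv, Algebra.algebraMap_eq_smul_one,
          TensorProduct.smul_tmul']⟩
    | ι z =>
      refine fun a => ⟨a ⊗ₜ TensorAlgebra.ι k z,
        tmul_mem_koszulMod a (ι_mem_koszulSpace hN z), ?_⟩
      have := koszulD_ι_mul a z 1
      rw [mul_one] at this
      rw [show koszulLin R _ = koszulD R _ from rfl, this]
      simp [TensorAlgebra.algebraMapInv]
    | mul s t hs ht =>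
      intro a
      obtain ⟨y, hy, hy'⟩ := ht (a * quotMk R s)
      obtain ⟨x, hx, hx'⟩ := hs a
      refine ⟨TensorAlgebra.algebraMapInv t • x + y,
        Submodule.add_mem _ ((koszulTerm N R 1).smul_mem _ hx) hy, ?_⟩
      have hl : koszulLin R (TensorAlgebra.algebraMapInv t • x) =
        TensorAlgebra.algebraMapInv t • koszulLin R x := (koszulD R).map_smul _ _
      rw [map_mul, ← mul_assoc, hy', hx', map_mul, map_add, smul_add, hl, smul_smul, mul_comm,
        add_assoc]
    | add s t hs ht =>
      intro a
      obtain ⟨y, hy, hy'⟩ := ht a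
      obtain ⟨x, hx, hx'⟩ := hs a
      refine ⟨x + y, Submodule.add_mem _ hx hy, ?_⟩
      rw [map_add, mul_add, TensorProduct.add_tmul, hx', hy', map_add, map_add, add_smul]
      abel
  obtain ⟨y, hy, h⟩ := key t 1
  exact ⟨y, hy, by rw [← h, one_mul]⟩

end Koszul

/-! ### The Koszul resolution and its minimality -/

section KoszulResolution

variable {k : Type u} [Field k] {Z : Type u} [AddCommGroup Z] [Module k Z]
  {N n : ℕ} {R : Submodule k (TensorAlgebra k Z)}

/-- The differentials of the Koszul complex. -/
def koszulDiff (b : Module.Basis (Fin n) k Z) (R : Submodule k (TensorAlgebra k Z)) (hN : 2 ≤ N)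
    (i : ℕ) : koszulMod N R (koszulDegree N (i + 1)) →ₗ[QuotAlg R]
      koszulMod N R (koszulDegree N i) :=
  (koszulLin R ^ (koszulDegree N (i + 1) - koszulDegree N i)).restrict fun _ hy =>
    koszulLin_pow_mem b (by have := koszulDegree_lt hN i; omega) hy

/-- The trivial-module-valued map `a ⊗ x ↦ ε(a) f(x)`. -/
def augLin {A : Type u} [Ring A] [Algebra k A] (ε : A →ₐ[k] k) {X : Type*} [AddCommMonoid X]
    [Module k X] (f : X →ₗ[k] k) : A ⊗[k] X →ₗ[A] trivialLeft ε where
  toFun := augPair ε f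
  map_add' := map_add _
  map_smul' := augPair_smul ε f

variable (b : Module.Basis (Fin n) k Z) (hN : 2 ≤ N)
  (hR : ∀ x ∈ R, TensorAlgebra.algebraMapInv x = 0)

variable (N) in
/-- The augmentation of the Koszul complex. -/
def koszulAug (hR : ∀ x ∈ R, TensorAlgebra.algebraMapInv x = 0) :
    koszulMod N R (koszulDegree N 0) →ₗ[QuotAlg R] trivialLeft (augmentation R hR) :=
  augLin (augmentation R hR) (TensorAlgebra.algebraMapInv).toLinearMap ∘ₗ
    (koszulMod N R (koszulDegree N 0)).subtype

include hN in
theorem koszulAug_surjective : Function.Surjective (koszulAug N hR) := by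
  intro c
  let c' : k := c
  refine ⟨⟨algebraMap k (QuotAlg R) c' ⊗ₜ 1,
    tmul_mem_koszulMod _ (by rw [koszulDegree_zero]; exact one_mem_koszulSpace hN)⟩, ?_⟩
  change augPair (augmentation R hR) (TensorAlgebra.algebraMapInv (R := k) (M := Z)).toLinearMap
    (algebraMap k (QuotAlg R) c' ⊗ₜ (1 : TensorAlgebra k Z)) = c'
  simp

theorem koszulDiff_coe (i : ℕ) (y : koszulMod N R (koszulDegree N (i + 1))) :
    (koszulDiff b R hN i y : QuotAlg R ⊗[k] TensorAlgebra k Z) =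
      (koszulLin R ^ (koszulDegree N (i + 1) - koszulDegree N i)) y := rfl

theorem trivialLeft_smul {A : Type u} [Ring A] [Algebra k A] (ε : A →ₐ[k] k) (a : A)
    (c : trivialLeft ε) : a • c = (ε a * (show k from c) : k) := rfl

/-- A linear map to the trivial module vanishes on the boundaries of the Koszul complex. -/
theorem trivial_comp_koszulDiff (i : ℕ)
    (f : koszulMod N R (koszulDegree N i) →ₗ[QuotAlg R] trivialLeft (augmentation R hR)) :
    f ∘ₗ koszulDiff b R hN i = 0 := by
  ext y
  have hlt := koszulDegree_lt hN i
  -- The degree drops by `e + 1 ≥ 1`, so one application of the differential can be performed last,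
  -- and it puts a generator in front, which acts as zero on the trivial module.
  obtain ⟨e, he⟩ : ∃ e, koszulDegree N (i + 1) = (koszulDegree N i + 1) + e :=
    ⟨_, (Nat.add_sub_cancel' (by omega)).symm⟩
  have hspan := koszulLin_mem_span b (koszulLin_pow_mem b he y.2)
  have hmem : ((koszulDiff b R hN i y : koszulMod N R (koszulDegree N i)) :
      QuotAlg R ⊗[k] TensorAlgebra k Z) = koszulLin R ((koszulLin R ^ e) y) := by
    rw [← Module.End.mul_apply, ← pow_succ', koszulDiff_coe,
      show koszulDegree N (i + 1) - koszulDegree N i = e + 1 by omega]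
  rw [← hmem] at hspan
  have key : ∀ x (hx : x ∈ koszulMod N R (koszulDegree N i)),
      x ∈ Submodule.span (QuotAlg R) {x | ∃ (z : Z) (x' : _),
        x' ∈ koszulMod N R (koszulDegree N i) ∧ x = quotMk R (TensorAlgebra.ι k z) • x'} →
      f ⟨x, hx⟩ = 0 := by
    intro x hx hx'
    have : Submodule.span (QuotAlg R) {x | ∃ (z : Z) (x' : _),
        x' ∈ koszulMod N R (koszulDegree N i) ∧ x = quotMk R (TensorAlgebra.ι k z) • x'} ≤
        (LinearMap.ker f).map (koszulMod N R (koszulDegree N i)).subtype := by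
      refine Submodule.span_le.2 ?_
      rintro _ ⟨z, x', hx', rfl⟩
      refine ⟨quotMk R (TensorAlgebra.ι k z) • ⟨x', hx'⟩, ?_, rfl⟩
      rw [SetLike.mem_coe, LinearMap.mem_ker, map_smul]
      rw [trivialLeft_smul, augmentation_quotMk]
      simp only [TensorAlgebra.algebraMapInv, TensorAlgebra.lift_ι_apply, LinearMap.zero_apply]
      exact zero_mul (M₀ := k) _
    obtain ⟨x'', h1, h2⟩ := this hx'
    rw [← h1]
    congr 1
    exact Subtype.ext h2.symm
  exact key _ _ hspan

theorem koszulDiff_exact_zero : Function.Exact (koszulDiff b R hN 0) (koszulAug N hR) := by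
  intro y
  constructor
  · intro hy
    obtain ⟨y, hy'⟩ := y
    rw [koszulDegree_zero] at hy'
    obtain ⟨a, rfl⟩ := exists_of_mem_koszulMod_zero hy'
    obtain ⟨t, rfl⟩ := quotMk_surjective a
    obtain ⟨x, hx, hx'⟩ := quotMk_mem_add_range (R := R) t hN
    change augPair (augmentation R hR) (TensorAlgebra.algebraMapInv (R := k) (M := Z)).toLinearMap
      (quotMk R t ⊗ₜ (1 : TensorAlgebra k Z)) = (0 : k) at hy
    simp [augmentation_quotMk] at hy
    refine ⟨⟨x, by rw [koszulDegree_one]; exact hx⟩, ?_⟩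
    apply Subtype.ext
    rw [hy, zero_smul, zero_add] at hx'
    refine Eq.trans ?_ hx'.symm
    change (koszulLin R ^ (koszulDegree N 1 - koszulDegree N 0)) x = _
    rw [koszulDegree_zero, koszulDegree_one, Nat.sub_zero, pow_one]
  · rintro ⟨x, rfl⟩
    exact LinearMap.congr_fun (trivial_comp_koszulDiff b hN hR 0 (koszulAug N hR)) x

theorem koszulDiff_exact (hR : R ≤ deg1 k Z ^ N) (hK : IsNKoszul N R) (i : ℕ) :
    Function.Exact (koszulDiff b R hN (i + 1)) (koszulDiff b R hN i) := by
  intro y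
  constructor
  · intro hy
    have := hK i y y.2 (by
      rw [← koszulLin_pow_apply]
      exact congrArg Subtype.val hy)
    obtain ⟨x, hx, hx'⟩ := this
    refine ⟨⟨x, hx⟩, Subtype.ext ?_⟩
    rw [← hx', ← koszulLin_pow_apply]
    rfl
  · rintro ⟨x, rfl⟩
    apply Subtype.ext
    rw [koszulDiff_coe, koszulDiff_coe]
    have h1 := koszulDegree_lt hN i
    have h2 := koszulDegree_lt hN (i + 1)
    have h3 := koszulDegree_add_two (N := N) i
    -- The jumps alternate between `1` and `N - 1`, so two consecutive differentials compose to the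
    -- `N`-th power.
    rw [← Module.End.mul_apply, ← pow_add, show koszulDegree N (i + 1) - koszulDegree N i +
      (koszulDegree N (i + 1 + 1) - koszulDegree N (i + 1)) = N by
        rw [show i + 1 + 1 = i + 2 from rfl] at *; omega]
    exact koszulLin_pow_eq_zero hR (j := koszulDegree N i) (by rw [← h3]; exact x.2)

end KoszulResolution

/-! ### Bar cocycles and coboundaries as linear maps -/

section Cochains

variable {k : Type u} [Field k] {A : Type w} [Ring A] [Algebra k A] (ε : A →ₐ[k] k)
  {Y : Type*} [AddCommGroup Y] [Module k Y]

theorem tensorCons_symm_hom_ext {i : ℕ} {f g : A ⊗[k] (⨂[k]^i A) →ₗ[k] Y}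
    (h : ∀ a : Fin (i + 1) → A, f ((tensorCons k A i).symm (PiTensorProduct.tprod k a)) =
      g ((tensorCons k A i).symm (PiTensorProduct.tprod k a))) : f = g := by
  have : f ∘ₗ (tensorCons k A i).symm.toLinearMap = g ∘ₗ (tensorCons k A i).symm.toLinearMap := by
    ext a
    exact h a
  ext1
  ext a x
  have := LinearMap.congr_fun this (tensorCons k A i (a ⊗ₜ PiTensorProduct.tprod k x))
  simpa using this

theorem isBarCocycle_iff {i : ℕ} (f : BarCochain k A Y i) :
    IsBarCocycle ε f ↔
      augPair ε (PiTensorProduct.lift f) = PiTensorProduct.lift f ∘ₗ barTail ε i := by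
  simp only [IsBarCocycle, barDiff_eq]
  constructor
  · intro h
    rw [← sub_eq_zero]
    exact tensorCons_symm_hom_ext fun a => by rw [h, LinearMap.zero_apply]
  · intro h a
    rw [h, sub_self, LinearMap.zero_apply]

variable (k) in
/-- The differential `k ⊗_A d` of the bar resolution. -/
def barBoundary (i : ℕ) : (⨂[k]^(i + 1) A) →ₗ[k] ⨂[k]^i A :=
  (augPair ε LinearMap.id - barTail ε i) ∘ₗ (tensorCons k A i).symm.toLinearMap

theorem augPair_eq_comp {X : Type*} [AddCommGroup X] [Module k X] (f : X →ₗ[k] Y) :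
    augPair ε f = f ∘ₗ augPair ε LinearMap.id := by
  ext a x
  simp

theorem isBarCoboundary_succ_iff {i : ℕ} (f : BarCochain k A Y (i + 1)) :
    IsBarCoboundary ε f ↔ ∃ b : (⨂[k]^i A) →ₗ[k] Y,
      PiTensorProduct.lift f = b ∘ₗ barBoundary k ε i := by
  have key : ∀ (b : BarCochain k A Y i) (a : Fin (i + 1) → A), barDiff ε b a =
      (PiTensorProduct.lift b ∘ₗ barBoundary k ε i) (PiTensorProduct.tprod k a) := by
    intro b a
    rw [barDiff_eq, augPair_eq_comp]
    simp [barBoundary]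
  constructor
  · rintro ⟨b, hb⟩
    refine ⟨PiTensorProduct.lift b, ?_⟩
    ext a
    rw [LinearMap.compMultilinearMap_apply, PiTensorProduct.lift.tprod, hb, key]
    rfl
  · rintro ⟨b, hb⟩
    refine ⟨b.compMultilinearMap (PiTensorProduct.tprod k), fun a => ?_⟩
    rw [key, ← PiTensorProduct.lift.tprod (φ := f), hb]
    congr 2
    exact (PiTensorProduct.lift_symm b ▸ PiTensorProduct.lift.apply_symm_apply b).symm

/-- A map that kills the kernel of `δ` descends to the image of `δ`, and over a field it extends
from there to the whole target. -/
theorem exists_factor {X X' : Type*} [AddCommGroup X] [Module k X] [AddCommGroup X']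
    [Module k X'] (δ : X →ₗ[k] X') (f : X →ₗ[k] Y) (h : LinearMap.ker δ ≤ LinearMap.ker f) :
    ∃ g : X' →ₗ[k] Y, f = g ∘ₗ δ := by
  obtain ⟨g, hg⟩ := LinearMap.exists_extend
    ((LinearMap.ker δ).liftQ f h ∘ₗ δ.quotKerEquivRange.symm.toLinearMap)
  refine ⟨g, ?_⟩
  ext x
  have := LinearMap.congr_fun hg ⟨δ x, x, rfl⟩
  simp only [LinearMap.comp_apply, Submodule.subtype_apply, LinearEquiv.coe_coe] at this
  rw [LinearMap.comp_apply, this]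
  have h2 : δ.quotKerEquivRange.symm ⟨δ x, x, rfl⟩ = (LinearMap.ker δ).mkQ x := by
    rw [LinearEquiv.symm_apply_eq]
    rfl
  rw [h2]
  simp

/-- Coboundaries with values in `Y` can be detected by functionals on `Y`. -/
theorem isBarCoboundary_of_dual {i : ℕ} (f : BarCochain k A Y (i + 1))
    (h : ∀ χ : Module.Dual k Y, IsBarCoboundary ε (χ.compMultilinearMap f)) :
    IsBarCoboundary ε f := by
  rw [isBarCoboundary_succ_iff]
  -- A cochain is a coboundary as soon as it vanishes on the kernel of `barBoundary`, and vanishing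
  -- can be tested by functionals. Thus cochains with values in `K` reduce to cochains with values
  -- in `k`.
  refine exists_factor _ _ fun x hx => ?_
  rw [LinearMap.mem_ker] at hx ⊢
  rw [← Module.forall_dual_apply_eq_zero_iff k]
  intro χ
  obtain ⟨b, hb⟩ := (isBarCoboundary_succ_iff ε _).1 (h χ)
  have : χ ∘ₗ PiTensorProduct.lift f = PiTensorProduct.lift (χ.compMultilinearMap f) := by
    ext a; simp
  rw [← LinearMap.comp_apply, this, hb, LinearMap.comp_apply, hx, map_zero]

end Cochains

/-! ### The comparison map from the Koszul to the bar complex -/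

section Comparison

variable {k : Type u} [Field k] {Z : Type v} [AddCommGroup Z] [Module k Z]
  {N n : ℕ} {R : Submodule k (TensorAlgebra k Z)}

variable (N R) in
/-- The comparison map from the Koszul complex to the bar complex, which cuts words into blocks. -/
def wordToBar : (i : ℕ) → TensorAlgebra k Z →ₗ[k] ⨂[k]^i (QuotAlg R)
  | 0 => (LinearMap.toSpanSingleton k _ (PiTensorProduct.tprod k Fin.elim0)) ∘ₗ
      (TensorAlgebra.algebraMapInv).toLinearMap
  | i + 1 => (tensorCons k (QuotAlg R) i).toLinearMap ∘ₗ
      LinearMap.lTensor (QuotAlg R) (wordToBar i) ∘ₗ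
      (koszulD R ^ (koszulDegree N (i + 1) - koszulDegree N i)) ∘ₗ
      TensorProduct.mk k (QuotAlg R) (TensorAlgebra k Z) 1

variable (N R) in
/-- The `A`-linear extension of `wordToBar`. -/
def wordToBarLin (i : ℕ) :
    QuotAlg R ⊗[k] TensorAlgebra k Z →ₗ[QuotAlg R] QuotAlg R ⊗[k] (⨂[k]^i (QuotAlg R)) :=
  LinearMap.baseChange (QuotAlg R) (wordToBar N R i)

theorem wordToBar_succ (i : ℕ) (t : TensorAlgebra k Z) : wordToBar N R (i + 1) t =
    tensorCons k (QuotAlg R) i (wordToBarLin N R i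
      ((koszulLin R ^ (koszulDegree N (i + 1) - koszulDegree N i)) (1 ⊗ₜ t))) := by
  rw [koszulLin_pow_apply, wordToBarLin, LinearMap.baseChange_eq_ltensor]
  rfl

variable (hR : ∀ x ∈ R, TensorAlgebra.algebraMapInv x = 0)

/-- The differential moves a generator into the left factor, where the augmentation kills it. -/
theorem augPair_koszulLin (b : Module.Basis (Fin n) k Z) {Y : Type*} [AddCommGroup Y] [Module k Y]
    (f : TensorAlgebra k Z →ₗ[k] Y) (y : QuotAlg R ⊗[k] TensorAlgebra k Z) :
    augPair (augmentation R hR) f (koszulLin R y) = 0 := by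
  induction y with
  | zero => simp
  | add x y hx hy => rw [map_add, map_add, hx, hy, add_zero]
  | tmul a t =>
    have : a ⊗ₜ[k] t = a • ((1 : QuotAlg R) ⊗ₜ[k] t) := by simp [TensorProduct.smul_tmul']
    rw [this, map_smul, augPair_smul, koszulLin_tmul b, map_sum, Finset.sum_eq_zero, smul_zero]
    intro l _
    rw [augPair_smul, augmentation_quotMk]
    simp [TensorAlgebra.algebraMapInv]

theorem augPair_wordToBarLin (i : ℕ) {Y : Type*} [AddCommGroup Y] [Module k Y]
    (f : (⨂[k]^i (QuotAlg R)) →ₗ[k] Y) (y : QuotAlg R ⊗[k] TensorAlgebra k Z) :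
    augPair (augmentation R hR) f (wordToBarLin N R i y) =
      augPair (augmentation R hR) (f ∘ₗ wordToBar N R i) y := by
  induction y with
  | zero => simp
  | add x y hx hy => rw [map_add, map_add, hx, hy, map_add]
  | tmul a t => rfl

/-- Apart from the leading term, the bar differential of a cut word is its tail. In positive degree
the tail carries the product of the first two blocks, which amounts to `d^N` and vanishes on the
Koszul terms only; in degree zero it is an augmentation of a positive block. -/
theorem barD_wordToBarLin (b : Module.Basis (Fin n) k Z) (hN : 2 ≤ N) (hR' : R ≤ deg1 k Z ^ N)
    (i : ℕ) {y : QuotAlg R ⊗[k] TensorAlgebra k Z}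
    (hy : y ∈ koszulMod N R (koszulDegree N (i + 1))) :
    barD (augmentation R hR) i (wordToBarLin N R (i + 1) y) = wordToBarLin N R i
      ((koszulLin R ^ (koszulDegree N (i + 1) - koszulDegree N i)) y) := by
  have aux : ∀ i, (∀ w ∈ koszulSpace N R (koszulDegree N (i + 1)),
      barTail (augmentation R hR) i (wordToBarLin N R i
      ((koszulLin R ^ (koszulDegree N (i + 1) - koszulDegree N i)) (1 ⊗ₜ w))) = 0) →
      ∀ y ∈ koszulMod N R (koszulDegree N (i + 1)),
        barD (augmentation R hR) i (wordToBarLin N R (i + 1) y) = wordToBarLin N R i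
          ((koszulLin R ^ (koszulDegree N (i + 1) - koszulDegree N i)) y) := by
    intro i h y hy
    refine koszulMod_le (S := LinearMap.eqLocus
      (barD (augmentation R hR) i ∘ₗ wordToBarLin N R (i + 1))
      (wordToBarLin N R i ∘ₗ (koszulLin R ^ (koszulDegree N (i + 1) - koszulDegree N i))))
      (fun w hw => ?_) hy
    rw [LinearMap.mem_eqLocus, LinearMap.comp_apply, LinearMap.comp_apply]
    rw [wordToBarLin, LinearMap.baseChange_tmul, wordToBar_succ, barD_one_tmul, h w hw]
    simp
  refine aux i ?_ y hy
  clear hy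
  induction i with
  | zero =>
    intro w _
    rw [barTail, augPair_wordToBarLin, koszulDegree_zero, koszulDegree_one, Nat.sub_zero, pow_one,
      augPair_koszulLin hR b]
  | succ i ih =>
    intro w hw
    have h1 := koszulDegree_lt hN i
    have h2 := koszulDegree_lt hN (i + 1)
    have h3 := koszulDegree_add_two (N := N) i
    have hw' := tmul_mem_koszulMod (1 : QuotAlg R) hw
    rw [barTail_succ, aux i ih _ (koszulLin_pow_mem b (by omega) hw'), ← Module.End.mul_apply,
      ← pow_add]
    have h4 : koszulDegree N (i + 1) - koszulDegree N i +
      (koszulDegree N (i + 1 + 1) - koszulDegree N (i + 1)) = N := by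
        rw [show i + 1 + 1 = i + 2 from rfl] at *; omega
    rw [h4, koszulLin_pow_eq_zero hR' (j := koszulDegree N i) (by rw [← h3]; exact hw')]
    simp

/-- The value of a coboundary on a word of the Koszul complex vanishes. -/
theorem lift_wordToBar_eq_zero (b : Module.Basis (Fin n) k Z) (hN : 2 ≤ N)
    (hR' : R ≤ deg1 k Z ^ N) {i : ℕ} {Y : Type*} [AddCommGroup Y] [Module k Y]
    {f : BarCochain k (QuotAlg R) Y (i + 1)} (hf : IsBarCoboundary (augmentation R hR) f)
    {w : TensorAlgebra k Z} (hw : w ∈ koszulSpace N R (koszulDegree N (i + 1))) :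
    PiTensorProduct.lift f (wordToBar N R (i + 1) w) = 0 := by
  obtain ⟨g, hg⟩ := (isBarCoboundary_succ_iff _ _).1 hf
  have h1 := barD_wordToBarLin hR b hN hR' i (tmul_mem_koszulMod (1 : QuotAlg R) hw)
  have hlt := koszulDegree_lt hN i
  have h2 : barTail (augmentation R hR) i (wordToBarLin N R i
      ((koszulLin R ^ (koszulDegree N (i + 1) - koszulDegree N i)) (1 ⊗ₜ w))) = 0 := by
    rw [← h1, barTail_barD]
  rw [hg, LinearMap.comp_apply, wordToBar_succ, barBoundary, LinearMap.comp_apply,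
    LinearEquiv.coe_coe, LinearEquiv.symm_apply_apply, LinearMap.sub_apply, h2, sub_zero,
    augPair_wordToBarLin, show koszulDegree N (i + 1) - koszulDegree N i =
      (koszulDegree N (i + 1) - koszulDegree N i - 1) + 1 by omega, pow_succ',
    Module.End.mul_apply, augPair_koszulLin hR b, map_zero]

end Comparison

/-! ### Projectivity of the terms of the bar complex -/

section Instances

variable {k : Type u} [Field k] {Z : Type v} [AddCommGroup Z] [Module k Z]
  {N : ℕ} {R : Submodule k (TensorAlgebra k Z)}

instance instAddCommGroupKoszulMod (j : ℕ) : AddCommGroup (koszulMod N R j) :=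
  @Submodule.addCommGroup (QuotAlg R) (QuotAlg R ⊗[k] TensorAlgebra k Z) _
    TensorProduct.addCommGroup _ (koszulMod N R j)

theorem projective_tensorProduct (A : Type*) [Ring A] [Algebra k A] (X : Type*) [AddCommGroup X]
    [Module k X] : Module.Projective A (A ⊗[k] X) :=
  inferInstance

instance (i : ℕ) : Module.Projective (QuotAlg R) (QuotAlg R ⊗[k] (⨂[k]^i (QuotAlg R))) :=
  projective_tensorProduct (k := k) (QuotAlg R) (⨂[k]^i (QuotAlg R))

end Instances

/-! ### Top cohomology and the last Koszul space -/

section Codeterminant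

open CategoryTheory

variable {k : Type u} [Field k]

section BarAug

variable {A : Type u} [Ring A] [Algebra k A] (ε : A →ₐ[k] k)

/-- The augmentation of the bar resolution. -/
def barAug : A ⊗[k] (⨂[k]^0 A) →ₗ[A] trivialLeft ε :=
  augLin ε (PiTensorProduct.isEmptyEquiv (Fin 0)).toLinearMap

theorem barAug_surjective : Function.Surjective (barAug ε) := by
  intro c
  let c' : k := c
  refine ⟨algebraMap k A c' ⊗ₜ PiTensorProduct.tprod k Fin.elim0, ?_⟩
  change @Eq k (augPair ε (PiTensorProduct.isEmptyEquiv (Fin 0)).toLinearMap _) c'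
  simp

/-- Up to the identification of `A^{⊗ 0}` with `k`, the augmentation is `barTail ε 0`, so the
homotopy formula applies once more. -/
theorem barAug_exact : Function.Exact (barD ε 0) (barAug ε) := by
  have key : ∀ y, barAug ε y = (PiTensorProduct.isEmptyEquiv (R := k) (Fin 0)
      (barTail ε 0 y) : k) := by
    intro y
    change @Eq k (augPair ε (PiTensorProduct.isEmptyEquiv (Fin 0)).toLinearMap y) _
    rw [augPair_eq_comp]
    rfl
  intro y
  rw [key]
  refine (LinearEquiv.map_eq_zero_iff _).trans ⟨fun h => ⟨1 ⊗ₜ tensorCons k A 0 y, ?_⟩, ?_⟩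
  · rw [barD_one_tmul, h]
    simp
  · rintro ⟨y, rfl⟩
    exact barTail_barD ε 0 y

/-- An `A`-linear map `A ⊗ X → k` is determined by its restriction to `X`. -/
theorem exists_augLin_eq {X : Type*} [AddCommGroup X] [Module k X]
    (F : A ⊗[k] X →ₗ[A] trivialLeft ε) : ∃ f : X →ₗ[k] k, augLin ε f = F := by
  refine ⟨{ toFun := fun x => (F (1 ⊗ₜ x) : k), map_add' := ?_, map_smul' := ?_ }, ?_⟩
  · intro x y
    rw [TensorProduct.tmul_add, map_add]
    rfl
  · intro c x
    have : (1 : A) ⊗ₜ[k] (c • x) = (algebraMap k A c) • ((1 : A) ⊗ₜ[k] x) := by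
      rw [TensorProduct.tmul_smul, algebraMap_smul]
    rw [this, map_smul, trivialLeft_smul, AlgHom.commutes]
    rfl
  · refine hom_ext_one_tmul fun x => ?_
    exact (congrArg (· * (show k from F (1 ⊗ₜ x))) (map_one ε)).trans (one_mul (M := k) _)

theorem augLin_barD_eq_zero_iff {i : ℕ} (f : (⨂[k]^i A) →ₗ[k] k) :
    augLin ε f ∘ₗ barD ε i = 0 ↔ augPair ε f = f ∘ₗ barTail ε i := by
  have key : ∀ y, augLin ε f (barD ε i (1 ⊗ₜ tensorCons k A i y)) =
      (augPair ε f y - f (barTail ε i y) : k) := by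
    intro y
    rw [barD_one_tmul]
    change @Eq k (augPair ε f _) _
    rw [map_sub, augPair_tmul, map_one, one_smul]
  constructor
  · intro h
    ext1
    ext a x
    have h1 := LinearMap.congr_fun h (1 ⊗ₜ tensorCons k A i (a ⊗ₜ PiTensorProduct.tprod k x))
    rw [LinearMap.comp_apply, key] at h1
    exact sub_eq_zero.1 h1
  · intro h
    refine hom_ext_one_tmul fun x => ?_
    obtain ⟨y, rfl⟩ := (tensorCons k A i).surjective x
    rw [LinearMap.comp_apply, key, h]
    exact sub_self (G := k) _

theorem augLin_comp_barD {i : ℕ} (b : (⨂[k]^i A) →ₗ[k] k) (x : ⨂[k]^(i + 1) A) :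
    augLin ε b (barD ε i (1 ⊗ₜ x)) = (b (barBoundary k ε i x) : k) := by
  obtain ⟨y, rfl⟩ := (tensorCons k A i).surjective x
  rw [barD_one_tmul, barBoundary]
  change @Eq k (augPair ε b _) _
  rw [map_sub, augPair_tmul, map_one, one_smul, augPair_eq_comp]
  simp

end BarAug

variable {Z : Type u} [AddCommGroup Z] [Module k Z]
  {N n : ℕ} {R : Submodule k (TensorAlgebra k Z)}
  (b : Module.Basis (Fin n) k Z) (hN : 2 ≤ N)
  (hR : ∀ x ∈ R, TensorAlgebra.algebraMapInv x = 0) (hR' : R ≤ deg1 k Z ^ N)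
  (hK : IsNKoszul N R)

variable (N R) in
/-- The comparison map, on the terms of the Koszul complex. -/
def comparison (i : ℕ) : koszulMod N R (koszulDegree N i) →ₗ[QuotAlg R]
    QuotAlg R ⊗[k] (⨂[k]^i (QuotAlg R)) :=
  wordToBarLin N R i ∘ₗ (koszulMod N R (koszulDegree N i)).subtype

include hR' in
theorem comparison_comp_koszulDiff (i : ℕ) : comparison N R i ∘ₗ koszulDiff b R hN i =
    barD (augmentation R hR) i ∘ₗ comparison N R (i + 1) := by
  ext y
  exact (barD_wordToBarLin hR b hN hR' i y.2).symm

theorem barAug_comp_comparison :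
    barAug (augmentation R hR) ∘ₗ comparison N R 0 = koszulAug N hR := by
  ext y
  have := augPair_wordToBarLin hR 0 (PiTensorProduct.isEmptyEquiv (R := k) (Fin 0)).toLinearMap
    (N := N) y.1
  refine Eq.trans this ?_
  change @Eq k _ (augPair (augmentation R hR) TensorAlgebra.algebraMapInv.toLinearMap y.1)
  congr 2
  ext t
  simp [wordToBar]

include b hN hR' hK in
/-- A cocycle that vanishes on the words of the Koszul complex is a coboundary. -/
theorem isBarCoboundary_of_lift_wordToBar {i : ℕ} {Y : Type*} [AddCommGroup Y] [Module k Y]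
    (f : BarCochain k (QuotAlg R) Y (i + 1)) (hf : IsBarCocycle (augmentation R hR) f)
    (h0 : ∀ w ∈ koszulSpace N R (koszulDegree N (i + 1)),
      PiTensorProduct.lift f (wordToBar N R (i + 1) w) = 0) :
    IsBarCoboundary (augmentation R hR) f := by
  -- With values in `k`, cochains are `A`-linear maps from the bar resolution to the trivial module,
  -- and the comparison of resolutions applies.
  refine isBarCoboundary_of_dual _ f fun χ => ?_
  have hχ : PiTensorProduct.lift (χ.compMultilinearMap f) = χ ∘ₗ PiTensorProduct.lift f := by
    ext a; simp
  rw [isBarCocycle_iff] at hf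
  obtain ⟨l, hl⟩ := exists_eq_comp_of_comparison (A := QuotAlg R) (P := fun i => koszulMod N R (koszulDegree N i))
    (d := koszulDiff b R hN) (Q := fun i => QuotAlg R ⊗[k] (⨂[k]^i (QuotAlg R))) (e := barD (augmentation R hR))
    (koszulAug_surjective hN hR)
    (koszulDiff_exact_zero b hN hR) (koszulDiff_exact b hN hR' hK)
    (barAug_surjective (augmentation R hR)) (barAug_exact (augmentation R hR))
    (barD_exact (augmentation R hR)) (comparison N R) (barAug_comp_comparison hR)
    (comparison_comp_koszulDiff b hN hR hR')
    (augLin (augmentation R hR) (PiTensorProduct.lift (χ.compMultilinearMap f)))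
    (by
      rw [augLin_barD_eq_zero_iff, hχ, LinearMap.comp_assoc, ← hf]
      ext a x
      simp)
    (by
      ext y
      refine koszulMod_le (S := LinearMap.ker (augLin (augmentation R hR)
        (PiTensorProduct.lift (χ.compMultilinearMap f)) ∘ₗ wordToBarLin N R (i + 1)))
        (fun w hw => ?_) y.2
      rw [LinearMap.mem_ker, LinearMap.comp_apply, wordToBarLin, LinearMap.baseChange_tmul, hχ]
      change @Eq k (augPair (augmentation R hR) (χ ∘ₗ PiTensorProduct.lift f) _) 0
      rw [augPair_tmul, LinearMap.comp_apply, h0 w hw, map_zero, smul_zero])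
  obtain ⟨g, rfl⟩ := exists_augLin_eq (k := k) (A := QuotAlg R) (X := ⨂[k]^i (QuotAlg R))
    (augmentation R hR) l
  refine (isBarCoboundary_succ_iff _ _).2 ⟨g, ?_⟩
  ext1
  ext a
  have := LinearMap.congr_fun hl (1 ⊗ₜ PiTensorProduct.tprod k a)
  rw [LinearMap.comp_apply, augLin_comp_barD] at this
  refine Eq.trans ?_ this.symm
  change @Eq k _ (augPair (augmentation R hR) (PiTensorProduct.lift (χ.compMultilinearMap f)) _)
  simp

include b hN hR' hK in
/-- There are cocycles with any prescribed values on the words of the Koszul complex. -/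
theorem exists_isBarCocycle_wordToBar (i : ℕ) (ψ : Module.Dual k (TensorAlgebra k Z)) :
    ∃ f : BarCochain k (QuotAlg R) k (i + 1), IsBarCocycle (augmentation R hR) f ∧
      ∀ w ∈ koszulSpace N R (koszulDegree N (i + 1)),
        PiTensorProduct.lift f (wordToBar N R (i + 1) w) = ψ w := by
  obtain ⟨F, hF, l, hl⟩ := exists_restrict_of_comparison (A := QuotAlg R) (P := fun i => koszulMod N R (koszulDegree N i))
    (d := koszulDiff b R hN) (Q := fun i => QuotAlg R ⊗[k] (⨂[k]^i (QuotAlg R))) (e := barD (augmentation R hR))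
    (koszulAug_surjective hN hR)
    (koszulDiff_exact_zero b hN hR) (koszulDiff_exact b hN hR' hK)
    (barAug_surjective (augmentation R hR)) (barAug_exact (augmentation R hR))
    (barD_exact (augmentation R hR)) (comparison N R) (barAug_comp_comparison hR)
    (comparison_comp_koszulDiff b hN hR hR') (i := i)
    (augLin (augmentation R hR) ψ ∘ₗ (koszulMod N R (koszulDegree N (i + 1))).subtype)
    (trivial_comp_koszulDiff b hN hR (i + 1) _)
  -- By minimality the coboundary `l ∘ d` is zero, so the cocycle restricts to the prescribed values
  -- exactly and not merely up to a coboundary.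
  rw [trivial_comp_koszulDiff b hN hR i l, sub_eq_zero] at hl
  obtain ⟨g, rfl⟩ := exists_augLin_eq (k := k) (A := QuotAlg R) (X := ⨂[k]^(i + 1) (QuotAlg R))
    (augmentation R hR) F
  have hg : PiTensorProduct.lift (g.compMultilinearMap (PiTensorProduct.tprod k)) = g := by
    ext a; simp
  refine ⟨g.compMultilinearMap (PiTensorProduct.tprod k), ?_, fun w hw => ?_⟩
  · rw [isBarCocycle_iff, hg]
    exact (augLin_barD_eq_zero_iff _ g).1 hF
  · rw [hg]
    have := LinearMap.congr_fun hl ⟨1 ⊗ₜ w, tmul_mem_koszulMod 1 hw⟩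
    change @Eq k (augPair (augmentation R hR) g (1 ⊗ₜ wordToBar N R (i + 1) w))
      (augPair (augmentation R hR) ψ (1 ⊗ₜ w)) at this
    simpa using this

include hN b hR' hK in
/-- For an Artin-Schelter regular algebra of dimension `d`, the last term of the Koszul complex
has rank one. -/
theorem koszulSpace_eq_span {d : ℕ} (hA : IsASRegular (augmentation R hR) (d + 1))
    {s : TensorAlgebra k Z} (hs : s ∈ koszulSpace N R (koszulDegree N (d + 1))) (hs0 : s ≠ 0) :
    koszulSpace N R (koszulDegree N (d + 1)) = Submodule.span k {s} := by
  refine le_antisymm (fun w hw => ?_) ((Submodule.span_singleton_le_iff_mem _ _).2 hs)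
  by_contra hws
  -- If `w` is not a multiple of `s`, then `ψ₂` with `ψ₂ s = 0 ≠ ψ₂ w` and `ψ₁` with `ψ₁ s ≠ 0` are
  -- independent on the Koszul space. A dependence between them is derived below.
  obtain ⟨ψ₂, h2w, h2s⟩ := Submodule.exists_le_ker_of_notMem hws
  obtain ⟨ψ₁, h1s⟩ : ∃ ψ : Module.Dual k (TensorAlgebra k Z), ψ s ≠ 0 := by
    by_contra! h
    exact hs0 ((Module.forall_dual_apply_eq_zero_iff k s).1 h)
  have hpd : HasProjectiveDimensionLT (trivialLeft (augmentation R hR)) (d + 1 + 1) := by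
    have h1 : projectiveDimension (trivialLeft (augmentation R hR)) ≤ ((d + 1 : ℕ) : WithBot ℕ∞) :=
      (le_iSup (fun M : ModuleCat.{u} (QuotAlg R) => projectiveDimension M) _).trans
        hA.gldim_left.le
    exact (projectiveDimension_le_iff _ _).1 h1
  obtain ⟨r, hr, hr'⟩ := exists_split_of_projectiveDimension (A := QuotAlg R) (P := fun i => koszulMod N R (koszulDegree N i))
    (d := koszulDiff b R hN) (koszulAug_surjective hN hR)
    (koszulDiff_exact_zero b hN hR) (koszulDiff_exact b hN hR' hK) hpd
  -- The `A`-linear extension of `ψ` with values in `A` need not be a cocycle; its composition with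
  -- `r` is.
  let H (ψ : Module.Dual k (TensorAlgebra k Z)) :
      koszulMod N R (koszulDegree N (d + 1)) →ₗ[QuotAlg R] QuotAlg R :=
    extendScalars (Algebra.linearMap k (QuotAlg R) ∘ₗ ψ) ∘ₗ
      (koszulMod N R (koszulDegree N (d + 1))).subtype
  let E : QuotAlg R →ₗ[QuotAlg R] trivialLeft (augmentation R hR) :=
    { toFun := augmentation R hR
      map_add' := map_add _
      map_smul' := fun a x => map_mul (augmentation R hR) a x }
  obtain ⟨α, β, hne, l, hl⟩ := exists_dependent_of_finrank_ext (A := QuotAlg R) (P := fun i => koszulMod N R (koszulDegree N i))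
    (d := koszulDiff b R hN) (koszulAug_surjective hN hR)
    (koszulDiff_exact_zero b hN hR) (koszulDiff_exact b hN hR' hK) (k := k) hA.ext_left
    (H ψ₁ ∘ₗ r) (H ψ₂ ∘ₗ r) (by rw [LinearMap.comp_assoc, hr, LinearMap.comp_zero])
    (by rw [LinearMap.comp_assoc, hr, LinearMap.comp_zero])
  -- The idempotent `r` changes an element by a boundary only, and boundaries die in the trivial
  -- module, so the augmentation gives back `ψ`.
  have hH : ∀ (ψ : Module.Dual k (TensorAlgebra k Z)) (x) (hx : x ∈ koszulSpace N R
      (koszulDegree N (d + 1))), augmentation R hR (H ψ (r ⟨1 ⊗ₜ x, tmul_mem_koszulMod 1 hx⟩)) =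
        ψ x := by
    intro ψ x hx
    obtain ⟨y, hy⟩ := hr' ⟨1 ⊗ₜ x, tmul_mem_koszulMod 1 hx⟩
    have h1 := LinearMap.congr_fun (trivial_comp_koszulDiff b hN hR (d + 1) (E ∘ₗ H ψ)) y
    rw [LinearMap.comp_apply, hy, map_sub] at h1
    have h2 : E (H ψ ⟨1 ⊗ₜ x, tmul_mem_koszulMod 1 hx⟩) = (ψ x : k) := by
      change augmentation R hR ((1 : QuotAlg R) • algebraMap k (QuotAlg R) (ψ x)) = _
      simp
    exact (sub_eq_zero.1 h1).symm.trans h2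
  -- The augmentation kills the coboundary `l ∘ d` too, so a dependence of classes becomes one of
  -- functionals.
  have key : ∀ x ∈ koszulSpace N R (koszulDegree N (d + 1)), α * ψ₁ x + β * ψ₂ x = 0 := by
    intro x hx
    have h1 := congrArg (augmentation R hR) (hl ⟨1 ⊗ₜ x, tmul_mem_koszulMod 1 hx⟩)
    rw [map_add, map_smul, map_smul] at h1
    change α • augmentation R hR (H ψ₁ (r _)) + β • augmentation R hR (H ψ₂ (r _)) = _ at h1
    rw [hH ψ₁ x hx, hH ψ₂ x hx] at h1
    refine h1.trans ?_
    exact LinearMap.congr_fun (trivial_comp_koszulDiff b hN hR d (E ∘ₗ l)) _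
  have h3 : ψ₂ s = 0 := h2s (Submodule.mem_span_singleton_self s)
  have h4 := key s hs
  rw [h3, mul_zero, add_zero, mul_eq_zero, or_iff_left h1s] at h4
  have h5 := key w hw
  rw [h4, zero_mul, zero_add, mul_eq_zero, or_iff_left h2w] at h5
  tauto

-- A zero last term would leave no nonzero cochain with values in `A` in degree `d`, whereas
-- `Ext^d(k, A)` is one-dimensional.
include hN b hR' hK in
theorem koszulSpace_ne_bot {d : ℕ} (hA : IsASRegular (augmentation R hR) d) :
    koszulSpace N R (koszulDegree N d) ≠ ⊥ := by
  intro h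
  obtain ⟨f, hf⟩ := exists_ne_zero_of_finrank_ext (A := QuotAlg R) (P := fun i => koszulMod N R (koszulDegree N i))
    (d := koszulDiff b R hN) (koszulAug_surjective hN hR)
    (koszulDiff_exact_zero b hN hR) (koszulDiff_exact b hN hR' hK) (k := k) hA.ext_left
  refine hf ?_
  ext y
  have : koszulMod N R (koszulDegree N d) ≤ ⊥ := koszulMod_le fun w hw => by
    rw [h, Submodule.mem_bot] at hw
    simp [hw]
  have hy : y = 0 := Subtype.ext ((Submodule.mem_bot _).1 (this y.2))
  rw [hy, map_zero, map_zero]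

end Codeterminant

/-! ### Words in the tensor algebra and functionals on them -/

section Words

variable {k : Type u} [Field k] {U : Type v} [AddCommGroup U] [Module k U]

theorem tprod_succ {j : ℕ} (w : Fin (j + 1) → U) : TensorAlgebra.tprod k U (j + 1) w =
    TensorAlgebra.ι k (w 0) * TensorAlgebra.tprod k U j (fun s => w s.succ) := by
  simp [TensorAlgebra.tprod_apply, List.ofFn_succ]

theorem tprod_cons {j : ℕ} (x : U) (w : Fin j → U) :
    TensorAlgebra.tprod k U (j + 1) (Fin.cons x w : Fin (j + 1) → U) =
      TensorAlgebra.ι k x * TensorAlgebra.tprod k U j w := by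
  simp [TensorAlgebra.tprod_apply]

theorem tprod_snoc {j : ℕ} (w : Fin j → U) (x : U) :
    TensorAlgebra.tprod k U (j + 1) (Fin.snoc w x : Fin (j + 1) → U) =
      TensorAlgebra.tprod k U j w * TensorAlgebra.ι k x := by
  rw [TensorAlgebra.tprod_apply, TensorAlgebra.tprod_apply, List.ofFn_succ']
  simp [List.concat_eq_append, -List.ofFn_succ]

theorem tprod_append {i j : ℕ} (w : Fin i → U) (w' : Fin j → U) :
    TensorAlgebra.tprod k U (i + j) (Fin.append w w' : Fin (i + j) → U) =
      TensorAlgebra.tprod k U i w * TensorAlgebra.tprod k U j w' := by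
  simp only [TensorAlgebra.tprod_apply]
  rw [← List.prod_append, ← List.ofFn_fin_append]
  congr 2
  ext s
  refine Fin.addCases (fun s => ?_) (fun s => ?_) s <;> simp

theorem tprod_mem (j : ℕ) (w : Fin j → U) : TensorAlgebra.tprod k U j w ∈ deg1 k U ^ j := by
  induction j with
  | zero => simp [TensorAlgebra.tprod_apply, Submodule.one_le.1 le_rfl]
  | succ j ih =>
    rw [tprod_succ, pow_succ']
    exact Submodule.mul_mem_mul ⟨_, rfl⟩ (ih _)

theorem hom_ext_tprod {X : Type*} [AddCommGroup X] [Module k X] {f g : TensorAlgebra k U →ₗ[k] X}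
    (h : ∀ j w, f (TensorAlgebra.tprod k U j w) = g (TensorAlgebra.tprod k U j w)) : f = g := by
  have key : f ∘ₗ (TensorAlgebra.equivDirectSum (R := k) (M := U)).symm.toLinearMap =
      g ∘ₗ (TensorAlgebra.equivDirectSum (R := k) (M := U)).symm.toLinearMap := by
    refine DirectSum.linearMap_ext _ fun j => ?_
    ext w
    have := h j w
    rw [← TensorAlgebra.ofDirectSum_of_tprod] at this
    exact this
  ext t
  have := LinearMap.congr_fun key (TensorAlgebra.equivDirectSum t)
  simpa using this

theorem tensorComponent_tprod (m : ℕ) (w : Fin m → U) :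
    tensorComponent k U m (TensorAlgebra.tprod k U m w) = PiTensorProduct.tprod k w := by
  rw [tensorComponent, LinearMap.comp_apply, AlgHom.toLinearMap_apply,
    TensorAlgebra.toDirectSum_tensorPower_tprod]
  exact DirectSum.component.lof_self k m _

theorem tensorComponent_tprod_of_ne {m j : ℕ} (h : j ≠ m) (w : Fin j → U) :
    tensorComponent k U m (TensorAlgebra.tprod k U j w) = 0 := by
  rw [tensorComponent, LinearMap.comp_apply, AlgHom.toLinearMap_apply,
    TensorAlgebra.toDirectSum_tensorPower_tprod]
  exact DirectSum.of_eq_of_ne _ _ _ h.symm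

variable {m : ℕ} (t : MultilinearMap k (fun _ : Fin m => U) k)

/-- The functional on the tensor algebra defined by a multilinear form. -/
def formFunctional : TensorAlgebra k U →ₗ[k] k := PiTensorProduct.lift t ∘ₗ tensorComponent k U m

theorem formFunctional_tprod (w : Fin m → U) :
    formFunctional t (TensorAlgebra.tprod k U m w) = t w := by
  rw [formFunctional, LinearMap.comp_apply, tensorComponent_tprod, PiTensorProduct.lift.tprod]

theorem formFunctional_tprod_of_ne {j : ℕ} (h : j ≠ m) (w : Fin j → U) :
    formFunctional t (TensorAlgebra.tprod k U j w) = 0 := by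
  rw [formFunctional, LinearMap.comp_apply, tensorComponent_tprod_of_ne h, map_zero]

variable {t} in
/-- A preregular form is cyclic up to a twist. -/
theorem IsPreregular.exists_cyclic (ht : IsPreregular t) : ∃ φ : U ≃ₗ[k] U,
    ∀ x z, formFunctional t (x * TensorAlgebra.ι k z) =
      formFunctional t (TensorAlgebra.ι k (φ z) * x) := by
  obtain ⟨-, φ, hφ⟩ := ht
  refine ⟨φ, fun x z => ?_⟩
  have : formFunctional t ∘ₗ LinearMap.mulRight k (TensorAlgebra.ι k z) =
      formFunctional t ∘ₗ LinearMap.mulLeft k (TensorAlgebra.ι k (φ z)) := by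
    refine hom_ext_tprod fun j w => ?_
    simp only [LinearMap.comp_apply, LinearMap.mulRight_apply, LinearMap.mulLeft_apply]
    rw [← tprod_snoc, ← tprod_cons]
    -- The functional is zero outside length `m`, so the cyclic identity carries content in that
    -- length only.
    by_cases h : j + 1 = m
    · subst h
      rw [formFunctional_tprod, formFunctional_tprod, hφ]
      congr 1
      ext s
      refine Fin.cases ?_ (fun s => ?_) s
      · have : (finRotate (j + 1)).symm 0 = Fin.last j := by
          rw [Equiv.symm_apply_eq, finRotate_last]
        simp [this]
      · have : (finRotate (j + 1)).symm s.succ = s.castSucc := by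
          rw [Equiv.symm_apply_eq, finRotate_apply, Fin.coeSucc_eq_succ]
        simp [this]
    · rw [formFunctional_tprod_of_ne _ h, formFunctional_tprod_of_ne _ h]
  exact LinearMap.congr_fun this x

/-- The form given by a product of coordinates. -/
def coordForm {n : ℕ} (b : Module.Basis (Fin n) k U) (j : Fin m → Fin n) :
    MultilinearMap k (fun _ : Fin m => U) k :=
  (MultilinearMap.mkPiAlgebra k (Fin m) k).compLinearMap fun s => b.coord (j s)

/-- The coordinate forms are dual to the words in the basis; they read off coefficients in the
tensor algebra. -/
theorem formFunctional_coordForm {n : ℕ} (b : Module.Basis (Fin n) k U) (j i : Fin m → Fin n) :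
    formFunctional (coordForm b j) (TensorAlgebra.tprod k U m fun s => b (i s)) =
      if i = j then 1 else 0 := by
  rw [formFunctional_tprod, coordForm, MultilinearMap.compLinearMap_apply,
    MultilinearMap.mkPiAlgebra_apply]
  simp only [Module.Basis.coord_apply, Module.Basis.repr_self, Finsupp.single_apply]
  rw [Fintype.prod_ite_zero]
  simp [funext_iff]

theorem formFunctional_coordForm_tensorOf {n : ℕ} (b : Module.Basis (Fin n) k U)
    (j : Fin m → Fin n) (c : (Fin m → Fin n) → k) :
    formFunctional (coordForm b j) (tensorOf b c) = c j := by
  simp only [tensorOf, map_sum, map_smul, formFunctional_coordForm]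
  simp

end Words

/-! ### Contractions of a form from both sides -/

section PartialWords

variable {k : Type u} [Field k] {Z : Type v} [AddCommGroup Z] [Module k Z] {U : Type w}
  [AddCommGroup U] [Module k U] {n : ℕ} (b : Module.Basis (Fin n) k Z)
  (u : Module.Basis (Fin n) k U) (E : TensorAlgebra k U →ₗ[k] k)

/-- The element `∑ E(x u_{i₁} ⋯ u_{i_j} y) b_{i₁} ⋯ b_{i_j}`. -/
def partialWord : ℕ → TensorAlgebra k U → TensorAlgebra k U → TensorAlgebra k Z
  | 0, x, y => E (x * y) • 1
  | j + 1, x, y =>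
    ∑ l, TensorAlgebra.ι k (b l) * partialWord j (x * TensorAlgebra.ι k (u l)) y

/-- The definition peels letters off at the left end; this peels them off at the right end, where
they join `y`. -/
theorem partialWord_succ' (j : ℕ) (x y : TensorAlgebra k U) :
    partialWord b u E (j + 1) x y =
      ∑ l, partialWord b u E j x (TensorAlgebra.ι k (u l) * y) * TensorAlgebra.ι k (b l) := by
  induction j generalizing x with
  | zero => simp [partialWord, mul_assoc]
  | succ j ih =>
    rw [partialWord]
    simp only [ih, Finset.mul_sum, ← mul_assoc]
    rw [Finset.sum_comm]
    refine Finset.sum_congr rfl fun l _ => ?_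
    rw [partialWord, Finset.sum_mul]

theorem partialWord_add_left (j : ℕ) (x x' y : TensorAlgebra k U) :
    partialWord b u E j (x + x') y = partialWord b u E j x y + partialWord b u E j x' y := by
  induction j generalizing x x' with
  | zero => simp [partialWord, add_mul, add_smul]
  | succ j ih => simp [partialWord, add_mul, ih, mul_add, Finset.sum_add_distrib]

theorem partialWord_smul_left (j : ℕ) (r : k) (x y : TensorAlgebra k U) :
    partialWord b u E j (r • x) y = r • partialWord b u E j x y := by
  induction j generalizing x with
  | zero => simp [partialWord, mul_smul]
  | succ j ih => simp [partialWord, ih, Finset.smul_sum]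

/-- `partialWord` as a linear map in its first argument. -/
def partialWordLin (j : ℕ) (y : TensorAlgebra k U) : TensorAlgebra k U →ₗ[k] TensorAlgebra k Z where
  toFun x := partialWord b u E j x y
  map_add' x x' := partialWord_add_left b u E j x x' y
  map_smul' r x := partialWord_smul_left b u E j r x y

theorem partialWord_eq_sum (j : ℕ) (x y : TensorAlgebra k U) :
    partialWord b u E j x y = ∑ i : Fin j → Fin n,
      E (x * TensorAlgebra.tprod k U j (fun s => u (i s)) * y) •
        TensorAlgebra.tprod k Z j (fun s => b (i s)) := by
  induction j generalizing x with
  | zero =>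
    simp [partialWord, TensorAlgebra.tprod_apply]
  | succ j ih =>
    rw [partialWord, ← (Fin.consEquiv fun _ => Fin n).sum_comp, Fintype.sum_prod_type]
    refine Finset.sum_congr rfl fun l _ => ?_
    rw [ih, Finset.mul_sum]
    refine Finset.sum_congr rfl fun i _ => ?_
    simp [mul_assoc]

theorem partialWord_add_right (j : ℕ) (x y y' : TensorAlgebra k U) :
    partialWord b u E j x (y + y') = partialWord b u E j x y + partialWord b u E j x y' := by
  simp only [partialWord_eq_sum, mul_add, map_add, add_smul, Finset.sum_add_distrib]

theorem partialWord_smul_right (j : ℕ) (r : k) (x y : TensorAlgebra k U) :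
    partialWord b u E j x (r • y) = r • partialWord b u E j x y := by
  simp only [partialWord_eq_sum, mul_smul_comm, map_smul, smul_assoc, Finset.smul_sum]

/-- Contraction hands the first letter over to the argument `x` of the form, so iterated
contractions are the same elements with a longer `x`. -/
theorem contractFirst_partialWord (j : ℕ) (p : Fin n) (x y : TensorAlgebra k U) :
    contractFirst (b.coord p) (partialWord b u E (j + 1) x y) =
      partialWord b u E j (x * TensorAlgebra.ι k (u p)) y := by
  rw [partialWord, map_sum]
  simp [contractFirst_ι_mul, Finsupp.single_apply]

/-- The span of the elements `partialWord j x 1` for `x` of degree `r`. -/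
def partialSpan (j r : ℕ) : Submodule k (TensorAlgebra k Z) :=
  (deg1 k U ^ r).map (partialWordLin b u E j 1)

theorem deg1_eq_span : deg1 k U = Submodule.span k (Set.range fun l => TensorAlgebra.ι k (u l)) := by
  rw [deg1, LinearMap.range_eq_map, ← u.span_eq, Submodule.map_span, ← Set.range_comp]
  rfl

theorem contractFirst_eq_sum (ν : Module.Dual k Z) (x : TensorAlgebra k Z) :
    contractFirst ν x = ∑ l, ν (b l) • contractFirst (b.coord l) x := by
  have : ν = ∑ l, ν (b l) • b.coord l := by
    refine b.ext fun i => ?_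
    simp
  have h2 : LinearMap.rTensor (TensorAlgebra k Z) ν =
      ∑ l, ν (b l) • LinearMap.rTensor (TensorAlgebra k Z) (b.coord l) := by
    conv_lhs => rw [this]
    ext z t
    have hz := LinearMap.congr_fun this z
    simp only [LinearMap.sum_apply, LinearMap.smul_apply] at hz
    simp [TensorProduct.smul_tmul', hz, TensorProduct.sum_tmul]
  simp [contractFirst, h2]

theorem partialSpace_partialSpan (j r : ℕ) :
    partialSpace (partialSpan b u E (j + 1) r) = partialSpan b u E j (r + 1) := by
  refine le_antisymm (Submodule.span_le.2 ?_) ?_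
  · rintro _ ⟨ν, _, ⟨x, hx, rfl⟩, rfl⟩
    rw [contractFirst_eq_sum b]
    refine Submodule.sum_mem _ fun l _ => Submodule.smul_mem _ _ ?_
    exact ⟨x * TensorAlgebra.ι k (u l), by
      rw [pow_succ]; exact Submodule.mul_mem_mul hx ⟨_, rfl⟩,
      (contractFirst_partialWord b u E j l x 1).symm⟩
  · rw [partialSpan, pow_succ, Submodule.map_le_iff_le_comap, Submodule.mul_le]
    intro x hx _ hz
    rw [deg1_eq_span u] at hz
    induction hz using Submodule.span_induction with
    | mem _ h =>
      obtain ⟨l, rfl⟩ := h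
      exact Submodule.subset_span ⟨b.coord l, _, ⟨x, hx, rfl⟩,
        (contractFirst_partialWord b u E j l x 1).symm⟩
    | zero => rw [mul_zero]; exact Submodule.zero_mem _
    | add z z' _ _ h h' => rw [mul_add]; exact Submodule.add_mem _ h h'
    | smul r z _ h => rw [mul_smul_comm]; exact Submodule.smul_mem _ _ h

theorem partialSpace_iterate_partialSpan (j r q : ℕ) :
    partialSpace^[q] (partialSpan b u E (j + q) r) = partialSpan b u E j (r + q) := by
  induction q generalizing r with
  | zero => rfl
  | succ q ih =>
    rw [Function.iterate_succ_apply, ← add_assoc, partialSpace_partialSpan, ih]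
    congr 1
    omega

-- A letter passes from the end of `y` to the front of `x` at the cost of the twist `φ`. This is why
-- contractions at either end, in any mixture, span one and the same space.
variable {E} in
theorem partialWord_cyclic {φ : U ≃ₗ[k] U} (hE : ∀ x z, E (x * TensorAlgebra.ι k z) =
      E (TensorAlgebra.ι k (φ z) * x)) (j : ℕ) (x y : TensorAlgebra k U) (z : U) :
    partialWord b u E j x (y * TensorAlgebra.ι k z) =
      partialWord b u E j (TensorAlgebra.ι k (φ z) * x) y := by
  simp only [partialWord_eq_sum, ← mul_assoc, hE]

variable {E} in
theorem partialWord_mem_partialSpan {φ : U ≃ₗ[k] U} (hE : ∀ x z, E (x * TensorAlgebra.ι k z) =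
      E (TensorAlgebra.ι k (φ z) * x)) (j : ℕ) {q r : ℕ} {x y : TensorAlgebra k U}
    (hx : x ∈ deg1 k U ^ q) (hy : y ∈ deg1 k U ^ r) :
    partialWord b u E j x y ∈ partialSpan b u E j (q + r) := by
  have key : ∀ (r q : ℕ) (x y : TensorAlgebra k U), x ∈ deg1 k U ^ q → y ∈ deg1 k U ^ r →
      ∃ x' ∈ deg1 k U ^ (q + r), ∀ j, partialWord b u E j x y = partialWord b u E j x' 1 := by
    intro r
    induction r with
    | zero =>
      intro q x y hx hy
      rw [pow_zero, Submodule.one_eq_range] at hy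
      obtain ⟨a, rfl⟩ := hy
      refine ⟨a • x, Submodule.smul_mem _ _ hx, fun j => ?_⟩
      simp [partialWord_eq_sum, Algebra.algebraMap_eq_smul_one]
    | succ r ih =>
      intro q x y hx hy
      rw [pow_succ] at hy
      induction hy using Submodule.mul_induction_on' with
      | mem_mul_mem y hy z hz =>
        obtain ⟨z, rfl⟩ := hz
        obtain ⟨x', hx', h⟩ := ih (q + 1) (TensorAlgebra.ι k (φ z) * x) y
          (by rw [pow_succ']; exact Submodule.mul_mem_mul ⟨_, rfl⟩ hx) hy
        exact ⟨x', by rwa [add_assoc, add_comm 1] at hx', fun j => by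
          rw [partialWord_cyclic b u hE, h]⟩
      | add y _ y' _ h h' =>
        obtain ⟨x₁, hx₁, h₁⟩ := h
        obtain ⟨x₂, hx₂, h₂⟩ := h'
        refine ⟨x₁ + x₂, Submodule.add_mem _ hx₁ hx₂, fun j => ?_⟩
        rw [partialWord_add_left, ← h₁, ← h₂]
        simp only [partialWord_eq_sum, mul_add, map_add, add_smul, Finset.sum_add_distrib]
  obtain ⟨x', hx', h⟩ := key r q x y hx hy
  rw [h j]
  exact ⟨x', hx', rfl⟩

/-- Every element of the partial span is obtained by contracting last letters only. -/
theorem exists_partialWord_one_left {E : TensorAlgebra k U →ₗ[k] k} {φ : U ≃ₗ[k] U}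
    (hE : ∀ x z, E (x * TensorAlgebra.ι k z) = E (TensorAlgebra.ι k (φ z) * x)) (j r : ℕ)
    {x : TensorAlgebra k U} (hx : x ∈ deg1 k U ^ r) :
    ∃ y ∈ deg1 k U ^ r, partialWord b u E j x 1 = partialWord b u E j 1 y := by
  have key : ∀ (r s : ℕ) (x y : TensorAlgebra k U), x ∈ deg1 k U ^ r → y ∈ deg1 k U ^ s →
      ∃ y' ∈ deg1 k U ^ (r + s), partialWord b u E j x y = partialWord b u E j 1 y' := by
    intro r
    induction r with
    | zero =>
      intro s x y hx hy
      rw [pow_zero, Submodule.one_eq_range] at hx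
      obtain ⟨a, rfl⟩ := hx
      refine ⟨a • y, by rw [zero_add]; exact Submodule.smul_mem _ _ hy, ?_⟩
      simp [partialWord_eq_sum, Algebra.algebraMap_eq_smul_one]
    | succ r ih =>
      intro s x y hx hy
      rw [pow_succ'] at hx
      induction hx using Submodule.mul_induction_on' with
      | mem_mul_mem z hz x hx =>
        obtain ⟨z, rfl⟩ := hz
        -- The front letter `z` moves to the end as `φ⁻¹ z`.
        obtain ⟨y', hy', h⟩ := ih (s + 1) x (y * TensorAlgebra.ι k (φ.symm z)) hx
          (by rw [pow_succ]; exact Submodule.mul_mem_mul hy ⟨_, rfl⟩)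
        refine ⟨y', by rwa [add_assoc, add_comm 1], ?_⟩
        rw [← h, partialWord_cyclic b u hE, φ.apply_symm_apply]
      | add x _ x' _ h h' =>
        obtain ⟨y₁, hy₁, h₁⟩ := h
        obtain ⟨y₂, hy₂, h₂⟩ := h'
        refine ⟨y₁ + y₂, Submodule.add_mem _ hy₁ hy₂, ?_⟩
        rw [partialWord_add_left, h₁, h₂]
        simp only [partialWord_eq_sum, mul_add, map_add, add_smul,
          Finset.sum_add_distrib]
  exact key r 0 x 1 hx (by simp [Submodule.one_le.1 le_rfl])

end PartialWords

/-! ### The relations of a preregular form -/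

section Superpotential

variable {k : Type u} [Field k] {Z : Type v} [AddCommGroup Z] [Module k Z] {U : Type w}
  [AddCommGroup U] [Module k U] {n m N : ℕ} (b : Module.Basis (Fin n) k Z)
  (u : Module.Basis (Fin n) k U) (e : MultilinearMap k (fun _ : Fin m => U) k)

theorem partialWord_one_one :
    partialWord b u (formFunctional e) m 1 1 = tensorOf b (coeff u e) := by
  simp only [partialWord_eq_sum, one_mul, mul_one, formFunctional_tprod]
  rfl

theorem partialSpan_zero : partialSpan b u (formFunctional e) m 0 =
    Submodule.span k {tensorOf b (coeff u e)} := by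
  rw [partialSpan, pow_zero, Submodule.one_eq_span, Submodule.map_span, Set.image_singleton,
    ← partialWord_one_one]
  rfl

theorem relSpace_eq_partialSpan (h : N ≤ m) :
    relSpace b (coeff u e) N = partialSpan b u (formFunctional e) N (m - N) := by
  rw [relSpace, ← partialSpan_zero b u]
  have := partialSpace_iterate_partialSpan b u (formFunctional e) N 0 (m - N)
  rwa [Nat.add_sub_cancel' h, zero_add] at this

theorem tprod_mul_tprod_joinIdx (h : N ≤ m) (l : Fin (m - N) → Fin n) (i : Fin N → Fin n) :
    TensorAlgebra.tprod k U (m - N) (fun s => u (l s)) *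
      TensorAlgebra.tprod k U N (fun s => u (i s)) =
    TensorAlgebra.tprod k U m (fun s => u (joinIdx h l i s)) := by
  rw [← tprod_append]
  have key : ∀ (M : ℕ) (hM : m - N + N = M) (w : Fin (m - N + N) → U),
      TensorAlgebra.tprod k U (m - N + N) w =
        TensorAlgebra.tprod k U M (fun s => w (Fin.cast hM.symm s)) := by
    rintro _ rfl w
    rfl
  rw [key m (by omega)]
  congr 1
  ext s
  simp only [joinIdx]
  generalize Fin.cast _ s = s'
  refine Fin.addCases (fun s => ?_) (fun s => ?_) s' <;> simp

theorem partialWord_tprod (h : N ≤ m) (l : Fin (m - N) → Fin n) :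
    partialWord b u (formFunctional e) N
      (TensorAlgebra.tprod k U (m - N) (fun s => u (l s))) 1 =
      ∑ i, coeff u e (joinIdx h l i) • TensorAlgebra.tprod k Z N (fun s => b (i s)) := by
  simp only [partialWord_eq_sum, mul_one, tprod_mul_tprod_joinIdx u h, formFunctional_tprod]
  rfl

theorem deg1_pow_eq_span (r : ℕ) : deg1 k U ^ r = Submodule.span k
    (Set.range fun l : Fin r → Fin n => TensorAlgebra.tprod k U r fun s => u (l s)) := by
  refine le_antisymm ?_ (Submodule.span_le.2 ?_)
  · induction r with
    | zero =>
      rw [pow_zero, Submodule.one_eq_span]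
      refine Submodule.span_mono ?_
      rintro _ rfl
      exact ⟨Fin.elim0, by simp [TensorAlgebra.tprod_apply]⟩
    | succ r ih =>
      rw [pow_succ']
      refine (mul_le_mul' (deg1_eq_span u).le ih).trans ?_
      rw [Submodule.span_mul_span]
      refine Submodule.span_mono ?_
      rintro _ ⟨_, ⟨l, rfl⟩, _, ⟨i, rfl⟩, rfl⟩
      refine ⟨Fin.cons l i, ?_⟩
      simp
  · rintro _ ⟨l, rfl⟩
    exact tprod_mem _ _

theorem relSpace_eq_span (h : N ≤ m) : relSpace b (coeff u e) N = Submodule.span k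
    (Set.range fun l : Fin (m - N) → Fin n =>
      ∑ i, coeff u e (joinIdx h l i) • TensorAlgebra.tprod k Z N (fun s => b (i s))) := by
  rw [relSpace_eq_partialSpan b u e h, partialSpan, deg1_pow_eq_span u, Submodule.map_span,
    ← Set.range_comp]
  congr 2
  ext l
  exact partialWord_tprod b u e h l

-- Split `s` into `r` letters, a middle part of `N` letters, and `s` letters. The middle part is a
-- contraction of the form from both sides, and by cyclicity it lies in the space of relations.
variable {e} in
theorem tensorOf_mem_koszulSpace (he : IsPreregular e) (h : N ≤ m) :
    tensorOf b (coeff u e) ∈ koszulSpace N (relSpace b (coeff u e) N) m := by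
  obtain ⟨φ, hφ⟩ := he.exists_cyclic
  simp only [koszulSpace, Submodule.mem_inf, Submodule.mem_iInf]
  refine ⟨tensorOf_mem b _, ?_⟩
  rintro r s hrs
  -- Letters are peeled off at the right end: `s'` of them remain, and `t` have already gone into
  -- `y`.
  have h1 : ∀ (s' t : ℕ) (x : TensorAlgebra k U) (y : TensorAlgebra k U), x ∈ deg1 k U ^ r →
      y ∈ deg1 k U ^ t → t + s' = s → partialWord b u (formFunctional e) (N + s') x y ∈
        relSpace b (coeff u e) N * deg1 k Z ^ s' := by
    intro s'
    induction s' with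
    | zero =>
      intro t x y hx hy ht
      rw [pow_zero, mul_one, relSpace_eq_partialSpan b u e h]
      have := partialWord_mem_partialSpan b u hφ N hx hy
      rwa [show r + t = m - N by omega] at this
    | succ s' ih =>
      intro t x y hx hy ht
      rw [← add_assoc, partialWord_succ', pow_succ, ← mul_assoc]
      refine Submodule.sum_mem _ fun l _ => Submodule.mul_mem_mul ?_ ⟨_, rfl⟩
      refine ih (t + 1) _ _ hx ?_ (by omega)
      rw [pow_succ']
      exact Submodule.mul_mem_mul ⟨_, rfl⟩ hy
  -- The same at the left end: `r'` letters remain, and `t` have gone into `x`.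
  have h2 : ∀ (r' t : ℕ) (x : TensorAlgebra k U), x ∈ deg1 k U ^ t → t + r' = r →
      partialWord b u (formFunctional e) (N + s + r') x 1 ∈
        deg1 k Z ^ r' * (relSpace b (coeff u e) N * deg1 k Z ^ s) := by
    intro r'
    induction r' with
    | zero =>
      intro t x hx ht
      rw [pow_zero, one_mul]
      exact h1 s 0 x 1 (by rwa [← ht, add_zero]) (by simp [Submodule.one_le.1 le_rfl])
        (by omega)
    | succ r' ih =>
      intro t x hx ht
      rw [← add_assoc, partialWord, pow_succ', mul_assoc]
      refine Submodule.sum_mem _ fun l _ => Submodule.mul_mem_mul ⟨_, rfl⟩ ?_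
      refine ih (t + 1) _ ?_ (by omega)
      rw [pow_succ]
      exact Submodule.mul_mem_mul hx ⟨_, rfl⟩
  rw [← partialWord_one_one b u, mul_assoc]
  have := h2 r 0 1 (by simp [Submodule.one_le.1 le_rfl]) (by omega)
  rwa [show N + s + r = m by omega] at this

variable {e} in
theorem tensorOf_ne_zero (he : IsPreregular e) [Nontrivial U] :
    tensorOf b (coeff u e) ≠ 0 := by
  intro h
  have h0 : e = 0 := by
    refine Module.Basis.ext_multilinear (fun _ => u) fun i => ?_
    have := formFunctional_coordForm_tensorOf b i (coeff u e)
    rw [h, map_zero] at this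
    exact this.symm
  obtain ⟨z, hz⟩ := exists_ne (0 : U)
  exact hz (he.1 z fun w _ => by rw [h0]; rfl)

end Superpotential

/-! ### Subspaces `K ⊗ S` and slice maps -/

section Slices

variable {k : Type u} [Field k] {K : Type v} [AddCommGroup K] [Module k K]
  {X : Type w} [AddCommGroup X] [Module k X]

/-- The slice map `χ ⊗ id`. -/
def slice (χ : Module.Dual k K) : K ⊗[k] X →ₗ[k] X :=
  (TensorProduct.lid k X).toLinearMap ∘ₗ LinearMap.rTensor X χ

theorem slice_tmul (χ : Module.Dual k K) (a : K) (x : X) : slice χ (a ⊗ₜ x) = χ a • x := rfl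

theorem slice_lTensor {Y : Type*} [AddCommGroup Y] [Module k Y] (χ : Module.Dual k K)
    (f : X →ₗ[k] Y) (z : K ⊗[k] X) : slice χ (LinearMap.lTensor K f z) = f (slice χ z) := by
  induction z with
  | zero => simp
  | add x y hx hy => simp only [map_add, hx, hy]
  | tmul a x => simp [slice_tmul]

theorem eq_zero_of_slice {z : K ⊗[k] X} (h : ∀ χ : Module.Dual k K, slice χ z = 0) : z = 0 := by
  classical
  let b := Module.Basis.ofVectorSpace k K
  have key : ∀ z : K ⊗[k] X, ∀ i,
      TensorProduct.equivFinsuppOfBasisLeft b z i = slice (b.coord i) z := by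
    intro z i
    induction z with
    | zero => simp
    | add x y hx hy => simp only [map_add, Finsupp.add_apply, hx, hy]
    | tmul a x => simp [slice_tmul]
  refine (TensorProduct.equivFinsuppOfBasisLeft b).injective (Finsupp.ext fun i => ?_)
  rw [key, h, map_zero, Finsupp.zero_apply]

variable (K) in
/-- The subspace `K ⊗ S` of `K ⊗ X`. -/
def tensorSub (S : Submodule k X) : Submodule k (K ⊗[k] X) :=
  LinearMap.range (LinearMap.lTensor K S.subtype)

/-- Exactness of `K ⊗ -` turns membership into vanishing in `K ⊗ X/S`, which slices detect. In this
form membership is visibly compatible with intersections. -/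
theorem mem_tensorSub_iff {S : Submodule k X} {z : K ⊗[k] X} :
    z ∈ tensorSub K S ↔ ∀ χ : Module.Dual k K, slice χ z ∈ S := by
  constructor
  · rintro ⟨z, rfl⟩ χ
    rw [slice_lTensor]
    exact (slice χ z).2
  · intro h
    have hex := lTensor_exact K (f := S.subtype) (g := S.mkQ)
      (LinearMap.exact_subtype_mkQ S) (Submodule.mkQ_surjective S)
    refine (hex z).1 (eq_zero_of_slice fun χ => ?_)
    rw [slice_lTensor]
    exact (Submodule.Quotient.mk_eq_zero S).2 (h χ)

theorem tmul_mem_tensorSub {S : Submodule k X} (a : K) {x : X} (hx : x ∈ S) :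
    a ⊗ₜ x ∈ tensorSub K S :=
  ⟨a ⊗ₜ ⟨x, hx⟩, rfl⟩

theorem tensorSub_le {S : Submodule k X} {T : Submodule k (K ⊗[k] X)}
    (h : ∀ a : K, ∀ x ∈ S, a ⊗ₜ x ∈ T) : tensorSub K S ≤ T := by
  rintro _ ⟨z, rfl⟩
  induction z with
  | zero => simp
  | add x y hx hy => rw [map_add]; exact T.add_mem hx hy
  | tmul a x => exact h a x x.2

theorem lTensor_mem_tensorSub {Y : Type*} [AddCommGroup Y] [Module k Y] {S : Submodule k X}
    {T : Submodule k Y} {f : X →ₗ[k] Y} (h : ∀ x ∈ S, f x ∈ T) {z : K ⊗[k] X}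
    (hz : z ∈ tensorSub K S) : LinearMap.lTensor K f z ∈ tensorSub K T := by
  rw [mem_tensorSub_iff] at hz ⊢
  intro χ
  rw [slice_lTensor]
  exact h _ (hz χ)

theorem mul_mem_tensorSub {K A : Type*} [Ring K] [Algebra k K] [Ring A] [Algebra k A]
    {S T : Submodule k A} {x y : K ⊗[k] A} (hx : x ∈ tensorSub K S) (hy : y ∈ tensorSub K T) :
    x * y ∈ tensorSub K (S * T) := by
  have h1 : tensorSub K S ≤ (tensorSub K (S * T)).comap (LinearMap.mulRight k y) := by
    refine tensorSub_le fun a s hs => ?_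
    have h2 : tensorSub K T ≤ (tensorSub K (S * T)).comap (LinearMap.mulLeft k (a ⊗ₜ s)) := by
      refine tensorSub_le fun c t ht => ?_
      simp only [Submodule.mem_comap, LinearMap.mulLeft_apply, Algebra.TensorProduct.tmul_mul_tmul]
      exact tmul_mem_tensorSub _ (Submodule.mul_mem_mul hs ht)
    exact h2 hy
  exact h1 hx

end Slices

/-! ### The degree `N` part of the ideal of relations -/

section Kernel

section Graded

variable {k : Type u} [Field k] {A : Type v} [Ring A] [Algebra k A] (𝒜 : ℕ → Submodule k A)
  [GradedAlgebra 𝒜] (h𝒜 : 𝒜 0 ≤ 1) {N : ℕ} {R : Submodule k A}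

include h𝒜

/-- For a subspace `R` of degree `N` in a connected graded algebra, the sum of `R` and the part
of degree greater than `N` is a left ideal. -/
def truncationIdeal (N : ℕ) (R : Submodule k A) : Ideal A where
  carrier := {t | (∀ j < N, GradedRing.proj 𝒜 j t = 0) ∧ GradedRing.proj 𝒜 N t ∈ R}
  add_mem' := by
    rintro s t ⟨h1, h2⟩ ⟨h3, h4⟩
    refine ⟨fun j hj => ?_, ?_⟩
    · rw [map_add, h1 j hj, h3 j hj, add_zero]
    · rw [map_add]
      exact R.add_mem h2 h4
  zero_mem' := by simp
  smul_mem' := by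
    rintro s t ⟨h1, h2⟩
    rw [smul_eq_mul]
    simp only [GradedRing.proj_apply] at h1 h2
    induction s using DirectSum.Decomposition.inductionOn 𝒜 with
    | zero => simp
    | @homogeneous i s =>
      simp only [GradedRing.proj_apply, Set.mem_ofPred_eq]
      refine ⟨fun j hj => ?_, ?_⟩
      · by_cases hij : i ≤ j
        · rw [DirectSum.coe_decompose_mul_of_left_mem_of_le 𝒜 s.2 hij, h1 _ (by omega),
            mul_zero]
        · rw [DirectSum.coe_decompose_mul_of_left_mem_of_not_le 𝒜 s.2 hij]
      · by_cases hi : i ≤ N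
        · rw [DirectSum.coe_decompose_mul_of_left_mem_of_le 𝒜 s.2 hi]
          -- A factor of degree zero is a scalar, by connectedness; one of positive degree meets
          -- only the components below `N`, which are zero.
          rcases Nat.eq_zero_or_pos i with rfl | hi'
          · obtain ⟨s, hs⟩ := s
            have hs' := h𝒜 hs
            rw [Submodule.one_eq_range] at hs'
            obtain ⟨c, rfl⟩ := hs'
            simp only [Algebra.linearMap_apply, Nat.sub_zero]
            rw [← Algebra.smul_def]
            exact R.smul_mem _ h2
          · rw [h1 _ (by omega), mul_zero]
            exact R.zero_mem
        · rw [DirectSum.coe_decompose_mul_of_left_mem_of_not_le 𝒜 s.2 hi]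
          exact R.zero_mem
    | add s s' hs hs' =>
      rw [add_mul]
      refine ⟨fun j hj => ?_, ?_⟩
      · rw [map_add, hs.1 j hj, hs'.1 j hj, add_zero]
      · rw [map_add]
        exact R.add_mem hs.2 hs'.2

theorem mul_mem_truncationIdeal (hR : R ≤ 𝒜 N) {r : A} (hr : r ∈ R) (t : A) :
    r * t ∈ truncationIdeal 𝒜 h𝒜 N R := by
  refine ⟨fun j hj => ?_, ?_⟩
  · rw [GradedRing.proj_apply,
      DirectSum.coe_decompose_mul_of_left_mem_of_not_le 𝒜 (hR hr) (by omega)]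
  · rw [GradedRing.proj_apply,
      DirectSum.coe_decompose_mul_of_left_mem_of_le 𝒜 (hR hr) le_rfl, Nat.sub_self]
    have h0 := h𝒜 (DirectSum.decompose 𝒜 t 0).2
    rw [Submodule.one_eq_range] at h0
    obtain ⟨c, hc⟩ := h0
    rw [← hc, Algebra.linearMap_apply, ← Algebra.commutes, ← Algebra.smul_def]
    exact R.smul_mem _ hr

theorem mem_of_mem_truncationIdeal {x : A} (hx : x ∈ 𝒜 N)
    (h : x ∈ truncationIdeal 𝒜 h𝒜 N R) : x ∈ R := by
  have := h.2
  rwa [GradedRing.proj_apply, DirectSum.decompose_of_mem_same 𝒜 hx] at this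

end Graded

variable {k : Type u} [Field k] {Z : Type v} [AddCommGroup Z] [Module k Z]
  {N : ℕ} {R : Submodule k (TensorAlgebra k Z)}

/-- The hypothesis says that `R` annihilates the left module `T(Z)/J`, so the quotient algebra acts
on it. If `x` is zero in that algebra, it kills the class of `1`. Thus a left ideal suffices here.
-/
theorem mem_ideal_of_quotMk_eq_zero {J : Ideal (TensorAlgebra k Z)} (hJ : ∀ r ∈ R, ∀ t, r * t ∈ J)
    {x : TensorAlgebra k Z} (h : quotMk R x = 0) : x ∈ J := by
  let F : QuotAlg R →ₐ[k] Module.End k (TensorAlgebra k Z ⧸ J) :=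
    RingQuot.liftAlgHom k ⟨Algebra.lsmul k k (TensorAlgebra k Z ⧸ J), by
      rintro r _ ⟨hr, rfl⟩
      rw [map_zero]
      refine LinearMap.ext fun t => ?_
      obtain ⟨t, rfl⟩ := Submodule.mkQ_surjective J t
      exact (Submodule.Quotient.mk_eq_zero J).2 (hJ r hr t)⟩
  have hF : F (quotMk R x) = Algebra.lsmul k k (TensorAlgebra k Z ⧸ J) x :=
    RingQuot.liftAlgHom_mkAlgHom_apply k _ _ x
  rw [h, map_zero] at hF
  have h1 := LinearMap.congr_fun hF (J.mkQ 1)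
  refine (Submodule.Quotient.mk_eq_zero J).1 ?_
  have h2 : Algebra.lsmul k k (TensorAlgebra k Z ⧸ J) x (J.mkQ 1) = J.mkQ (x * 1) := rfl
  rw [← h1, mul_one] at h2
  exact h2.symm

/-- The relations of degree `N` of `T(Z)/(R)`, for `R` in degree `N`, are those in `R`. -/
theorem mem_of_quotMk_eq_zero (hR : R ≤ deg1 k Z ^ N) {x : TensorAlgebra k Z}
    (hx : x ∈ deg1 k Z ^ N) (h : quotMk R x = 0) : x ∈ R := by
  have : GradedAlgebra (fun j => deg1 k Z ^ j) := TensorAlgebra.gradedAlgebra (R := k) (M := Z)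
  have h0 : deg1 k Z ^ 0 ≤ 1 := (pow_zero _).le
  exact mem_of_mem_truncationIdeal (fun j => deg1 k Z ^ j) h0 hx
    (mem_ideal_of_quotMk_eq_zero (fun r hr t => mul_mem_truncationIdeal _ h0 hR hr t) h)

end Kernel

/-! ### Contraction of the last letter -/

section LastLetter

variable {k : Type u} [Field k] {Z : Type v} [AddCommGroup Z] [Module k Z]

variable (k Z) in
/-- The reversal of words. -/
def wordReverse : TensorAlgebra k Z →ₗ[k] TensorAlgebra k Z :=
  (MulOpposite.opLinearEquiv k).symm.toLinearMap ∘ₗ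
    (TensorAlgebra.lift k ((MulOpposite.opLinearEquiv k).toLinearMap ∘ₗ
      TensorAlgebra.ι k (M := Z))).toLinearMap

theorem wordReverse_ι (z : Z) : wordReverse k Z (TensorAlgebra.ι k z) = TensorAlgebra.ι k z := by
  simp [wordReverse]

theorem wordReverse_mul (x y : TensorAlgebra k Z) :
    wordReverse k Z (x * y) = wordReverse k Z y * wordReverse k Z x := by
  simp [wordReverse]

theorem wordReverse_wordReverse (x : TensorAlgebra k Z) :
    wordReverse k Z (wordReverse k Z x) = x := by
  induction x using TensorAlgebra.induction with
  | algebraMap r => simp [wordReverse]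
  | ι z => simp [wordReverse_ι]
  | mul x y hx hy => rw [wordReverse_mul, wordReverse_mul, hx, hy]
  | add x y hx hy => rw [map_add, map_add, hx, hy]

/-- Contraction of the last letter with a functional. -/
def contractLast (ν : Module.Dual k Z) : TensorAlgebra k Z →ₗ[k] TensorAlgebra k Z :=
  wordReverse k Z ∘ₗ contractFirst ν ∘ₗ wordReverse k Z

theorem contractLast_mul_ι (ν : Module.Dual k Z) (t : TensorAlgebra k Z) (z : Z) :
    contractLast ν (t * TensorAlgebra.ι k z) = ν z • t := by
  simp [contractLast, wordReverse_mul, wordReverse_ι, contractFirst_ι_mul,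
    wordReverse_wordReverse]

end LastLetter

/-! ### Products of sums and of pure tensors -/

section Products

variable {k : Type u} [Field k]

theorem prod_ofFn_sum {A : Type*} [Ring A] [Algebra k A] {m n : ℕ} (x : Fin m → Fin n → A) :
    (List.ofFn fun s => ∑ j, x s j).prod =
      ∑ j : Fin m → Fin n, (List.ofFn fun s => x s (j s)).prod := by
  have := (MultilinearMap.mkPiAlgebraFin k m A).map_sum x
  simpa only [MultilinearMap.mkPiAlgebraFin_apply] using this

theorem prod_ofFn_tmul {A B : Type*} [Ring A] [Algebra k A] [Ring B] [Algebra k B] {m : ℕ}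
    (x : Fin m → A) (y : Fin m → B) :
    (List.ofFn fun s => x s ⊗ₜ[k] y s).prod = (List.ofFn x).prod ⊗ₜ (List.ofFn y).prod := by
  induction m with
  | zero => simp [Algebra.TensorProduct.one_def]
  | succ m ih => simp [List.ofFn_succ, ih]

end Products

/-! ### Subspaces stable under the coaction -/

section Coaction

variable {k : Type u} [Field k] {Z : Type v} [AddCommGroup Z] [Module k Z] {K : Type w} [Ring K]
  [Algebra k K] {n m N : ℕ} {b : Module.Basis (Fin n) k Z} {a : Fin n → Fin n → K}
  {ρ : TensorAlgebra k Z →ₐ[k] K ⊗[k] TensorAlgebra k Z}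
  (hρ : ∀ i, ρ (TensorAlgebra.ι k (b i)) = ∑ j, a i j ⊗ₜ[k] TensorAlgebra.ι k (b j))

include hρ in
theorem coaction_tprod (i : Fin m → Fin n) : ρ (TensorAlgebra.tprod k Z m fun s => b (i s)) =
    ∑ j, wordProd a i j ⊗ₜ[k] TensorAlgebra.tprod k Z m fun s => b (j s) := by
  simp only [TensorAlgebra.tprod_apply, map_list_prod, List.map_ofFn, Function.comp_def, hρ]
  rw [prod_ofFn_sum (k := k)]
  simp only [prod_ofFn_tmul, wordProd]

include hρ in
theorem coaction_mem {r : ℕ} {x : TensorAlgebra k Z} (hx : x ∈ deg1 k Z ^ r) :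
    ρ x ∈ tensorSub K (deg1 k Z ^ r) := by
  have h : deg1 k Z ^ r ≤ (tensorSub K (deg1 k Z ^ r)).comap ρ.toLinearMap := by
    conv_lhs => rw [deg1_pow_eq_span b]
    rw [Submodule.span_le]
    rintro _ ⟨i, rfl⟩
    rw [SetLike.mem_coe, Submodule.mem_comap, AlgHom.toLinearMap_apply, coaction_tprod hρ]
    exact Submodule.sum_mem _ fun j _ => tmul_mem_tensorSub _ (tprod_mem _ _)
  exact h hx

include hρ in
theorem coaction_tensorOf (c : (Fin m → Fin n) → k) : ρ (tensorOf b c) =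
    ∑ j, (∑ i, c i • wordProd a i j) ⊗ₜ[k] TensorAlgebra.tprod k Z m fun s => b (j s) := by
  simp only [tensorOf, map_sum, map_smul, coaction_tprod hρ, Finset.smul_sum,
    TensorProduct.sum_tmul, TensorProduct.smul_tmul']
  exact Finset.sum_comm

include hρ in
theorem coaction_tensorOf_eq_iff (c : (Fin m → Fin n) → k) (g : K) :
    ρ (tensorOf b c) = g ⊗ₜ tensorOf b c ↔ ∀ j, ∑ i, c i • wordProd a i j = c j • g := by
  rw [coaction_tensorOf hρ]
  constructor
  · intro h j
    have := congrArg (TensorProduct.rid k K ∘ LinearMap.lTensor K (formFunctional (coordForm b j)))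
      h
    simpa [formFunctional_coordForm, formFunctional_coordForm_tensorOf,
      -TensorAlgebra.tprod_apply] using this
  · intro h
    simp only [h, tensorOf, TensorProduct.tmul_sum, TensorProduct.tmul_smul,
      TensorProduct.smul_tmul']

theorem tmul_one_mul_mem {S : Submodule k (TensorAlgebra k Z)} (c : K)
    {z : K ⊗[k] TensorAlgebra k Z} (hz : z ∈ tensorSub K S) : (c ⊗ₜ 1) * z ∈ tensorSub K S := by
  have := mul_mem_tensorSub (tmul_mem_tensorSub (S := (1 : Submodule k (TensorAlgebra k Z))) c
    (Submodule.one_le.1 le_rfl)) hz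
  rwa [one_mul] at this

theorem mul_tmul_one_mem {S : Submodule k (TensorAlgebra k Z)} (c : K)
    {z : K ⊗[k] TensorAlgebra k Z} (hz : z ∈ tensorSub K S) : z * (c ⊗ₜ 1) ∈ tensorSub K S := by
  have := mul_mem_tensorSub hz (tmul_mem_tensorSub (S := (1 : Submodule k (TensorAlgebra k Z))) c
    (Submodule.one_le.1 le_rfl))
  rwa [mul_one] at this

theorem lTensor_contractFirst_mul (ν : Module.Dual k Z) (c : K) (x : Z)
    (z : K ⊗[k] TensorAlgebra k Z) :
    LinearMap.lTensor K (contractFirst ν) ((c ⊗ₜ TensorAlgebra.ι k x) * z) =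
      ν x • ((c ⊗ₜ 1) * z) := by
  induction z with
  | zero => simp
  | add y z hy hz => simp only [mul_add, map_add, hy, hz, smul_add]
  | tmul d t => simp [contractFirst_ι_mul]

theorem lTensor_contractLast_mul (ν : Module.Dual k Z) (c : K) (x : Z)
    (z : K ⊗[k] TensorAlgebra k Z) :
    LinearMap.lTensor K (contractLast ν) (z * (c ⊗ₜ TensorAlgebra.ι k x)) =
      ν x • (z * (c ⊗ₜ 1)) := by
  induction z with
  | zero => simp
  | add y z hy hz => simp only [add_mul, map_add, hy, hz, smul_add]
  | tmul d t => simp [contractLast_mul_ι]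

-- Contraction of `ρ(∑ b_l x_l)` at `b_p` leaves `∑_l (a_{lp} ⊗ 1) ρ(x_l)`, with the coefficients on
-- the left; a left inverse `Y` of the transpose of `a` isolates `ρ(x_q)`.
include hρ in
theorem coaction_first_letter_mem {S S' : Submodule k (TensorAlgebra k Z)} {Y : Fin n → Fin n → K}
    (hY : ∀ q i, ∑ p, Y q p * a i p = if i = q then 1 else 0) (x : Fin n → TensorAlgebra k Z)
    (hx : ρ (∑ l, TensorAlgebra.ι k (b l) * x l) ∈ tensorSub K S)
    (hS : ∀ p, ∀ s ∈ S, contractFirst (b.coord p) s ∈ S') (q : Fin n) :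
    ρ (x q) ∈ tensorSub K S' := by
  have h1 : ∀ p, ∑ l, (a l p ⊗ₜ 1) * ρ (x l) ∈ tensorSub K S' := by
    intro p
    have := lTensor_mem_tensorSub (hS p) hx
    simp only [map_sum, map_mul, hρ, Finset.sum_mul, lTensor_contractFirst_mul] at this
    convert this using 2 with l
    simp [Finsupp.single_apply]
  have h2 : ρ (x q) = ∑ p, (Y q p ⊗ₜ 1) * ∑ l, (a l p ⊗ₜ 1) * ρ (x l) := by
    simp only [Finset.mul_sum, ← mul_assoc, Algebra.TensorProduct.tmul_mul_tmul, mul_one]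
    rw [Finset.sum_comm]
    simp only [← Finset.sum_mul, ← TensorProduct.sum_tmul, hY]
    rw [Finset.sum_eq_single q]
    · simp [← Algebra.TensorProduct.one_def]
    · intro l _ hl
      simp [hl]
    · simp
  rw [h2]
  exact Submodule.sum_mem _ fun p _ => tmul_one_mul_mem _ (h1 p)

-- For the last letter the coefficients `a_{lp}` multiply from the right, so a right inverse of `a`
-- itself is what isolates `ρ(x_q)`.
include hρ in
theorem coaction_last_letter_mem {S S' : Submodule k (TensorAlgebra k Z)} {Y : Fin n → Fin n → K}
    (hY : ∀ i q, ∑ p, a i p * Y p q = if i = q then 1 else 0) (x : Fin n → TensorAlgebra k Z)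
    (hx : ρ (∑ l, x l * TensorAlgebra.ι k (b l)) ∈ tensorSub K S)
    (hS : ∀ p, ∀ s ∈ S, contractLast (b.coord p) s ∈ S') (q : Fin n) :
    ρ (x q) ∈ tensorSub K S' := by
  have h1 : ∀ p, ∑ l, ρ (x l) * (a l p ⊗ₜ 1) ∈ tensorSub K S' := by
    intro p
    have := lTensor_mem_tensorSub (hS p) hx
    simp only [map_sum, map_mul, hρ, Finset.mul_sum, lTensor_contractLast_mul] at this
    convert this using 2 with l
    simp [Finsupp.single_apply]
  have h2 : ρ (x q) = ∑ p, (∑ l, ρ (x l) * (a l p ⊗ₜ 1)) * (Y p q ⊗ₜ 1) := by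
    simp only [Finset.sum_mul, mul_assoc, Algebra.TensorProduct.tmul_mul_tmul, mul_one]
    rw [Finset.sum_comm]
    simp only [← Finset.mul_sum, ← TensorProduct.sum_tmul, hY]
    rw [Finset.sum_eq_single q]
    · simp [← Algebra.TensorProduct.one_def]
    · intro l _ hl
      simp [hl]
    · simp
  rw [h2]
  exact Submodule.sum_mem _ fun p _ => mul_tmul_one_mem _ (h1 p)

theorem eq_sum_contractFirst (b : Module.Basis (Fin n) k Z) {S : Submodule k (TensorAlgebra k Z)}
    {x : TensorAlgebra k Z} (hx : x ∈ deg1 k Z * S) :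
    x = ∑ l, TensorAlgebra.ι k (b l) * contractFirst (b.coord l) x := by
  induction hx using Submodule.mul_induction_on' with
  | mem_mul_mem z hz t ht =>
    obtain ⟨z, rfl⟩ := hz
    simp only [contractFirst_ι_mul, mul_smul_comm]
    simp only [Module.Basis.coord_apply, ← smul_mul_assoc, ← map_smul]
    rw [← Finset.sum_mul, ← map_sum, b.sum_repr]
  | add x _ y _ hx hy =>
    simp only [map_add, mul_add, Finset.sum_add_distrib]
    rw [← hx, ← hy]

include hρ in
/-- Subcomodules are stable under contraction of the first letter. -/
theorem coaction_partialSpace_mem {Y : Fin n → Fin n → K}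
    (hY : ∀ q i, ∑ p, Y q p * a i p = if i = q then 1 else 0) {j : ℕ}
    {S : Submodule k (TensorAlgebra k Z)} (hSj : S ≤ deg1 k Z ^ (j + 1))
    (hS : ∀ x ∈ S, ρ x ∈ tensorSub K S) :
    ∀ x ∈ partialSpace S, ρ x ∈ tensorSub K (partialSpace S) := by
  have h : partialSpace S ≤ (tensorSub K (partialSpace S)).comap ρ.toLinearMap := by
    refine Submodule.span_le.2 ?_
    rintro _ ⟨ν, x, hx, rfl⟩
    rw [SetLike.mem_coe, contractFirst_eq_sum b]
    refine Submodule.sum_mem _ fun q _ => Submodule.smul_mem _ _ ?_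
    have hx' := hSj hx
    rw [pow_succ'] at hx'
    refine coaction_first_letter_mem hρ hY (fun l => contractFirst (b.coord l) x) (S := S)
      (S' := partialSpace S) ?_
      (fun p s hs => Submodule.subset_span ⟨b.coord p, s, hs, rfl⟩) q
    rw [← eq_sum_contractFirst b hx']
    exact hS x hx
  exact fun x hx => h hx

include hρ in
/-- If `e^*` spans a subcomodule, then so does the space of relations. -/
theorem coaction_relSpace_mem_of_left_inverse {Y : Fin n → Fin n → K}
    (hY : ∀ q i, ∑ p, Y q p * a i p = if i = q then 1 else 0) (hNm : N ≤ m)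
    {c : (Fin m → Fin n) → k} {g : K} (hg : ρ (tensorOf b c) = g ⊗ₜ tensorOf b c) :
    ∀ x ∈ relSpace b c N, ρ x ∈ tensorSub K (relSpace b c N) := by
  have key : ∀ (r j : ℕ) (S : Submodule k (TensorAlgebra k Z)), S ≤ deg1 k Z ^ (j + r) →
      (∀ x ∈ S, ρ x ∈ tensorSub K S) →
      ∀ x ∈ partialSpace^[r] S, ρ x ∈ tensorSub K (partialSpace^[r] S) := by
    intro r
    induction r with
    | zero => exact fun j S _ hS => hS
    | succ r ih =>
      intro j S hSj hS
      rw [Function.iterate_succ_apply]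
      exact ih j _ (partialSpace_le hSj) (coaction_partialSpace_mem hρ hY hSj hS)
  refine key (m - N) N _ ?_ ?_
  · rw [Nat.add_sub_cancel' hNm, Submodule.span_singleton_le_iff_mem]
    exact tensorOf_mem b c
  · intro x hx
    obtain ⟨r, rfl⟩ := Submodule.mem_span_singleton.1 hx
    rw [map_smul, hg]
    exact Submodule.smul_mem _ _ (tmul_mem_tensorSub _ (Submodule.mem_span_singleton_self _))

variable {U : Type*} [AddCommGroup U] [Module k U] {u : Module.Basis (Fin n) k U}
  {e : MultilinearMap k (fun _ : Fin m => U) k}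

-- A right inverse of `a` is suited to contracting last letters, while the relations are defined by
-- contracting first letters. Cyclicity rewrites the latter as the former, and the induction runs
-- over the number of contracted letters.
include hρ in
theorem coaction_relSpace_mem_of_right_inverse (he : IsPreregular e) {Y : Fin n → Fin n → K}
    (hY : ∀ i q, ∑ p, a i p * Y p q = if i = q then 1 else 0) (hNm : N ≤ m) {g : K}
    (hg : ρ (tensorOf b (coeff u e)) = g ⊗ₜ tensorOf b (coeff u e)) :
    ∀ x ∈ relSpace b (coeff u e) N, ρ x ∈ tensorSub K (relSpace b (coeff u e) N) := by
  obtain ⟨φ, hφ⟩ := he.exists_cyclic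
  have h1 : (1 : TensorAlgebra k U) ∈ deg1 k U ^ 0 := by simp [Submodule.one_le.1 le_rfl]
  have key : ∀ r j, j + r = m → ∀ x ∈ partialSpan b u (formFunctional e) j r,
      ρ x ∈ tensorSub K (partialSpan b u (formFunctional e) j r) := by
    intro r
    induction r with
    | zero =>
      intro j hj x hx
      obtain rfl : m = j := by omega
      rw [partialSpan_zero] at hx ⊢
      obtain ⟨r, rfl⟩ := Submodule.mem_span_singleton.1 hx
      rw [map_smul, hg]
      exact Submodule.smul_mem _ _ (tmul_mem_tensorSub _ (Submodule.mem_span_singleton_self _))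
    | succ r ih =>
      rintro j hj _ ⟨x, hx, rfl⟩
      obtain ⟨y, hy, hxy⟩ := exists_partialWord_one_left b u hφ j (r + 1) hx
      change ρ (partialWord b u (formFunctional e) j x 1) ∈ _
      rw [hxy]
      clear hxy hx
      rw [pow_succ'] at hy
      induction hy using Submodule.mul_induction_on' with
      | mem_mul_mem z hz y hy =>
        rw [deg1_eq_span u] at hz
        induction hz using Submodule.span_induction with
        | mem _ h =>
          obtain ⟨q, rfl⟩ := h
          -- The element is the coefficient of the last letter `b_q` in a contraction with one
          -- letter fewer, to which the induction hypothesis applies.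
          refine coaction_last_letter_mem hρ hY
            (fun l => partialWord b u (formFunctional e) j 1 (TensorAlgebra.ι k (u l) * y))
            (S := partialSpan b u (formFunctional e) (j + 1) r) ?_ ?_ q
          · rw [← partialWord_succ']
            refine ih (j + 1) (by omega) _ ?_
            have := partialWord_mem_partialSpan b u hφ (j + 1) h1 hy
            rwa [zero_add] at this
          · rintro p _ ⟨s, hs, rfl⟩
            obtain ⟨s', hs', h⟩ := exists_partialWord_one_left b u hφ (j + 1) r hs
            change contractLast _ (partialWord b u (formFunctional e) (j + 1) s 1) ∈ _
            rw [h, partialWord_succ', map_sum]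
            refine Submodule.sum_mem _ fun l _ => ?_
            rw [contractLast_mul_ι]
            refine Submodule.smul_mem _ _ ?_
            have := partialWord_mem_partialSpan b u hφ j h1
              (y := TensorAlgebra.ι k (u l) * s') (r := r + 1)
              (by rw [pow_succ']; exact Submodule.mul_mem_mul ⟨_, rfl⟩ hs')
            rwa [zero_add] at this
        | zero => simp [partialWord_eq_sum]
        | add z z' _ _ h h' =>
          rw [add_mul, partialWord_add_right, map_add]
          exact Submodule.add_mem _ h h'
        | smul c z _ h =>
          rw [smul_mul_assoc, partialWord_smul_right, map_smul]
          exact Submodule.smul_mem _ _ h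
      | add y _ y' _ h h' =>
        rw [partialWord_add_right, map_add]
        exact Submodule.add_mem _ h h'
  rw [relSpace_eq_partialSpan b u e hNm]
  exact key (m - N) N (by omega)

theorem coaction_mul_mem {S T : Submodule k (TensorAlgebra k Z)}
    (hS : ∀ x ∈ S, ρ x ∈ tensorSub K S) (hT : ∀ x ∈ T, ρ x ∈ tensorSub K T) :
    ∀ x ∈ S * T, ρ x ∈ tensorSub K (S * T) := by
  have : S * T ≤ (tensorSub K (S * T)).comap ρ.toLinearMap := by
    refine Submodule.mul_le.2 fun x hx y hy => ?_
    rw [Submodule.mem_comap, AlgHom.toLinearMap_apply, map_mul]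
    exact mul_mem_tensorSub (hS x hx) (hT y hy)
  exact fun x hx => this hx

-- Each `Z^r R Z^s` is stable because `ρ` is multiplicative, and stability passes to the
-- intersection slice by slice.
include hρ in
theorem coaction_koszulSpace_mem {R : Submodule k (TensorAlgebra k Z)}
    (hR : ∀ x ∈ R, ρ x ∈ tensorSub K R) (j : ℕ) :
    ∀ x ∈ koszulSpace N R j, ρ x ∈ tensorSub K (koszulSpace N R j) := by
  intro x hx
  rw [mem_tensorSub_iff]
  intro χ
  simp only [koszulSpace, Submodule.mem_inf, Submodule.mem_iInf] at hx ⊢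
  have hd : ∀ r : ℕ, ∀ x ∈ deg1 k Z ^ r, ρ x ∈ tensorSub K (deg1 k Z ^ r) := fun r x hx =>
    coaction_mem hρ hx
  exact ⟨mem_tensorSub_iff.1 (coaction_mem hρ hx.1) χ, fun r s h => mem_tensorSub_iff.1
    (coaction_mul_mem (coaction_mul_mem (hd r) hR) (hd s) x (hx.2 r s h)) χ⟩

theorem exists_of_mem_tensorSub_span {X : Type*} [AddCommGroup X] [Module k X] {s : X}
    {z : K ⊗[k] X} (hz : z ∈ tensorSub K (Submodule.span k {s})) : ∃ g, z = g ⊗ₜ s := by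
  have : tensorSub K (Submodule.span k {s}) ≤ LinearMap.range ((TensorProduct.mk k K X).flip s) := by
    refine tensorSub_le fun c x hx => ?_
    obtain ⟨r, rfl⟩ := Submodule.mem_span_singleton.1 hx
    exact ⟨r • c, by simp [TensorProduct.smul_tmul']⟩
  obtain ⟨g, hg⟩ := this hz
  exact ⟨g, hg.symm⟩

theorem tmul_tensorOf_injective {c : (Fin m → Fin n) → k} (hc : tensorOf b c ≠ 0) {X : Type*}
    [AddCommGroup X] [Module k X] {x y : X} (h : x ⊗ₜ[k] tensorOf b c = y ⊗ₜ tensorOf b c) :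
    x = y := by
  obtain ⟨ψ, hψ⟩ : ∃ ψ : Module.Dual k (TensorAlgebra k Z), ψ (tensorOf b c) ≠ 0 := by
    by_contra! h
    exact hc ((Module.forall_dual_apply_eq_zero_iff k _).1 h)
  have := congrArg (TensorProduct.rid k X ∘ LinearMap.lTensor X ψ) h
  simp only [Function.comp_apply, LinearMap.lTensor_tmul, TensorProduct.rid_tmul] at this
  exact smul_right_injective X hψ this

-- The scalars `μ` are the functionals on `Z^{⊗ N}` that vanish on the relations, and over a field a
-- subspace is the common kernel of such functionals.
include hρ in
theorem coaction_relSpace_mem_iff (hNm : N ≤ m) :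
    (∀ x ∈ relSpace b (coeff u e) N, ρ x ∈ tensorSub K (relSpace b (coeff u e) N)) ↔
    ∀ μ : (Fin N → Fin n) → k, (∀ l : Fin (m - N) → Fin n,
      ∑ i, coeff u e (joinIdx hNm l i) * μ i = 0) → ∀ l : Fin (m - N) → Fin n,
        ∑ i : Fin N → Fin n, ∑ j : Fin N → Fin n,
          (coeff u e (joinIdx hNm l i) * μ j) • wordProd a i j = 0 := by
  have hr : ∀ l : Fin (m - N) → Fin n,
      tensorOf b (fun i => coeff u e (joinIdx hNm l i)) ∈ relSpace b (coeff u e) N := by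
    intro l
    rw [relSpace_eq_span b u e hNm]
    exact Submodule.subset_span ⟨l, rfl⟩
  constructor
  · intro h μ hμ l
    let F : TensorAlgebra k Z →ₗ[k] k := ∑ j, μ j • formFunctional (coordForm b j)
    have hF : ∀ c : (Fin N → Fin n) → k, F (tensorOf b c) = ∑ i, c i * μ i := by
      intro c
      simp [F, LinearMap.sum_apply, formFunctional_coordForm_tensorOf, mul_comm]
    have hF' : ∀ i : Fin N → Fin n, F (TensorAlgebra.tprod k Z N fun s => b (i s)) = μ i := by
      intro i
      simp [F, LinearMap.sum_apply, formFunctional_coordForm, -TensorAlgebra.tprod_apply]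
    have hFR : ∀ x ∈ relSpace b (coeff u e) N, F x ∈ (⊥ : Submodule k k) := by
      have : relSpace b (coeff u e) N ≤ LinearMap.ker F := by
        rw [relSpace_eq_span b u e hNm, Submodule.span_le]
        rintro _ ⟨l, rfl⟩
        exact (hF _).trans (hμ l)
      exact fun x hx => (Submodule.mem_bot k).2 (this hx)
    have h1 := lTensor_mem_tensorSub hFR (h _ (hr l))
    have h2 : LinearMap.lTensor K F (ρ (tensorOf b fun i => coeff u e (joinIdx hNm l i))) = 0 := by
      refine eq_zero_of_slice fun χ => ?_
      exact (Submodule.mem_bot k).1 (mem_tensorSub_iff.1 h1 χ)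
    rw [coaction_tensorOf hρ] at h2
    have h3 := congrArg (TensorProduct.rid k K) h2
    simp only [map_sum, LinearMap.lTensor_tmul, TensorProduct.rid_tmul, hF', map_zero,
      Finset.smul_sum] at h3
    rw [Finset.sum_comm, ← h3]
    refine Finset.sum_congr rfl fun j _ => Finset.sum_congr rfl fun i _ => ?_
    rw [smul_smul, mul_comm]
  · intro h
    have : relSpace b (coeff u e) N ≤
        (tensorSub K (relSpace b (coeff u e) N)).comap ρ.toLinearMap := by
      conv_lhs => rw [relSpace_eq_span b u e hNm]
      rw [Submodule.span_le]
      rintro _ ⟨l, rfl⟩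
      change ρ (tensorOf b fun i => coeff u e (joinIdx hNm l i)) ∈ tensorSub K (relSpace b (coeff u e) N)
      rw [mem_tensorSub_iff]
      intro χ
      by_contra hn
      -- A functional separating the slice from the relations supplies, by its values on words, a
      -- solution `μ` that violates the equations.
      obtain ⟨F, hF, hFR⟩ := Submodule.exists_le_ker_of_notMem hn
      have h1 := h (fun i => F (TensorAlgebra.tprod k Z N fun s => b (i s))) (fun l => by
        have := hFR (hr l)
        simpa [tensorOf, -TensorAlgebra.tprod_apply] using this) l
      refine hF ?_
      rw [Finset.sum_comm] at h1
      have h2 := congrArg χ h1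
      rw [coaction_tensorOf hρ]
      simp only [map_sum, map_smul, map_zero, slice_tmul, smul_eq_mul] at h2 ⊢
      rw [← h2]
      refine Finset.sum_congr rfl fun j _ => ?_
      rw [Finset.sum_mul]
      refine Finset.sum_congr rfl fun i _ => ?_
      ring
    exact fun x hx => this hx

theorem exists_quotMk_lift {B : Type*} [Ring B] [Algebra k B] {R : Submodule k (TensorAlgebra k Z)}
    (F : TensorAlgebra k Z →ₐ[k] B) (hF : ∀ x ∈ R, F x = 0) :
    ∃ F' : QuotAlg R →ₐ[k] B, ∀ x, F' (quotMk R x) = F x :=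
  ⟨RingQuot.liftAlgHom k ⟨F, by rintro x _ ⟨hx, rfl⟩; rw [hF x hx, map_zero]⟩,
    fun x => RingQuot.liftAlgHom_mkAlgHom_apply k _ _ x⟩

theorem lTensor_quotMk_eq_zero {R : Submodule k (TensorAlgebra k Z)}
    {z : K ⊗[k] TensorAlgebra k Z} (hz : z ∈ tensorSub K R) :
    LinearMap.lTensor K (quotMk R).toLinearMap z = 0 := by
  refine eq_zero_of_slice fun χ => ?_
  rw [slice_lTensor]
  exact quotMk_eq_zero (mem_tensorSub_iff.1 hz χ)

-- The slices of `ρ(x)` are homogeneous of degree `N`, and in that degree the kernel of the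
-- projection to the quotient is `R`.
include hρ in
theorem coaction_mem_of_lTensor_quotMk {R : Submodule k (TensorAlgebra k Z)}
    (hR : R ≤ deg1 k Z ^ N) (h : ∀ x ∈ R, LinearMap.lTensor K (quotMk R).toLinearMap (ρ x) = 0) :
    ∀ x ∈ R, ρ x ∈ tensorSub K R := by
  intro x hx
  rw [mem_tensorSub_iff]
  intro χ
  refine mem_of_quotMk_eq_zero hR (mem_tensorSub_iff.1 (coaction_mem hρ (hR hx)) χ) ?_
  have := slice_lTensor χ (quotMk R).toLinearMap (ρ x)
  rw [h x hx, map_zero] at this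
  exact this.symm

end Coaction

/-! ### Diagonal coactions in coordinates -/

section TensorCoaction

variable {k : Type u} [Field k] {U : Type v} [AddCommGroup U] [Module k U] {K : Type w} [Ring K]
  [HopfAlgebra k K] {n m : ℕ} {u : Module.Basis (Fin n) k U} {a : Fin n → Fin n → K}

theorem leftTensorCoaction_tprod {ρ : U →ₗ[k] K ⊗[k] U} (hρ : ∀ i, ρ (u i) = ∑ j, a i j ⊗ₜ u j)
    (i : Fin m → Fin n) : leftTensorCoaction ρ m (PiTensorProduct.tprod k fun s => u (i s)) =
      ∑ j, wordProd a i j ⊗ₜ[k] PiTensorProduct.tprod k fun s => u (j s) := by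
  simp only [leftTensorCoaction, PiTensorProduct.lift.tprod,
    LinearMap.compMultilinearMap_apply, MultilinearMap.compLinearMap_apply, LinearMap.comp_apply,
    hρ, map_sum, LinearMap.lTensor_tmul, MultilinearMap.mkPiAlgebraFin_apply]
  rw [prod_ofFn_sum (k := k), map_sum]
  refine Finset.sum_congr rfl fun j _ => ?_
  rw [prod_ofFn_tmul, LinearMap.lTensor_tmul, ← TensorAlgebra.tprod_apply, tensorComponent_tprod]
  rfl

theorem rightTensorCoaction_tprod {ρ : U →ₗ[k] U ⊗[k] K} (hρ : ∀ j, ρ (u j) = ∑ i, u i ⊗ₜ a i j)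
    (j : Fin m → Fin n) : rightTensorCoaction ρ m (PiTensorProduct.tprod k fun s => u (j s)) =
      ∑ i : Fin m → Fin n, (PiTensorProduct.tprod k fun s => u (i s)) ⊗ₜ[k] wordProd a i j := by
  simp only [rightTensorCoaction, PiTensorProduct.lift.tprod,
    LinearMap.compMultilinearMap_apply, MultilinearMap.compLinearMap_apply, LinearMap.comp_apply,
    hρ, map_sum, LinearMap.rTensor_tmul, MultilinearMap.mkPiAlgebraFin_apply]
  rw [prod_ofFn_sum (k := k), map_sum]
  refine Finset.sum_congr rfl fun i _ => ?_
  rw [prod_ofFn_tmul, LinearMap.rTensor_tmul, ← TensorAlgebra.tprod_apply, tensorComponent_tprod]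
  rfl

variable {M : Type*} [AddCommGroup M] [Module k M] (m₀ : Module.Basis Unit k M)
  (e : MultilinearMap k (fun _ : Fin m => U) k) (g : K)

theorem piTensor_hom_ext {X : Type*} [AddCommGroup X] [Module k X] (u : Module.Basis (Fin n) k U)
    {f f' : (⨂[k]^m U) →ₗ[k] X} (h : ∀ i : Fin m → Fin n, f (PiTensorProduct.tprod k fun s => u (i s)) =
      f' (PiTensorProduct.tprod k fun s => u (i s))) : f = f' :=
  PiTensorProduct.ext (Module.Basis.ext_multilinear (fun _ => u) h)

theorem isRightComoduleMap_smulRight_iff {ρ : U →ₗ[k] U ⊗[k] K}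
    (hρ : ∀ j, ρ (u j) = ∑ i, u i ⊗ₜ a i j) :
    IsRightComoduleMap (rightTensorCoaction ρ m) (rightBy k g M)
      ((PiTensorProduct.lift e).smulRight (m₀ ())) ↔
    ∀ j, ∑ i, coeff u e i • wordProd a i j = coeff u e j • g := by
  have h1 : ∀ j : Fin m → Fin n, (rightBy k g M ∘ₗ (PiTensorProduct.lift e).smulRight (m₀ ()))
      (PiTensorProduct.tprod k fun s => u (j s)) = m₀ () ⊗ₜ (coeff u e j • g) := by
    intro j
    simp [rightBy, coeff]
  have h2 : ∀ j : Fin m → Fin n, (LinearMap.rTensor K ((PiTensorProduct.lift e).smulRight (m₀ ()))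
      ∘ₗ rightTensorCoaction ρ m) (PiTensorProduct.tprod k fun s => u (j s)) =
        m₀ () ⊗ₜ ∑ i, coeff u e i • wordProd a i j := by
    intro j
    rw [LinearMap.comp_apply, rightTensorCoaction_tprod hρ, map_sum, TensorProduct.tmul_sum]
    refine Finset.sum_congr rfl fun i _ => ?_
    simp [coeff, TensorProduct.smul_tmul]
  constructor
  · intro h j
    have h3 := LinearMap.congr_fun h (PiTensorProduct.tprod k fun s => u (j s))
    rw [h1, h2] at h3
    have := congrArg (TensorProduct.lid k K ∘ LinearMap.rTensor K (m₀.coord ())) h3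
    simpa using this.symm
  · intro h
    exact piTensor_hom_ext u fun j => by rw [h1, h2, h]

theorem isLeftComoduleMap_smulRight_iff {ρ : U →ₗ[k] K ⊗[k] U}
    (hρ : ∀ i, ρ (u i) = ∑ j, a i j ⊗ₜ u j) :
    IsLeftComoduleMap (leftTensorCoaction ρ m) (leftBy k g M)
      ((PiTensorProduct.lift e).smulRight (m₀ ())) ↔
    ∀ i, ∑ j, coeff u e j • wordProd a i j = coeff u e i • g := by
  have h1 : ∀ i : Fin m → Fin n, (leftBy k g M ∘ₗ (PiTensorProduct.lift e).smulRight (m₀ ()))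
      (PiTensorProduct.tprod k fun s => u (i s)) = (coeff u e i • g) ⊗ₜ m₀ () := by
    intro i
    simp [leftBy, coeff, TensorProduct.smul_tmul]
  have h2 : ∀ i : Fin m → Fin n, (LinearMap.lTensor K ((PiTensorProduct.lift e).smulRight (m₀ ()))
      ∘ₗ leftTensorCoaction ρ m) (PiTensorProduct.tprod k fun s => u (i s)) =
        (∑ j, coeff u e j • wordProd a i j) ⊗ₜ m₀ () := by
    intro i
    rw [LinearMap.comp_apply, leftTensorCoaction_tprod hρ, map_sum, TensorProduct.sum_tmul]
    refine Finset.sum_congr rfl fun j _ => ?_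
    simp [coeff, TensorProduct.smul_tmul]
  constructor
  · intro h i
    have h3 := LinearMap.congr_fun h (PiTensorProduct.tprod k fun s => u (i s))
    rw [h1, h2] at h3
    have := congrArg (TensorProduct.rid k K ∘ LinearMap.lTensor K (m₀.coord ())) h3
    simpa using this.symm
  · intro h
    exact piTensor_hom_ext u fun i => by rw [h1, h2, h]

end TensorCoaction

/-! ### Grouplike elements and the multiplicative matrix -/

section Sides

variable {k : Type u} [Field k] {Z : Type v} [AddCommGroup Z] [Module k Z] {K : Type w} [Ring K]
  [HopfAlgebra k K] {n m : ℕ} {b : Module.Basis (Fin n) k Z} {a : Fin n → Fin n → K}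

theorem isLeftComoduleMap_span_iff {X : Type*} [AddCommGroup X] [Module k X]
    (ρ : X →ₗ[k] K ⊗[k] X) (s : X) (g : K) :
    IsLeftComoduleMap (leftBy k g _) ρ (Submodule.span k {s}).subtype ↔ ρ s = g ⊗ₜ s := by
  constructor
  · intro h
    exact LinearMap.congr_fun h ⟨s, Submodule.mem_span_singleton_self s⟩
  · intro h
    refine LinearMap.ext fun ⟨x, hx⟩ => ?_
    obtain ⟨r, rfl⟩ := Submodule.mem_span_singleton.1 hx
    simp [leftBy, h]

theorem isRightComoduleMap_span_iff {X : Type*} [AddCommGroup X] [Module k X]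
    (ρ : X →ₗ[k] X ⊗[k] K) (s : X) (g : K) :
    IsRightComoduleMap (rightBy k g _) ρ (Submodule.span k {s}).subtype ↔ ρ s = s ⊗ₜ g := by
  constructor
  · intro h
    exact LinearMap.congr_fun h ⟨s, Submodule.mem_span_singleton_self s⟩
  · intro h
    refine LinearMap.ext fun ⟨x, hx⟩ => ?_
    obtain ⟨r, rfl⟩ := Submodule.mem_span_singleton.1 hx
    simp [rightBy, h, TensorProduct.smul_tmul']

theorem exists_dual_eq_one {X : Type*} [AddCommGroup X] [Module k X] {s : X} (hs : s ≠ 0) :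
    ∃ ψ : Module.Dual k X, ψ s = 1 := by
  obtain ⟨ψ, hψ⟩ : ∃ ψ : Module.Dual k X, ψ s ≠ 0 := by
    by_contra! h
    exact hs ((Module.forall_dual_apply_eq_zero_iff k _).1 h)
  exact ⟨(ψ s)⁻¹ • ψ, by simp [hψ]⟩

/-- Both conditions are the coaction axioms evaluated at `s`, which is then cancelled by a
functional with value one on it. -/
theorem isGroupLikeElem_of_left {X : Type*} [AddCommGroup X] [Module k X]
    {ρ : X →ₗ[k] K ⊗[k] X} (hρ : IsLeftCoaction ρ) {s : X} (hs : s ≠ 0) {g : K}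
    (h : ρ s = g ⊗ₜ s) : IsGroupLikeElem k g := by
  obtain ⟨ψ, hψ⟩ := exists_dual_eq_one (k := k) hs
  constructor
  · have h1 := LinearMap.congr_fun hρ.counit s
    simp only [LinearMap.comp_apply, h, LinearMap.rTensor_tmul, LinearEquiv.coe_coe,
      TensorProduct.lid_tmul, LinearMap.id_apply] at h1
    simpa [hψ] using congrArg ψ h1
  · have h1 := LinearMap.congr_fun hρ.coassoc s
    simp only [LinearMap.comp_apply, h, LinearMap.rTensor_tmul, LinearEquiv.coe_coe,
      LinearMap.lTensor_tmul] at h1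
    have h2 := congrArg (LinearMap.lTensor K ((TensorProduct.rid k K).toLinearMap ∘ₗ
      LinearMap.lTensor K ψ)) h1
    have key : ∀ z : K ⊗[k] K, LinearMap.lTensor K ((TensorProduct.rid k K).toLinearMap ∘ₗ
      LinearMap.lTensor K ψ) (TensorProduct.assoc k K K X (z ⊗ₜ s)) = z := by
      intro z
      induction z with
      | zero => simp
      | add x y hx hy => rw [TensorProduct.add_tmul, map_add, map_add, hx, hy]
      | tmul x y => simp [hψ]
    rw [key] at h2
    simpa [hψ] using h2

theorem isGroupLikeElem_of_right {X : Type*} [AddCommGroup X] [Module k X]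
    {ρ : X →ₗ[k] X ⊗[k] K} (hρ : IsRightCoaction ρ) {s : X} (hs : s ≠ 0) {g : K}
    (h : ρ s = s ⊗ₜ g) : IsGroupLikeElem k g := by
  obtain ⟨ψ, hψ⟩ := exists_dual_eq_one (k := k) hs
  constructor
  · have h1 := LinearMap.congr_fun hρ.counit s
    simp only [LinearMap.comp_apply, h, LinearMap.lTensor_tmul, LinearEquiv.coe_coe,
      TensorProduct.rid_tmul, LinearMap.id_apply] at h1
    simpa [hψ] using congrArg ψ h1
  · have h1 := LinearMap.congr_fun hρ.coassoc s
    simp only [LinearMap.comp_apply, h, LinearMap.rTensor_tmul, LinearEquiv.coe_coe,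
      LinearMap.lTensor_tmul] at h1
    have h2 := congrArg (LinearMap.rTensor K ((TensorProduct.lid k K).toLinearMap ∘ₗ
      LinearMap.rTensor K ψ)) h1
    have key : ∀ z : K ⊗[k] K, LinearMap.rTensor K ((TensorProduct.lid k K).toLinearMap ∘ₗ
      LinearMap.rTensor K ψ) ((TensorProduct.assoc k X K K).symm (s ⊗ₜ z)) = z := by
      intro z
      induction z with
      | zero => simp
      | add x y hx hy => rw [TensorProduct.tmul_add, map_add, map_add, hx, hy]
      | tmul x y => simp [hψ]
    rw [key] at h2
    simpa [hψ] using h2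

theorem ιInv_ι (z : Z) : TensorAlgebra.ιInv (TensorAlgebra.ι k z) = z :=
  TensorAlgebra.ι_leftInverse z

/-- Together with the counit this says that `a` is a multiplicative matrix, whence the antipode
applied entrywise gives a two-sided inverse (`sum_mul_antipode`, `sum_antipode_mul`). -/
theorem comul_left {ρ : TensorAlgebra k Z →ₗ[k] K ⊗[k] TensorAlgebra k Z} (hc : IsLeftCoaction ρ)
    (hρ : ∀ i, ρ (TensorAlgebra.ι k (b i)) = ∑ j, a i j ⊗ₜ[k] TensorAlgebra.ι k (b j))
    (i l : Fin n) : Coalgebra.comul (R := k) (a i l) = ∑ j, a i j ⊗ₜ[k] a j l := by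
  have h1 := LinearMap.congr_fun hc.coassoc (TensorAlgebra.ι k (b i))
  simp only [LinearMap.comp_apply, hρ, map_sum, LinearMap.rTensor_tmul, LinearMap.lTensor_tmul,
    LinearEquiv.coe_coe] at h1
  have h2 := congrArg (LinearMap.lTensor K ((TensorProduct.rid k K).toLinearMap ∘ₗ
      LinearMap.lTensor K (b.coord l ∘ₗ TensorAlgebra.ιInv))) h1
  have key : ∀ (z : K ⊗[k] K) (j : Fin n), LinearMap.lTensor K ((TensorProduct.rid k K).toLinearMap
      ∘ₗ LinearMap.lTensor K (b.coord l ∘ₗ TensorAlgebra.ιInv))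
        (TensorProduct.assoc k K K _ (z ⊗ₜ TensorAlgebra.ι k (b j))) =
      if j = l then z else 0 := by
    intro z j
    induction z with
    | zero => simp
    | add x y hx hy => rw [TensorProduct.add_tmul, map_add, map_add, hx, hy]; split_ifs <;> simp
    | tmul x y =>
      simp only [TensorProduct.assoc_tmul, LinearMap.lTensor_tmul, LinearMap.comp_apply, ιInv_ι,
        Module.Basis.coord_apply, Module.Basis.repr_self, Finsupp.single_apply,
        LinearEquiv.coe_coe, TensorProduct.rid_tmul]
      split_ifs <;> simp
  have key' := fun x y j => key (x ⊗ₜ y) j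
  simp only [TensorProduct.assoc_tmul] at key'
  simp only [map_sum, key, TensorProduct.tmul_sum, key'] at h2
  simpa using h2

theorem counit_left {ρ : TensorAlgebra k Z →ₗ[k] K ⊗[k] TensorAlgebra k Z} (hc : IsLeftCoaction ρ)
    (hρ : ∀ i, ρ (TensorAlgebra.ι k (b i)) = ∑ j, a i j ⊗ₜ[k] TensorAlgebra.ι k (b j))
    (i l : Fin n) : Coalgebra.counit (R := k) (a i l) = if i = l then 1 else 0 := by
  have h1 := LinearMap.congr_fun hc.counit (TensorAlgebra.ι k (b i))
  simp only [LinearMap.comp_apply, hρ, map_sum, LinearMap.rTensor_tmul,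
    LinearEquiv.coe_coe, TensorProduct.lid_tmul, LinearMap.id_apply] at h1
  have h2 := congrArg (b.coord l ∘ₗ TensorAlgebra.ιInv) h1
  simpa [ιInv_ι, Finsupp.single_apply] using h2

theorem comul_right {ρ : TensorAlgebra k Z →ₗ[k] TensorAlgebra k Z ⊗[k] K}
    (hc : IsRightCoaction ρ)
    (hρ : ∀ j, ρ (TensorAlgebra.ι k (b j)) = ∑ i, TensorAlgebra.ι k (b i) ⊗ₜ[k] a i j)
    (i l : Fin n) : Coalgebra.comul (R := k) (a i l) = ∑ j, a i j ⊗ₜ[k] a j l := by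
  have h1 := LinearMap.congr_fun hc.coassoc (TensorAlgebra.ι k (b l))
  simp only [LinearMap.comp_apply, hρ, map_sum, LinearMap.rTensor_tmul, LinearMap.lTensor_tmul,
    LinearEquiv.coe_coe] at h1
  have h2 := congrArg (LinearMap.rTensor K ((TensorProduct.lid k K).toLinearMap ∘ₗ
      LinearMap.rTensor K (b.coord i ∘ₗ TensorAlgebra.ιInv))) h1
  have key : ∀ (z : K ⊗[k] K) (j : Fin n), LinearMap.rTensor K ((TensorProduct.lid k K).toLinearMap
      ∘ₗ LinearMap.rTensor K (b.coord i ∘ₗ TensorAlgebra.ιInv))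
        ((TensorProduct.assoc k _ K K).symm (TensorAlgebra.ι k (b j) ⊗ₜ z)) =
      if j = i then z else 0 := by
    intro z j
    induction z with
    | zero => simp
    | add x y hx hy => rw [TensorProduct.tmul_add, map_add, map_add, hx, hy]; split_ifs <;> simp
    | tmul x y =>
      simp only [TensorProduct.assoc_symm_tmul, LinearMap.rTensor_tmul, LinearMap.comp_apply, ιInv_ι,
        Module.Basis.coord_apply, Module.Basis.repr_self, Finsupp.single_apply,
        LinearEquiv.coe_coe, TensorProduct.lid_tmul]
      split_ifs <;> simp
  have key' := fun x y j => key (x ⊗ₜ y) j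
  simp only [TensorProduct.assoc_symm_tmul] at key'
  simp only [map_sum, key, TensorProduct.sum_tmul, key'] at h2
  simpa using h2

theorem counit_right {ρ : TensorAlgebra k Z →ₗ[k] TensorAlgebra k Z ⊗[k] K}
    (hc : IsRightCoaction ρ)
    (hρ : ∀ j, ρ (TensorAlgebra.ι k (b j)) = ∑ i, TensorAlgebra.ι k (b i) ⊗ₜ[k] a i j)
    (i l : Fin n) : Coalgebra.counit (R := k) (a i l) = if i = l then 1 else 0 := by
  have h1 := LinearMap.congr_fun hc.counit (TensorAlgebra.ι k (b l))
  simp only [LinearMap.comp_apply, hρ, map_sum, LinearMap.lTensor_tmul,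
    LinearEquiv.coe_coe, TensorProduct.rid_tmul, LinearMap.id_apply] at h1
  have h2 := congrArg (b.coord i ∘ₗ TensorAlgebra.ιInv) h1
  simpa [ιInv_ι, Finsupp.single_apply, eq_comm] using h2

theorem sum_mul_antipode (hΔ : ∀ i l, Coalgebra.comul (R := k) (a i l) = ∑ j, a i j ⊗ₜ[k] a j l)
    (hε : ∀ i l, Coalgebra.counit (R := k) (a i l) = if i = l then 1 else 0) (i l : Fin n) :
    ∑ p, a i p * HopfAlgebra.antipode k (a p l) = if i = l then 1 else 0 := by
  have := HopfAlgebra.mul_antipode_lTensor_comul_apply (R := k) (a i l)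
  rw [hΔ, hε] at this
  simp only [map_sum, LinearMap.lTensor_tmul, LinearMap.mul'_apply] at this
  rw [this]
  split_ifs <;> simp

theorem sum_antipode_mul (hΔ : ∀ i l, Coalgebra.comul (R := k) (a i l) = ∑ j, a i j ⊗ₜ[k] a j l)
    (hε : ∀ i l, Coalgebra.counit (R := k) (a i l) = if i = l then 1 else 0) (i l : Fin n) :
    ∑ p, HopfAlgebra.antipode k (a i p) * a p l = if i = l then 1 else 0 := by
  have := HopfAlgebra.mul_antipode_rTensor_comul_apply (R := k) (a i l)
  rw [hΔ, hε] at this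
  simp only [map_sum, LinearMap.rTensor_tmul, LinearMap.mul'_apply] at this
  rw [this]
  split_ifs <;> simp

end Sides

/-! ### Coactions induced on quotients -/

section Induced

variable {k : Type u} [Field k] {Z : Type v} [AddCommGroup Z] [Module k Z] {K : Type w} [Ring K]
  [HopfAlgebra k K] {R : Submodule k (TensorAlgebra k Z)}

theorem isLeftCoaction_of_surjective {X Y : Type*} [AddCommGroup X] [Module k X] [AddCommGroup Y]
    [Module k Y] {ρ : X →ₗ[k] K ⊗[k] X} (hρ : IsLeftCoaction ρ) {ρ' : Y →ₗ[k] K ⊗[k] Y}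
    {q : X →ₗ[k] Y} (hq : Function.Surjective q) (h : ρ' ∘ₗ q = LinearMap.lTensor K q ∘ₗ ρ) :
    IsLeftCoaction ρ' := by
  constructor
  · rw [← LinearMap.cancel_right hq]
    have h1 : LinearMap.lTensor K ρ' ∘ₗ ρ' ∘ₗ q =
        LinearMap.lTensor K (LinearMap.lTensor K q) ∘ₗ LinearMap.lTensor K ρ ∘ₗ ρ := by
      rw [h, ← LinearMap.comp_assoc, ← LinearMap.lTensor_comp, h, LinearMap.lTensor_comp,
        LinearMap.comp_assoc]
    have h2 : LinearMap.rTensor Y (Coalgebra.comul (R := k) (A := K)) ∘ₗ LinearMap.lTensor K q =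
        LinearMap.lTensor (K ⊗[k] K) q ∘ₗ
          LinearMap.rTensor X (Coalgebra.comul (R := k) (A := K)) := by
      ext; simp
    have h3 : (TensorProduct.assoc k K K Y).toLinearMap ∘ₗ LinearMap.lTensor (K ⊗[k] K) q =
        LinearMap.lTensor K (LinearMap.lTensor K q) ∘ₗ
          (TensorProduct.assoc k K K X).toLinearMap := by
      ext; simp
    calc _ = (TensorProduct.assoc k K K Y).toLinearMap ∘ₗ
          (LinearMap.rTensor Y (Coalgebra.comul (R := k) (A := K)) ∘ₗ LinearMap.lTensor K q) ∘ₗ ρ := by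
          rw [LinearMap.comp_assoc, LinearMap.comp_assoc, h]; rfl
      _ = ((TensorProduct.assoc k K K Y).toLinearMap ∘ₗ LinearMap.lTensor (K ⊗[k] K) q) ∘ₗ
          LinearMap.rTensor X (Coalgebra.comul (R := k) (A := K)) ∘ₗ ρ := by rw [h2]; rfl
      _ = LinearMap.lTensor K (LinearMap.lTensor K q) ∘ₗ ((TensorProduct.assoc k K K X).toLinearMap
          ∘ₗ LinearMap.rTensor X (Coalgebra.comul (R := k) (A := K)) ∘ₗ ρ) := by rw [h3]; rfl
      _ = _ := by rw [hρ.coassoc, LinearMap.comp_assoc, h1]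
  · rw [← LinearMap.cancel_right hq]
    have h2 : (TensorProduct.lid k Y).toLinearMap ∘ₗ
        LinearMap.rTensor Y (Coalgebra.counit (R := k) (A := K)) ∘ₗ LinearMap.lTensor K q =
        q ∘ₗ (TensorProduct.lid k X).toLinearMap ∘ₗ
          LinearMap.rTensor X (Coalgebra.counit (R := k) (A := K)) := by
      ext; simp
    calc _ = ((TensorProduct.lid k Y).toLinearMap ∘ₗ
        LinearMap.rTensor Y (Coalgebra.counit (R := k) (A := K)) ∘ₗ LinearMap.lTensor K q) ∘ₗ ρ := by
          rw [LinearMap.comp_assoc, LinearMap.comp_assoc, h]; rfl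
      _ = q ∘ₗ ((TensorProduct.lid k X).toLinearMap ∘ₗ
          LinearMap.rTensor X (Coalgebra.counit (R := k) (A := K)) ∘ₗ ρ) := by rw [h2]; rfl
      _ = _ := by rw [hρ.counit]; rfl

theorem isRightCoaction_of_surjective {X Y : Type*} [AddCommGroup X] [Module k X] [AddCommGroup Y]
    [Module k Y] {ρ : X →ₗ[k] X ⊗[k] K} (hρ : IsRightCoaction ρ) {ρ' : Y →ₗ[k] Y ⊗[k] K}
    {q : X →ₗ[k] Y} (hq : Function.Surjective q) (h : ρ' ∘ₗ q = LinearMap.rTensor K q ∘ₗ ρ) :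
    IsRightCoaction ρ' := by
  constructor
  · rw [← LinearMap.cancel_right hq]
    have h1 : LinearMap.rTensor K ρ' ∘ₗ ρ' ∘ₗ q =
        LinearMap.rTensor K (LinearMap.rTensor K q) ∘ₗ LinearMap.rTensor K ρ ∘ₗ ρ := by
      rw [h, ← LinearMap.comp_assoc, ← LinearMap.rTensor_comp, h, LinearMap.rTensor_comp,
        LinearMap.comp_assoc]
    have h2 : LinearMap.lTensor Y (Coalgebra.comul (R := k) (A := K)) ∘ₗ LinearMap.rTensor K q =
        LinearMap.rTensor (K ⊗[k] K) q ∘ₗ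
          LinearMap.lTensor X (Coalgebra.comul (R := k) (A := K)) := by
      ext; simp
    have h3 : (TensorProduct.assoc k Y K K).symm.toLinearMap ∘ₗ LinearMap.rTensor (K ⊗[k] K) q =
        LinearMap.rTensor K (LinearMap.rTensor K q) ∘ₗ
          (TensorProduct.assoc k X K K).symm.toLinearMap := by
      refine TensorProduct.ext_threefold' fun x y z => ?_
      simp
    calc _ = (TensorProduct.assoc k Y K K).symm.toLinearMap ∘ₗ
          (LinearMap.lTensor Y (Coalgebra.comul (R := k) (A := K)) ∘ₗ LinearMap.rTensor K q) ∘ₗ ρ := by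
          rw [LinearMap.comp_assoc, LinearMap.comp_assoc, h]; rfl
      _ = ((TensorProduct.assoc k Y K K).symm.toLinearMap ∘ₗ LinearMap.rTensor (K ⊗[k] K) q) ∘ₗ
          LinearMap.lTensor X (Coalgebra.comul (R := k) (A := K)) ∘ₗ ρ := by rw [h2]; rfl
      _ = LinearMap.rTensor K (LinearMap.rTensor K q) ∘ₗ
          ((TensorProduct.assoc k X K K).symm.toLinearMap ∘ₗ
          LinearMap.lTensor X (Coalgebra.comul (R := k) (A := K)) ∘ₗ ρ) := by rw [h3]; rfl
      _ = _ := by rw [hρ.coassoc, LinearMap.comp_assoc, h1]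
  · rw [← LinearMap.cancel_right hq]
    have h2 : (TensorProduct.rid k Y).toLinearMap ∘ₗ
        LinearMap.lTensor Y (Coalgebra.counit (R := k) (A := K)) ∘ₗ LinearMap.rTensor K q =
        q ∘ₗ (TensorProduct.rid k X).toLinearMap ∘ₗ
          LinearMap.lTensor X (Coalgebra.counit (R := k) (A := K)) := by
      ext; simp
    calc _ = ((TensorProduct.rid k Y).toLinearMap ∘ₗ
        LinearMap.lTensor Y (Coalgebra.counit (R := k) (A := K)) ∘ₗ LinearMap.rTensor K q) ∘ₗ ρ := by
          rw [LinearMap.comp_assoc, LinearMap.comp_assoc, h]; rfl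
      _ = q ∘ₗ ((TensorProduct.rid k X).toLinearMap ∘ₗ
          LinearMap.lTensor X (Coalgebra.counit (R := k) (A := K)) ∘ₗ ρ) := by rw [h2]; rfl
      _ = _ := by rw [hρ.counit]; rfl

theorem exists_isInducedLeft {ρ : TensorAlgebra k Z →ₐ[k] K ⊗[k] TensorAlgebra k Z}
    (hc : IsLeftCoaction ρ.toLinearMap)
    (h : ∀ x ∈ R, LinearMap.lTensor K (quotMk R).toLinearMap (ρ x) = 0) :
    ∃ ρ' : QuotAlg R →ₐ[k] K ⊗[k] QuotAlg R, IsInducedLeft R ρ ρ' := by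
  obtain ⟨ρ', h'⟩ := exists_quotMk_lift
    ((Algebra.TensorProduct.map (AlgHom.id k K) (quotMk R)).comp ρ) h
  refine ⟨ρ', isLeftCoaction_of_surjective hc (q := (quotMk R).toLinearMap) quotMk_surjective
    (LinearMap.ext h'), h'⟩

theorem exists_isInducedRight {ρ : TensorAlgebra k Z →ₐ[k] TensorAlgebra k Z ⊗[k] K}
    (hc : IsRightCoaction ρ.toLinearMap)
    (h : ∀ x ∈ R, LinearMap.rTensor K (quotMk R).toLinearMap (ρ x) = 0) :
    ∃ ρ' : QuotAlg R →ₐ[k] QuotAlg R ⊗[k] K, IsInducedRight R ρ ρ' := by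
  obtain ⟨ρ', h'⟩ := exists_quotMk_lift (R := R) (B := QuotAlg R ⊗[k] K)
    ((Algebra.TensorProduct.map (quotMk R) (AlgHom.id k K)).comp ρ) h
  refine ⟨ρ', isRightCoaction_of_surjective hc (q := (quotMk R).toLinearMap) quotMk_surjective
    (LinearMap.ext h'), h'⟩

end Induced

/-! ### Equivariance of the bar complex -/

section Diagonal

variable {k : Type u} [Field k] {A : Type w} [Ring A] [Algebra k A] {K : Type v} [Ring K]
  [HopfAlgebra k K]

/-- The product `(c ⊗ a) ⋆ (c' ⊗ x) = c c' ⊗ (a ⊗ x)`. -/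
def diagMul (X : Type*) [AddCommGroup X] [Module k X] :
    K ⊗[k] A →ₗ[k] K ⊗[k] X →ₗ[k] K ⊗[k] (A ⊗[k] X) :=
  TensorProduct.map₂ (LinearMap.mul k K) (TensorProduct.mk k A X)

theorem diagMul_tmul {X : Type*} [AddCommGroup X] [Module k X] (c c' : K) (a : A) (x : X) :
    diagMul X (c ⊗ₜ[k] a) (c' ⊗ₜ[k] x) = (c * c') ⊗ₜ (a ⊗ₜ x) := rfl

/-- Carries the rule for splitting off a block over to `K ⊗ T(Z)`. The rule holds only for left
factors of the length of the block, which form the subspace `S`. -/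
theorem lTensor_mul_eq {T X Y : Type*} [Ring T] [Algebra k T] [AddCommGroup X] [Module k X]
    [AddCommGroup Y] [Module k Y] (q : T →ₗ[k] A) (f : T →ₗ[k] X) (τ : A ⊗[k] X →ₗ[k] Y)
    {f' : T →ₗ[k] Y} {S : Submodule k T} (h : ∀ s ∈ S, ∀ t, f' (s * t) = τ (q s ⊗ₜ f t))
    (z : K ⊗[k] T) (hz : z ∈ tensorSub K S) (y : K ⊗[k] T) : LinearMap.lTensor K f' (z * y) =
      LinearMap.lTensor K τ (diagMul X (LinearMap.lTensor K q z) (LinearMap.lTensor K f y)) := by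
  obtain ⟨z, rfl⟩ := hz
  induction z with
  | zero => simp
  | add x x' hx hx' => simp only [map_add, add_mul, hx, hx', LinearMap.add_apply]
  | tmul c s =>
    induction y with
    | zero => simp
    | add x x' hx hx' => simp only [map_add, mul_add, hx, hx']
    | tmul c' t => simp [diagMul_tmul, h s s.2]

/-- The diagonal coaction on `A ⊗ X`. -/
def diagCoaction {X : Type*} [AddCommGroup X] [Module k X] (r : A →ₗ[k] K ⊗[k] A)
    (T : X →ₗ[k] K ⊗[k] X) : A ⊗[k] X →ₗ[k] K ⊗[k] (A ⊗[k] X) :=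
  TensorProduct.lift ((diagMul X).compl₁₂ r T)

theorem diagCoaction_tmul {X : Type*} [AddCommGroup X] [Module k X] (r : A →ₗ[k] K ⊗[k] A)
    (T : X →ₗ[k] K ⊗[k] X) (a : A) (x : X) :
    diagCoaction r T (a ⊗ₜ x) = diagMul X (r a) (T x) := rfl

theorem tensorComponent_ι_mul (i : ℕ) (a : A) (t : TensorAlgebra k A) :
    tensorComponent k A (i + 1) (TensorAlgebra.ι k a * t) =
      tensorCons k A i (a ⊗ₜ tensorComponent k A i t) := by
  have : tensorComponent k A (i + 1) ∘ₗ LinearMap.mulLeft k (TensorAlgebra.ι k a) =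
      (tensorCons k A i).toLinearMap ∘ₗ TensorProduct.mk k A _ a ∘ₗ tensorComponent k A i := by
    refine hom_ext_tprod fun j w => ?_
    simp only [LinearMap.comp_apply, LinearMap.mulLeft_apply, TensorProduct.mk_apply,
      LinearEquiv.coe_coe]
    rw [← tprod_cons]
    by_cases h : j = i
    · subst h
      rw [tensorComponent_tprod, tensorComponent_tprod, tensorCons_tprod]
    · rw [tensorComponent_tprod_of_ne h, tensorComponent_tprod_of_ne (by omega)]
      simp
  exact LinearMap.congr_fun this t

theorem lTensor_tensorComponent_mul (i : ℕ) (z : K ⊗[k] A) (t : K ⊗[k] TensorAlgebra k A) :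
    LinearMap.lTensor K (tensorComponent k A (i + 1))
      (LinearMap.lTensor K (TensorAlgebra.ι k) z * t) =
      LinearMap.lTensor K (tensorCons k A i).toLinearMap
        (diagMul _ z (LinearMap.lTensor K (tensorComponent k A i) t)) := by
  induction z with
  | zero => simp
  | add x y hx hy => simp only [map_add, add_mul, hx, hy, LinearMap.add_apply]
  | tmul c a =>
    induction t with
    | zero => simp
    | add x y hx hy => simp only [map_add, mul_add, hx, hy]
    | tmul c' t => simp [diagMul_tmul, tensorComponent_ι_mul]

theorem leftTensorCoaction_tensorCons (r : A →ₗ[k] K ⊗[k] A) (i : ℕ) (y : A ⊗[k] (⨂[k]^i A)) :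
    leftTensorCoaction r (i + 1) (tensorCons k A i y) =
      LinearMap.lTensor K (tensorCons k A i).toLinearMap
        (diagCoaction r (leftTensorCoaction r i) y) := by
  have : leftTensorCoaction r (i + 1) ∘ₗ (tensorCons k A i).toLinearMap =
      LinearMap.lTensor K (tensorCons k A i).toLinearMap ∘ₗ
        diagCoaction r (leftTensorCoaction r i) := by
    ext1
    ext a x
    simp only [LinearMap.compMultilinearMap_apply, TensorProduct.AlgebraTensorModule.curry_apply,
      TensorProduct.curry_apply, LinearMap.coe_restrictScalars, LinearMap.comp_apply,
      LinearEquiv.coe_coe, tensorCons_tprod, diagCoaction_tmul, leftTensorCoaction,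
      PiTensorProduct.lift.tprod, MultilinearMap.compLinearMap_apply,
      MultilinearMap.mkPiAlgebraFin_apply, List.ofFn_succ, List.prod_cons, Fin.cons_zero,
      Fin.cons_succ, lTensor_tensorComponent_mul]
  exact LinearMap.congr_fun this y

theorem leftTensorCoaction_zero (r : A →ₗ[k] K ⊗[k] A) (x : Fin 0 → A) :
    leftTensorCoaction r 0 (PiTensorProduct.tprod k x) = 1 ⊗ₜ PiTensorProduct.tprod k x := by
  have h := tensorComponent_tprod (k := k) 0 x
  rw [TensorAlgebra.tprod_apply, List.ofFn_zero, List.prod_nil] at h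
  simp [leftTensorCoaction, Algebra.TensorProduct.one_def, h]

theorem lTensor_augPair_diagMul (ε : A →ₐ[k] k) {X Y : Type*} [AddCommGroup X] [Module k X]
    [AddCommGroup Y] [Module k Y] (f : X →ₗ[k] Y) (z : K ⊗[k] A) (y : K ⊗[k] X) :
    LinearMap.lTensor K (augPair ε f) (diagMul X z y) =
      TensorProduct.map₂ (LinearMap.mul k K) (LinearMap.lsmul k Y)
        (LinearMap.lTensor K ε.toLinearMap z) (LinearMap.lTensor K f y) := by
  induction z with
  | zero => simp
  | add x y hx hy => simp only [map_add, hx, hy, LinearMap.add_apply]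
  | tmul c a =>
    induction y with
    | zero => simp
    | add x y hx hy => simp only [map_add, hx, hy]
    | tmul c' t => simp [diagMul_tmul]

/-- The hypothesis `hε` makes the augmentation a comodule map to the trivial comodule, so the first
factor contributes nothing to `K`. -/
theorem lTensor_augPair_diagCoaction {ε : A →ₐ[k] k} {r : A →ₗ[k] K ⊗[k] A}
    (hε : ∀ a, LinearMap.lTensor K ε.toLinearMap (r a) = 1 ⊗ₜ ε a) {X Y : Type*} [AddCommGroup X]
    [Module k X] [AddCommGroup Y] [Module k Y] (f : X →ₗ[k] Y) (T : X →ₗ[k] K ⊗[k] X)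
    (y : A ⊗[k] X) :
    LinearMap.lTensor K (augPair ε f) (diagCoaction r T y) =
      augPair ε (LinearMap.lTensor K f ∘ₗ T) y := by
  have key : ∀ (c : k) (w : K ⊗[k] Y), TensorProduct.map₂ (LinearMap.mul k K) (LinearMap.lsmul k Y)
      (1 ⊗ₜ c) w = c • w := by
    intro c w
    induction w with
    | zero => simp
    | add x y hx hy => simp only [map_add, hx, hy, smul_add]
    | tmul c' t => simp
  induction y with
  | zero => simp
  | add x y hx hy => simp only [map_add, hx, hy]
  | tmul a x => rw [diagCoaction_tmul, lTensor_augPair_diagMul, hε, key]; rfl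

variable (k A K) in
/-- The product `(c ⊗ a)(c' ⊗ y) = c c' ⊗ a y`, for `y` in the free module `A ⊗ X`. -/
def diagSMul (X : Type*) [AddCommGroup X] [Module k X] :
    K ⊗[k] A →ₗ[k] K ⊗[k] (A ⊗[k] X) →ₗ[k] K ⊗[k] (A ⊗[k] X) :=
  TensorProduct.map₂ (LinearMap.mul k K) (Algebra.lsmul k k (A ⊗[k] X)).toLinearMap

theorem diagSMul_diagMul {X : Type*} [AddCommGroup X] [Module k X] (z z' : K ⊗[k] A)
    (y : K ⊗[k] X) : diagSMul k A K X z (diagMul X z' y) = diagMul X (z * z') y := by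
  induction z with
  | zero => simp
  | add x y hx hy => simp only [map_add, hx, hy, LinearMap.add_apply, add_mul]
  | tmul c a =>
    induction z' with
    | zero => simp
    | add x y hx hy => simp only [map_add, hx, hy, LinearMap.add_apply, mul_add]
    | tmul c' a' =>
      induction y with
      | zero => simp
      | add x y hx hy => simp only [map_add, hx, hy]
      | tmul c'' t =>
        rw [Algebra.TensorProduct.tmul_mul_tmul, diagMul_tmul, diagMul_tmul, diagSMul,
          TensorProduct.map₂_apply_tmul]
        simp [mul_assoc, TensorProduct.smul_tmul']

theorem diagCoaction_smul (r : A →ₐ[k] K ⊗[k] A) {X : Type*} [AddCommGroup X] [Module k X]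
    (T : X →ₗ[k] K ⊗[k] X) (a : A) (y : A ⊗[k] X) :
    diagCoaction r.toLinearMap T (a • y) =
      diagSMul k A K X (r a) (diagCoaction r.toLinearMap T y) := by
  induction y with
  | zero => simp
  | add x y hx hy => simp only [map_add, hx, hy, smul_add]
  | tmul a' x =>
    rw [diagCoaction_tmul, AlgHom.toLinearMap_apply, diagSMul_diagMul, TensorProduct.smul_tmul',
      diagCoaction_tmul, AlgHom.toLinearMap_apply, smul_eq_mul, map_mul]

theorem lTensor_barTail_diagMul (ε : A →ₐ[k] k) (i : ℕ) (z : K ⊗[k] A)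
    (y : K ⊗[k] (A ⊗[k] (⨂[k]^i A))) :
    LinearMap.lTensor K (barTail ε (i + 1))
      (diagMul _ z (LinearMap.lTensor K (tensorCons k A i).toLinearMap y)) =
      LinearMap.lTensor K (tensorCons k A i).toLinearMap
        (diagSMul k A K _ z y - diagMul _ z (LinearMap.lTensor K (barTail ε i) y)) := by
  induction z with
  | zero => simp
  | add x x' hx hx' =>
    simp only [map_add, hx, hx', LinearMap.add_apply, map_sub]
    abel
  | tmul c a =>
    induction y with
    | zero => simp
    | add x y hx hy =>
      simp only [map_add, hx, hy, map_sub]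
      abel
    | tmul c' y =>
      rw [LinearMap.lTensor_tmul, LinearMap.lTensor_tmul, diagMul_tmul, diagMul_tmul,
        LinearMap.lTensor_tmul, LinearEquiv.coe_coe, barTail_succ, barD, barStep_tmul, diagSMul,
        TensorProduct.map₂_apply_tmul, TensorProduct.map_tmul, map_sub, LinearMap.lTensor_tmul,
        LinearMap.lTensor_tmul, LinearMap.mul_apply',
        ← TensorProduct.tmul_sub]
      simp [smul_sub, TensorProduct.smul_tmul']

/-- The differential is made of the product and the augmentation, and the coaction respects both;
the induction follows the recursion that defines `barTail`. -/
theorem leftTensorCoaction_barTail {ε : A →ₐ[k] k} {r : A →ₐ[k] K ⊗[k] A}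
    (hε : ∀ a, LinearMap.lTensor K ε.toLinearMap (r a) = 1 ⊗ₜ ε a) (i : ℕ)
    (y : A ⊗[k] (⨂[k]^i A)) :
    leftTensorCoaction r.toLinearMap i (barTail ε i y) =
      LinearMap.lTensor K (barTail ε i)
        (diagCoaction r.toLinearMap (leftTensorCoaction r.toLinearMap i) y) := by
  induction i with
  | zero =>
    rw [barTail, lTensor_augPair_diagCoaction hε, LinearMap.lTensor_id, LinearMap.id_comp,
      augPair_eq_comp ε (leftTensorCoaction r.toLinearMap 0)]
    rfl
  | succ i ih =>
    induction y with
    | zero => simp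
    | add x y hx hy => simp only [map_add, hx, hy]
    | tmul a x =>
      obtain ⟨y, rfl⟩ := (tensorCons k A i).surjective x
      rw [diagCoaction_tmul, leftTensorCoaction_tensorCons, lTensor_barTail_diagMul, barTail_succ,
        barD, barStep_tmul, leftTensorCoaction_tensorCons, smul_sub, map_sub, diagCoaction_smul,
        ← ih, TensorProduct.smul_tmul', smul_eq_mul, mul_one, diagCoaction_tmul]
      rfl

/-- The antipode of the slice `(id ⊗ f)`. -/
def antipodeSlice {X : Type*} [AddCommGroup X] [Module k X] (f : X →ₗ[k] k) : K ⊗[k] X →ₗ[k] K :=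
  HopfAlgebra.antipode k (A := K) ∘ₗ (TensorProduct.rid k K).toLinearMap ∘ₗ LinearMap.lTensor K f

theorem antipodeSlice_tmul {X : Type*} [AddCommGroup X] [Module k X] (f : X →ₗ[k] k) (c : K)
    (x : X) : antipodeSlice f (c ⊗ₜ x) = f x • HopfAlgebra.antipode k c := by
  simp [antipodeSlice]

theorem lift_leftBarCoaction (r : A →ₗ[k] K ⊗[k] A) {i : ℕ} (f : BarCochain k A k i) :
    PiTensorProduct.lift (leftBarCoaction r f) =
      antipodeSlice (PiTensorProduct.lift f) ∘ₗ leftTensorCoaction r i := by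
  ext a
  simp [leftBarCoaction, antipodeSlice]

theorem isBarCocycle_leftBarCoaction {ε : A →ₐ[k] k} {r : A →ₐ[k] K ⊗[k] A}
    (hε : ∀ a, LinearMap.lTensor K ε.toLinearMap (r a) = 1 ⊗ₜ ε a) {i : ℕ}
    {f : BarCochain k A k i} (hf : IsBarCocycle ε f) :
    IsBarCocycle ε (leftBarCoaction r.toLinearMap f) := by
  rw [isBarCocycle_iff] at hf ⊢
  rw [lift_leftBarCoaction]
  ext1
  ext1 a
  refine LinearMap.ext fun x => ?_
  simp only [TensorProduct.AlgebraTensorModule.curry_apply, TensorProduct.curry_apply,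
    LinearMap.coe_restrictScalars, LinearMap.comp_apply]
  rw [leftTensorCoaction_barTail hε]
  have h1 : antipodeSlice (K := K) (PiTensorProduct.lift f) ∘ₗ LinearMap.lTensor K (barTail ε i) =
      HopfAlgebra.antipode k (A := K) ∘ₗ (TensorProduct.rid k K).toLinearMap ∘ₗ
        LinearMap.lTensor K (augPair ε (PiTensorProduct.lift f)) := by
    rw [hf, LinearMap.lTensor_comp]
    rfl
  have h2 := LinearMap.congr_fun h1
    (diagCoaction r.toLinearMap (leftTensorCoaction r.toLinearMap i) (a ⊗ₜ x))
  rw [LinearMap.comp_apply] at h2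
  rw [h2, LinearMap.comp_apply, LinearMap.comp_apply, lTensor_augPair_diagCoaction hε]
  simp [antipodeSlice]

end Diagonal

/-! ### Equivariance of the comparison map -/

section Equivariance

variable {k : Type u} [Field k] {Z : Type v} [AddCommGroup Z] [Module k Z] {K : Type w} [Ring K]
  [HopfAlgebra k K] {n m N : ℕ} {R : Submodule k (TensorAlgebra k Z)}
  {b : Module.Basis (Fin n) k Z} {a : Fin n → Fin n → K}
  {ρ : TensorAlgebra k Z →ₐ[k] K ⊗[k] TensorAlgebra k Z}
  (hρ : ∀ i, ρ (TensorAlgebra.ι k (b i)) = ∑ j, a i j ⊗ₜ[k] TensorAlgebra.ι k (b j))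
  {r : QuotAlg R →ₐ[k] K ⊗[k] QuotAlg R}
  (hr : ∀ x, r (quotMk R x) = LinearMap.lTensor K (quotMk R).toLinearMap (ρ x))

include hρ in
theorem lTensor_algebraMapInv_coaction (t : TensorAlgebra k Z) :
    LinearMap.lTensor K TensorAlgebra.algebraMapInv.toLinearMap (ρ t) =
      1 ⊗ₜ TensorAlgebra.algebraMapInv t := by
  have : (Algebra.TensorProduct.map (AlgHom.id k K) TensorAlgebra.algebraMapInv).comp ρ =
      (Algebra.TensorProduct.includeRight (A := K)).comp
        (TensorAlgebra.algebraMapInv (R := k) (M := Z)) := by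
    ext1
    refine b.ext fun i => ?_
    simp [hρ, TensorAlgebra.algebraMapInv]
  exact AlgHom.congr_fun this t

include hρ hr in
theorem lTensor_augmentation_coaction (hR : ∀ x ∈ R, TensorAlgebra.algebraMapInv x = 0)
    (x : QuotAlg R) :
    LinearMap.lTensor K (augmentation R hR).toLinearMap (r x) = 1 ⊗ₜ augmentation R hR x := by
  obtain ⟨t, rfl⟩ := quotMk_surjective x
  rw [hr, augmentation_quotMk, ← lTensor_algebraMapInv_coaction hρ, ← LinearMap.comp_apply,
    ← LinearMap.lTensor_comp]
  congr 2
  ext t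
  exact augmentation_quotMk hR t

include hρ hr in
/-- The comparison map from the Koszul complex to the bar complex is equivariant. -/
theorem leftTensorCoaction_wordToBar (hN : 2 ≤ N) (i : ℕ) {t : TensorAlgebra k Z}
    (ht : t ∈ deg1 k Z ^ koszulDegree N i) :
    leftTensorCoaction r.toLinearMap i (wordToBar N R i t) =
      LinearMap.lTensor K (wordToBar N R i) (ρ t) := by
  induction i generalizing t with
  | zero =>
    rw [wordToBar, LinearMap.lTensor_comp, LinearMap.comp_apply, LinearMap.comp_apply,
      lTensor_algebraMapInv_coaction hρ, LinearMap.lTensor_tmul, AlgHom.toLinearMap_apply,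
      LinearMap.toSpanSingleton_apply, map_smul, leftTensorCoaction_zero, TensorProduct.tmul_smul]
  | succ i ih =>
    have hlt := koszulDegree_lt hN i
    obtain ⟨e, he⟩ : ∃ e, koszulDegree N (i + 1) = e + koszulDegree N i :=
      ⟨koszulDegree N (i + 1) - koszulDegree N i, by omega⟩
    -- On a product whose left factor has the length of the first block, cutting takes that factor
    -- off; the coaction preserves lengths, so the rule is available after `ρ` as well.
    have hw : ∀ s ∈ deg1 k Z ^ e, ∀ t, wordToBar N R (i + 1) (s * t) =
        tensorCons k _ i (quotMk R s ⊗ₜ wordToBar N R i t) := by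
      intro s hs t
      rw [wordToBar_succ, koszulLin_pow_apply, show koszulDegree N (i + 1) - koszulDegree N i = e
        by omega, koszulD_pow_mul hs, one_mul]
      rfl
    have hw' := lTensor_mul_eq (K := K) (A := QuotAlg R) (T := TensorAlgebra k Z)
      (X := ⨂[k]^i (QuotAlg R)) (Y := ⨂[k]^(i + 1) (QuotAlg R)) (f' := wordToBar N R (i + 1))
      (S := deg1 k Z ^ e) (quotMk R).toLinearMap (wordToBar N R i)
      (tensorCons k (QuotAlg R) i).toLinearMap hw
    rw [he, pow_add] at ht
    induction ht using Submodule.mul_induction_on' with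
    | mem_mul_mem s hs t ht =>
      rw [hw s hs, leftTensorCoaction_tensorCons, diagCoaction_tmul, ih ht, map_mul,
        hw' _ (coaction_mem hρ hs), AlgHom.toLinearMap_apply, hr]
    | add x _ y _ hx hy => simp only [map_add, hx, hy]

end Equivariance

/-! ### The coaction on the top cohomology -/

section Codeterminant

variable {k Z : Type u} [Field k] [AddCommGroup Z] [Module k Z] {K : Type w} [Ring K]
  [HopfAlgebra k K] {n m N d : ℕ} {R : Submodule k (TensorAlgebra k Z)}
  {b : Module.Basis (Fin n) k Z} {a : Fin n → Fin n → K}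
  {ρ : TensorAlgebra k Z →ₐ[k] K ⊗[k] TensorAlgebra k Z}
  (hρ : ∀ i, ρ (TensorAlgebra.ι k (b i)) = ∑ j, a i j ⊗ₜ[k] TensorAlgebra.ι k (b j))
  {r : QuotAlg R →ₐ[k] K ⊗[k] QuotAlg R}
  (hr : ∀ x, r (quotMk R x) = LinearMap.lTensor K (quotMk R).toLinearMap (ρ x))

include hρ hr in
/-- If the last term of the Koszul complex is spanned by an element `s` with `ρ(s) = g ⊗ s`,
then the coaction on the top cohomology is given by the antipode of `g`. -/
theorem isBarCoboundary_leftBarCoaction_sub_iff (hN : 2 ≤ N) (hR' : R ≤ deg1 k Z ^ N)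
    (hR : ∀ x ∈ R, TensorAlgebra.algebraMapInv x = 0) (hK : IsNKoszul N R)
    {s : TensorAlgebra k Z} (hs : koszulSpace N R (koszulDegree N (d + 1)) = Submodule.span k {s})
    (hs0 : s ≠ 0) {g : K} (hg : ρ s = g ⊗ₜ s) (D : K) :
    ((∃ f : BarCochain k (QuotAlg R) k (d + 1), IsBarCocycle (augmentation R hR) f ∧
      ¬ IsBarCoboundary (augmentation R hR) f) ∧
    ∀ f : BarCochain k (QuotAlg R) k (d + 1), IsBarCocycle (augmentation R hR) f →
      IsBarCoboundary (augmentation R hR) (leftBarCoaction r.toLinearMap f - f.smulRight D)) ↔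
      D = HopfAlgebra.antipode k g := by
  have hsW : s ∈ koszulSpace N R (koszulDegree N (d + 1)) := by
    rw [hs]; exact Submodule.mem_span_singleton_self s
  have hε := lTensor_augmentation_coaction hρ hr hR
  -- Equivariance of the comparison map and `ρ(s) = g ⊗ s` show that the coaction multiplies the
  -- value on `s` by the antipode of `g`.
  have hval : ∀ f : BarCochain k (QuotAlg R) k (d + 1),
      PiTensorProduct.lift (leftBarCoaction r.toLinearMap f - f.smulRight D)
        (wordToBar N R (d + 1) s) = PiTensorProduct.lift f (wordToBar N R (d + 1) s) •
          (HopfAlgebra.antipode k g - D) := by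
    intro f
    have h1 : PiTensorProduct.lift (f.smulRight D) = (PiTensorProduct.lift f).smulRight D := by
      ext x; simp
    rw [map_sub, LinearMap.sub_apply, lift_leftBarCoaction, h1, LinearMap.comp_apply,
      leftTensorCoaction_wordToBar hρ hr hN (d + 1) hsW.1, hg, LinearMap.lTensor_tmul,
      antipodeSlice_tmul, LinearMap.smulRight_apply, smul_sub]
  obtain ⟨ψ, hψ⟩ := exists_dual_eq_one (k := k) hs0
  -- A cocycle with value one on `s`: it is not a coboundary, and it determines `D`.
  obtain ⟨f₀, hf₀, hf₀'⟩ := exists_isBarCocycle_wordToBar b hN hR hR' hK d ψ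
  constructor
  · rintro ⟨-, h⟩
    have h1 := lift_wordToBar_eq_zero hR b hN hR' (h f₀ hf₀) hsW
    rw [hval, hf₀' s hsW, hψ, one_smul, sub_eq_zero] at h1
    exact h1.symm
  · rintro rfl
    refine ⟨⟨f₀, hf₀, fun h => ?_⟩, fun f hf => ?_⟩
    · have h1 := lift_wordToBar_eq_zero hR b hN hR' h hsW
      rw [hf₀' s hsW, hψ] at h1
      exact one_ne_zero h1
    -- The difference is a cocycle, so it suffices that it vanishes on the last Koszul space, which
    -- is the line spanned by `s`.
    · refine isBarCoboundary_of_lift_wordToBar b hN hR hR' hK _ ?_ fun w hw => ?_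
      · have h1 := isBarCocycle_leftBarCoaction hε hf
        intro x
        have h2 := h1 x
        have h3 := hf x
        rw [barDiff_eq] at h2 h3 ⊢
        have h4 : ∀ y, PiTensorProduct.lift (f.smulRight (HopfAlgebra.antipode k g)) y =
            PiTensorProduct.lift f y • HopfAlgebra.antipode k g := by
          intro y
          rw [← LinearMap.smulRight_apply]
          congr 1
          ext x; simp
        have h5 : ∀ y, augPair (augmentation R hR)
            (PiTensorProduct.lift (f.smulRight (HopfAlgebra.antipode k g))) y =
            augPair (augmentation R hR) (PiTensorProduct.lift f) y • HopfAlgebra.antipode k g := by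
          intro y
          rw [augPair_eq_comp, LinearMap.comp_apply, h4, ← LinearMap.comp_apply, ← augPair_eq_comp]
        have h6 : ∀ y, augPair (augmentation R hR) (PiTensorProduct.lift
            (leftBarCoaction r.toLinearMap f - f.smulRight (HopfAlgebra.antipode k g))) y =
            augPair (augmentation R hR) (PiTensorProduct.lift (leftBarCoaction r.toLinearMap f)) y -
            augPair (augmentation R hR) (PiTensorProduct.lift f) y • HopfAlgebra.antipode k g := by
          intro y
          rw [← h5, augPair_eq_comp, LinearMap.comp_apply, map_sub, LinearMap.sub_apply,
            ← LinearMap.comp_apply, ← LinearMap.comp_apply, ← augPair_eq_comp, ← augPair_eq_comp]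
        rw [LinearMap.sub_apply, LinearMap.comp_apply] at h2 h3 ⊢
        rw [h6, map_sub, LinearMap.sub_apply, h4, sub_sub_sub_comm, h2, ← sub_smul, h3, zero_smul,
          sub_zero]
      · rw [hs] at hw
        obtain ⟨c, rfl⟩ := Submodule.mem_span_singleton.1 hw
        rw [map_smul, map_smul, hval, sub_self, smul_zero, smul_zero]

end Codeterminant

/-! ### Right coactions as flipped left coactions -/

section Right

variable {k : Type u} [Field k] {A : Type w} [Ring A] [Algebra k A] {K : Type v} [Ring K]
  [HopfAlgebra k K]

theorem comm_prod_ofFn {m : ℕ} (x : Fin m → A ⊗[k] K) :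
    TensorProduct.comm k A K (List.ofFn x).prod =
      (List.ofFn fun s => TensorProduct.comm k A K (x s)).prod := by
  have := map_list_prod (Algebra.TensorProduct.comm k A K) (List.ofFn x)
  rw [List.map_ofFn] at this
  exact this

theorem comm_rTensor {X Y : Type*} [AddCommGroup X] [Module k X] [AddCommGroup Y] [Module k Y]
    (f : X →ₗ[k] Y) (z : X ⊗[k] K) : TensorProduct.comm k Y K (LinearMap.rTensor K f z) =
      LinearMap.lTensor K f (TensorProduct.comm k X K z) := by
  induction z with
  | zero => simp
  | add x y hx hy => simp only [map_add, hx, hy]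
  | tmul x c => simp

/-- The flip `A ⊗ K ≃ K ⊗ A` is an algebra isomorphism and keeps the order of products in `K`, so no
opposite algebra enters. -/
theorem comm_rightTensorCoaction (r : A →ₗ[k] A ⊗[k] K) (i : ℕ) (x : ⨂[k]^i A) :
    TensorProduct.comm k _ K (rightTensorCoaction r i x) =
      leftTensorCoaction ((TensorProduct.comm k A K).toLinearMap ∘ₗ r) i x := by
  have : (TensorProduct.comm k (⨂[k]^i A) K).toLinearMap ∘ₗ rightTensorCoaction r i =
      leftTensorCoaction ((TensorProduct.comm k A K).toLinearMap ∘ₗ r) i := by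
    ext x
    simp only [LinearMap.compMultilinearMap_apply, LinearMap.comp_apply, rightTensorCoaction,
      leftTensorCoaction, PiTensorProduct.lift.tprod, MultilinearMap.compLinearMap_apply,
      MultilinearMap.mkPiAlgebraFin_apply, LinearEquiv.coe_coe, comm_rTensor, comm_prod_ofFn]
  exact LinearMap.congr_fun this x

theorem rightBarCoaction_eq (r : A →ₗ[k] A ⊗[k] K) {i : ℕ} (f : BarCochain k A k i) :
    rightBarCoaction r f = leftBarCoaction ((TensorProduct.comm k A K).toLinearMap ∘ₗ r) f := by
  have h : ∀ z : (⨂[k]^i A) ⊗[k] K, TensorProduct.lid k K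
      (LinearMap.rTensor K (PiTensorProduct.lift f) z) = TensorProduct.rid k K
        (LinearMap.lTensor K (PiTensorProduct.lift f) (TensorProduct.comm k _ K z)) := by
    intro z
    induction z with
    | zero => simp
    | add x y hx hy => simp only [map_add, hx, hy]
    | tmul x c => simp
  ext x
  simp only [rightBarCoaction, leftBarCoaction, LinearMap.compMultilinearMap_apply,
    LinearMap.comp_apply, ← comm_rightTensorCoaction, LinearEquiv.coe_coe, h]

end Right

/-! ### The superpotential spans the last Koszul space -/

section Superpotential

variable {k Z U : Type u} [Field k] [AddCommGroup Z] [Module k Z] [AddCommGroup U] [Module k U]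
  {n m N d : ℕ} {b : Module.Basis (Fin n) k Z} {u : Module.Basis (Fin n) k U}
  {e : MultilinearMap k (fun _ : Fin m => U) k}

theorem exists_eq_succ_of_koszulDegree (hN : 2 ≤ N) (hNm : N ≤ m) (hm : m = koszulDegree N d) :
    ∃ d', d = d' + 1 := by
  cases d with
  | zero => rw [koszulDegree_zero] at hm; omega
  | succ d => exact ⟨d, rfl⟩

/-- Nondegeneracy gives this unless the space is zero. In that case `Z^{⊗ m} = 0`, because `m > 0`,
and the vanishing of the last Koszul space contradicts regularity. -/
theorem tensorOf_ne_zero_of_isASRegular (he : IsPreregular e) (hN : 2 ≤ N) (hNm : N ≤ m)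
    (hm : m = koszulDegree N d) (hK : IsNKoszul N (relSpace b (coeff u e) N))
    (hA : IsASRegular (superAug b (coeff u e) hN hNm) d) : tensorOf b (coeff u e) ≠ 0 := by
  have h1 := koszulSpace_ne_bot b hN (relSpace_augmented b (coeff u e) hN hNm)
    (relSpace_le b (coeff u e) hNm) hK hA
  rcases subsingleton_or_nontrivial U with hU | hU
  · refine absurd ?_ h1
    rw [← hm, eq_bot_iff]
    intro x hx
    have h2 := hx.1
    rw [deg1_pow_eq_span b] at h2
    have : IsEmpty (Fin n) := by
      by_contra hn
      rw [not_isEmpty_iff] at hn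
      obtain ⟨i⟩ := hn
      exact u.ne_zero i (Subsingleton.elim _ _)
    have : Nonempty (Fin m) := ⟨⟨0, by omega⟩⟩
    have : IsEmpty (Fin m → Fin n) := inferInstance
    rw [Set.range_eq_empty, Submodule.span_empty] at h2
    exact h2
  · exact tensorOf_ne_zero b u he

theorem koszulSpace_eq_span_tensorOf (he : IsPreregular e) (hN : 2 ≤ N) (hNm : N ≤ m)
    (hm : m = koszulDegree N d) (hK : IsNKoszul N (relSpace b (coeff u e) N))
    (hA : IsASRegular (superAug b (coeff u e) hN hNm) d) :
    koszulSpace N (relSpace b (coeff u e) N) (koszulDegree N d) =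
      Submodule.span k {tensorOf b (coeff u e)} := by
  have h0 := tensorOf_ne_zero_of_isASRegular he hN hNm hm hK hA
  obtain ⟨d, rfl⟩ := exists_eq_succ_of_koszulDegree hN hNm hm
  refine koszulSpace_eq_span b hN (relSpace_augmented b (coeff u e) hN hNm)
    (relSpace_le b (coeff u e) hNm) hK hA ?_ h0
  rw [← hm]
  exact tensorOf_mem_koszulSpace b u he hNm

variable {K : Type w} [Ring K] [HopfAlgebra k K] {a : Fin n → Fin n → K}
  {ρ : TensorAlgebra k Z →ₐ[k] K ⊗[k] TensorAlgebra k Z}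
  (hρ : ∀ i, ρ (TensorAlgebra.ι k (b i)) = ∑ j, a i j ⊗ₜ[k] TensorAlgebra.ι k (b j))

include hρ in
theorem exists_coaction_tensorOf (he : IsPreregular e) (hN : 2 ≤ N) (hNm : N ≤ m)
    (hm : m = koszulDegree N d) (hK : IsNKoszul N (relSpace b (coeff u e) N))
    (hA : IsASRegular (superAug b (coeff u e) hN hNm) d)
    (hR : ∀ x ∈ relSpace b (coeff u e) N, ρ x ∈ tensorSub K (relSpace b (coeff u e) N)) :
    ∃ g, ρ (tensorOf b (coeff u e)) = g ⊗ₜ tensorOf b (coeff u e) := by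
  refine exists_of_mem_tensorSub_span ?_
  rw [← koszulSpace_eq_span_tensorOf he hN hNm hm hK hA]
  refine coaction_koszulSpace_mem hρ hR _ _ ?_
  rw [← hm]
  exact tensorOf_mem_koszulSpace b u he hNm

include hρ in
theorem codeterminant_iff (he : IsPreregular e) (hN : 2 ≤ N) (hNm : N ≤ m)
    (hm : m = koszulDegree N d) (hK : IsNKoszul N (relSpace b (coeff u e) N))
    (hA : IsASRegular (superAug b (coeff u e) hN hNm) d) {g : K}
    (hg : ρ (tensorOf b (coeff u e)) = g ⊗ₜ tensorOf b (coeff u e))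
    {r : QuotAlg (relSpace b (coeff u e) N) →ₐ[k] K ⊗[k] QuotAlg (relSpace b (coeff u e) N)}
    (hr : ∀ x, r (quotMk _ x) = LinearMap.lTensor K (quotMk _).toLinearMap (ρ x)) (D : K) :
    ((∃ f : BarCochain k (QuotAlg (relSpace b (coeff u e) N)) k d,
      IsBarCocycle (superAug b (coeff u e) hN hNm) f ∧
      ¬ IsBarCoboundary (superAug b (coeff u e) hN hNm) f) ∧
    ∀ f : BarCochain k (QuotAlg (relSpace b (coeff u e) N)) k d,
      IsBarCocycle (superAug b (coeff u e) hN hNm) f →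
      IsBarCoboundary (superAug b (coeff u e) hN hNm)
        (leftBarCoaction r.toLinearMap f - f.smulRight D)) ↔
      D = HopfAlgebra.antipode k g := by
  have h0 := tensorOf_ne_zero_of_isASRegular he hN hNm hm hK hA
  have h1 := koszulSpace_eq_span_tensorOf he hN hNm hm hK hA
  obtain ⟨d, rfl⟩ := exists_eq_succ_of_koszulDegree hN hNm hm
  exact isBarCoboundary_leftBarCoaction_sub_iff hρ hr hN (relSpace_le b (coeff u e) hNm)
    (relSpace_augmented b (coeff u e) hN hNm) hK h1 h0 hg D

end Superpotential

/-! ### Flipping `R ⊗ K` -/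

section CommTensor

variable {k : Type u} [Field k] {K : Type v} [Ring K] [HopfAlgebra k K]

theorem mem_range_rTensor_iff {X : Type*} [AddCommGroup X] [Module k X] {S : Submodule k X}
    {z : X ⊗[k] K} : z ∈ LinearMap.range (LinearMap.rTensor K S.subtype) ↔
      TensorProduct.comm k X K z ∈ tensorSub K S := by
  constructor
  · rintro ⟨y, rfl⟩
    exact ⟨_, (comm_rTensor _ y).symm⟩
  · rintro ⟨y, hy⟩
    refine ⟨(TensorProduct.comm k S K).symm y, (TensorProduct.comm k X K).injective ?_⟩
    rw [comm_rTensor, LinearEquiv.apply_symm_apply, hy]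

end CommTensor

end Preregular

end

-- The main theorem

universe u v w in
theorem theoremT {k V : Type u} {K : Type v} {M : Type w} [Field k] [AddCommGroup V] [Module k V]
    [Ring K] [HopfAlgebra k K] [AddCommGroup M] [Module k M]
    {n m N d : ℕ} (hN : 2 ≤ N) (hNm : N ≤ m) (hm : m = koszulDegree N d)
    (v : Module.Basis (Fin n) k V) (m₀ : Module.Basis Unit k M) (a : Fin n → Fin n → K) :
    -- the algebra `A(e, N) = T(V^*)/(R)` and left coactions
    (∀ e : MultilinearMap k (fun _ : Fin m => V) k, IsPreregular e →
      IsNKoszul N (relSpace v.dualBasis (coeff v e) N) →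
      IsASRegular (superAug v.dualBasis (coeff v e) hN hNm) d →
      ∀ ρ : TensorAlgebra k (Module.Dual k V) →ₐ[k] K ⊗[k] TensorAlgebra k (Module.Dual k V),
      IsLeftCoaction ρ.toLinearMap →
      (∀ i, ρ (TensorAlgebra.ι k (v.dualBasis i)) =
        ∑ j, a i j ⊗ₜ[k] TensorAlgebra.ι k (v.dualBasis j)) →
      List.TFAE [
        -- (a) `ρ` descends to `A(e, N)`
        ∃ ρ' : QuotAlg (relSpace v.dualBasis (coeff v e) N) →ₐ[k]
            K ⊗[k] QuotAlg (relSpace v.dualBasis (coeff v e) N),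
          IsInducedLeft (relSpace v.dualBasis (coeff v e) N) ρ ρ',
        -- (b) `ρ(R) ⊆ K ⊗ R`
        ∀ x ∈ relSpace v.dualBasis (coeff v e) N,
          ρ x ∈ LinearMap.range
            (LinearMap.lTensor K (relSpace v.dualBasis (coeff v e) N).subtype),
        -- (b), explicitly
        ∀ μ : (Fin N → Fin n) → k,
          (∀ l : Fin (m - N) → Fin n, ∑ i, coeff v e (joinIdx hNm l i) * μ i = 0) →
          ∀ l : Fin (m - N) → Fin n,
            ∑ i : Fin N → Fin n, ∑ j : Fin N → Fin n,
              (coeff v e (joinIdx hNm l i) * μ j) • wordProd a i j = 0,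
        -- (c) `k e^* → (V^*)^{⊗ m}` is a comodule map
        ∃! g : K, IsGroupLikeElem k g ∧
          IsLeftComoduleMap (leftBy k g _) ρ.toLinearMap
            (Submodule.span k {tensorOf v.dualBasis (coeff v e)}).subtype,
        -- (d) `ê : V^{⊗ m} → M_e` is a comodule map
        ∃! g : K, IsGroupLikeElem k g ∧
          IsRightComoduleMap
            (rightTensorCoaction (v.constr k fun j => ∑ i, v i ⊗ₜ[k] a i j) m)
            (rightBy k g M) ((PiTensorProduct.lift e).smulRight (m₀ ())),
        -- (e) the explicit relations
        ∃! g : K, IsGroupLikeElem k g ∧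
          ∀ j : Fin m → Fin n, ∑ i, coeff v e i • wordProd a i j = coeff v e j • g] ∧
      ∀ ρ' : QuotAlg (relSpace v.dualBasis (coeff v e) N) →ₐ[k]
          K ⊗[k] QuotAlg (relSpace v.dualBasis (coeff v e) N),
        IsInducedLeft (relSpace v.dualBasis (coeff v e) N) ρ ρ' →
        ∃ g : K, IsGroupLikeElem k g ∧
          IsLeftComoduleMap (leftBy k g _) ρ.toLinearMap
            (Submodule.span k {tensorOf v.dualBasis (coeff v e)}).subtype ∧
          IsRightComoduleMap
            (rightTensorCoaction (v.constr k fun j => ∑ i, v i ⊗ₜ[k] a i j) m)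
            (rightBy k g M) ((PiTensorProduct.lift e).smulRight (m₀ ())) ∧
          (∀ j : Fin m → Fin n, ∑ i, coeff v e i • wordProd a i j = coeff v e j • g) ∧
          (∀ j : Fin m → Fin n, coeff v e j ≠ 0 →
            g = (coeff v e j)⁻¹ • ∑ i, coeff v e i • wordProd a i j) ∧
          ∀ D : K, IsLeftHomCodet (superAug v.dualBasis (coeff v e) hN hNm)
            ρ'.toLinearMap d D ↔ D = g) ∧
    -- the algebra `A(f, N) = T(V)/(R)` and right coactions
    (∀ f : MultilinearMap k (fun _ : Fin m => Module.Dual k V) k, IsPreregular f →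
      IsNKoszul N (relSpace v (coeff v.dualBasis f) N) →
      IsASRegular (superAug v (coeff v.dualBasis f) hN hNm) d →
      ∀ ρ : TensorAlgebra k V →ₐ[k] TensorAlgebra k V ⊗[k] K,
      IsRightCoaction ρ.toLinearMap →
      (∀ j, ρ (TensorAlgebra.ι k (v j)) = ∑ i, TensorAlgebra.ι k (v i) ⊗ₜ[k] a i j) →
      List.TFAE [
        -- (a) `ρ` descends to `A(f, N)`
        ∃ ρ' : QuotAlg (relSpace v (coeff v.dualBasis f) N) →ₐ[k]
            QuotAlg (relSpace v (coeff v.dualBasis f) N) ⊗[k] K,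
          IsInducedRight (relSpace v (coeff v.dualBasis f) N) ρ ρ',
        -- (b) `ρ(R) ⊆ R ⊗ K`
        ∀ x ∈ relSpace v (coeff v.dualBasis f) N,
          ρ x ∈ LinearMap.range
            (LinearMap.rTensor K (relSpace v (coeff v.dualBasis f) N).subtype),
        -- (b), explicitly
        ∀ ν : (Fin N → Fin n) → k,
          (∀ l : Fin (m - N) → Fin n,
            ∑ j, coeff v.dualBasis f (joinIdx hNm l j) * ν j = 0) →
          ∀ l : Fin (m - N) → Fin n,
            ∑ i : Fin N → Fin n, ∑ j : Fin N → Fin n,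
              (coeff v.dualBasis f (joinIdx hNm l j) * ν i) • wordProd a i j = 0,
        -- (c) `k f^* → V^{⊗ m}` is a comodule map
        ∃! g : K, IsGroupLikeElem k g ∧
          IsRightComoduleMap (rightBy k g _) ρ.toLinearMap
            (Submodule.span k {tensorOf v (coeff v.dualBasis f)}).subtype,
        -- (d) `f̂ : (V^*)^{⊗ m} → M_f` is a comodule map
        ∃! g : K, IsGroupLikeElem k g ∧
          IsLeftComoduleMap
            (leftTensorCoaction
              (v.dualBasis.constr k fun i => ∑ j, a i j ⊗ₜ[k] v.dualBasis j) m)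
            (leftBy k g M) ((PiTensorProduct.lift f).smulRight (m₀ ())),
        -- (e) the explicit relations
        ∃! g : K, IsGroupLikeElem k g ∧
          ∀ i : Fin m → Fin n,
            ∑ j, coeff v.dualBasis f j • wordProd a i j = coeff v.dualBasis f i • g] ∧
      ∀ ρ' : QuotAlg (relSpace v (coeff v.dualBasis f) N) →ₐ[k]
          QuotAlg (relSpace v (coeff v.dualBasis f) N) ⊗[k] K,
        IsInducedRight (relSpace v (coeff v.dualBasis f) N) ρ ρ' →
        ∃ g : K, IsGroupLikeElem k g ∧
          IsRightComoduleMap (rightBy k g _) ρ.toLinearMap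
            (Submodule.span k {tensorOf v (coeff v.dualBasis f)}).subtype ∧
          IsLeftComoduleMap
            (leftTensorCoaction
              (v.dualBasis.constr k fun i => ∑ j, a i j ⊗ₜ[k] v.dualBasis j) m)
            (leftBy k g M) ((PiTensorProduct.lift f).smulRight (m₀ ())) ∧
          (∀ i : Fin m → Fin n,
            ∑ j, coeff v.dualBasis f j • wordProd a i j = coeff v.dualBasis f i • g) ∧
          (∀ i : Fin m → Fin n, coeff v.dualBasis f i ≠ 0 →
            g = (coeff v.dualBasis f i)⁻¹ • ∑ j, coeff v.dualBasis f j • wordProd a i j) ∧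
          ∀ D : K, IsRightHomCodet (superAug v (coeff v.dualBasis f) hN hNm)
            ρ'.toLinearMap d D ↔ (D * g = 1 ∧ g * D = 1)) := by
  refine ⟨fun e he hK hA ρ hc hρ => ?_, fun f hf hK hA ρ hc hρ => ?_⟩
  · have hs0 := tensorOf_ne_zero_of_isASRegular he hN hNm hm hK hA
    have hb : ∀ ρ', IsInducedLeft (relSpace v.dualBasis (coeff v e) N) ρ ρ' →
        ∀ x ∈ relSpace v.dualBasis (coeff v e) N,
          ρ x ∈ tensorSub K (relSpace v.dualBasis (coeff v e) N) := fun ρ' h =>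
      coaction_mem_of_lTensor_quotMk hρ (relSpace_le _ _ hNm) fun x hx => by
        rw [← h.2, quotMk_eq_zero hx, map_zero]
    have hbc : (∀ x ∈ relSpace v.dualBasis (coeff v e) N,
        ρ x ∈ tensorSub K (relSpace v.dualBasis (coeff v e) N)) →
        ∃ g, IsGroupLikeElem k g ∧ ρ (tensorOf v.dualBasis (coeff v e)) =
          g ⊗ₜ tensorOf v.dualBasis (coeff v e) := fun h => by
      obtain ⟨g, hg⟩ := exists_coaction_tensorOf hρ he hN hNm hm hK hA h
      exact ⟨g, isGroupLikeElem_of_left hc hs0 hg, hg⟩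
    have hC := isLeftComoduleMap_span_iff (K := K) ρ.toLinearMap
      (tensorOf v.dualBasis (coeff v e))
    have hCE := coaction_tensorOf_eq_iff hρ (coeff v e)
    have hDE := isRightComoduleMap_smulRight_iff (a := a) (u := v) m₀ e
      (ρ := v.constr k fun j => ∑ i, v i ⊗ₜ[k] a i j) (hρ := fun j => by simp)
    refine ⟨?_, fun ρ' h' => ?_⟩
    · tfae_have 1 → 2 := fun ⟨ρ', h⟩ => hb ρ' h
      tfae_have 2 → 1 := fun h => exists_isInducedLeft hc fun x hx => lTensor_quotMk_eq_zero (h x hx)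
      tfae_have 2 ↔ 3 := coaction_relSpace_mem_iff hρ hNm
      tfae_have 2 → 4 := fun h => by
        obtain ⟨g, hg, hg'⟩ := hbc h
        refine ⟨g, ⟨hg, (hC g).2 hg'⟩, fun g' h' => ?_⟩
        exact tmul_tensorOf_injective hs0 (((hC g').1 h'.2).symm.trans hg')
      -- The identity `∑ a_{ip} S(a_{pq}) = δ_{iq}` is the right inverse that contraction of last
      -- letters requires.
      tfae_have 4 → 2 := fun ⟨g, hg, _⟩ =>
        coaction_relSpace_mem_of_right_inverse hρ he
          (sum_mul_antipode (comul_left hc hρ) (counit_left hc hρ)) hNm ((hC g).1 hg.2)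
      tfae_have 4 ↔ 6 := existsUnique_congr fun g => and_congr_right fun _ =>
        (hC g).trans (hCE g)
      tfae_have 5 ↔ 6 := existsUnique_congr fun g => and_congr_right fun _ => hDE g
      tfae_finish
    · obtain ⟨g, hg, hg'⟩ := hbc (hb ρ' h')
      have hE := (hCE g).1 hg'
      refine ⟨g, hg, (hC g).2 hg', (hDE g).2 hE, hE, fun j hj => ?_, fun D => ?_⟩
      · rw [hE j, smul_smul, inv_mul_cancel₀ hj, one_smul]
      · have hcod := codeterminant_iff hρ he hN hNm hm hK hA hg' h'.2
        constructor
        · rintro ⟨D', h1, h2, h3⟩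
          -- In the left convention the inverse `D'` is what acts on the cohomology, so `D' = S(g)`
          -- and `D = g`.
          rw [(hcod D').1 h3] at h1
          calc D = D * (HopfAlgebra.antipode k g * g) := by
                rw [hg.antipode_mul_cancel, mul_one]
            _ = g := by rw [← mul_assoc, h1, one_mul]
        · rintro rfl
          exact ⟨HopfAlgebra.antipode k D, hg.mul_antipode_cancel, hg.antipode_mul_cancel,
            (hcod _).2 rfl⟩
  -- The flip transposes the matrix `a`. In general `ρ₁` is not a left coaction, since the
  -- comultiplication is reversed, but the lemmas applied to it use only multiplicativity and the
  -- values on generators. Grouplikeness and the inverse matrix are obtained from `ρ` itself.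
  · let ρ₁ : TensorAlgebra k V →ₐ[k] K ⊗[k] TensorAlgebra k V :=
      (Algebra.TensorProduct.comm k (TensorAlgebra k V) K).toAlgHom.comp ρ
    have hρ₁' : ∀ x, ρ₁ x = TensorProduct.comm k (TensorAlgebra k V) K (ρ x) := fun _ => rfl
    have hρ₁ : ∀ i, ρ₁ (TensorAlgebra.ι k (v i)) =
        ∑ j, a j i ⊗ₜ[k] TensorAlgebra.ι k (v j) := fun i => by
      rw [hρ₁', hρ, map_sum]
      simp
    have hs0 := tensorOf_ne_zero_of_isASRegular hf hN hNm hm hK hA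
    have hb : ∀ ρ', IsInducedRight (relSpace v (coeff v.dualBasis f) N) ρ ρ' →
        ∀ x ∈ relSpace v (coeff v.dualBasis f) N,
          ρ₁ x ∈ tensorSub K (relSpace v (coeff v.dualBasis f) N) := fun ρ' h =>
      coaction_mem_of_lTensor_quotMk hρ₁ (relSpace_le _ _ hNm) fun x hx => by
        rw [hρ₁', ← comm_rTensor, ← h.2, quotMk_eq_zero hx, map_zero, map_zero]
    have hbb : (∀ x ∈ relSpace v (coeff v.dualBasis f) N, ρ x ∈ LinearMap.range
        (LinearMap.rTensor K (relSpace v (coeff v.dualBasis f) N).subtype)) ↔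
        ∀ x ∈ relSpace v (coeff v.dualBasis f) N,
          ρ₁ x ∈ tensorSub K (relSpace v (coeff v.dualBasis f) N) :=
      forall₂_congr fun x _ => mem_range_rTensor_iff
    have hsw : ∀ g, ρ₁ (tensorOf v (coeff v.dualBasis f)) =
        g ⊗ₜ tensorOf v (coeff v.dualBasis f) ↔ ρ (tensorOf v (coeff v.dualBasis f)) =
          tensorOf v (coeff v.dualBasis f) ⊗ₜ g := fun g => by
      rw [hρ₁', ← (TensorProduct.comm k (TensorAlgebra k V) K).injective.eq_iff,
        TensorProduct.comm_tmul]
    have hbc : (∀ x ∈ relSpace v (coeff v.dualBasis f) N,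
        ρ₁ x ∈ tensorSub K (relSpace v (coeff v.dualBasis f) N)) →
        ∃ g, IsGroupLikeElem k g ∧ ρ₁ (tensorOf v (coeff v.dualBasis f)) =
          g ⊗ₜ tensorOf v (coeff v.dualBasis f) := fun h => by
      obtain ⟨g, hg⟩ := exists_coaction_tensorOf hρ₁ hf hN hNm hm hK hA h
      exact ⟨g, isGroupLikeElem_of_right hc hs0 ((hsw g).1 hg), hg⟩
    have hC := fun g => (isRightComoduleMap_span_iff (K := K) ρ.toLinearMap
      (tensorOf v (coeff v.dualBasis f)) g).trans (hsw g).symm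
    have hCE : ∀ g, ρ₁ (tensorOf v (coeff v.dualBasis f)) =
        g ⊗ₜ tensorOf v (coeff v.dualBasis f) ↔ ∀ i : Fin m → Fin n,
          ∑ j, coeff v.dualBasis f j • wordProd a i j = coeff v.dualBasis f i • g :=
      coaction_tensorOf_eq_iff hρ₁ (coeff v.dualBasis f)
    have hDE := isLeftComoduleMap_smulRight_iff (a := a) (u := v.dualBasis) m₀ f
      (ρ := v.dualBasis.constr k fun i => ∑ j, a i j ⊗ₜ[k] v.dualBasis j)
      (hρ := fun i => by rw [Module.Basis.constr_basis])
    refine ⟨?_, fun ρ' h' => ?_⟩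
    · tfae_have 1 → 2 := fun ⟨ρ', h⟩ => hbb.2 (hb ρ' h)
      tfae_have 2 → 1 := fun h => exists_isInducedRight hc fun x hx => by
        have := lTensor_quotMk_eq_zero (hbb.1 h x hx)
        rw [hρ₁', ← comm_rTensor] at this
        exact (TensorProduct.comm k _ K).map_eq_zero_iff.1 this
      tfae_have 2 ↔ 3 := by
        refine hbb.trans ((coaction_relSpace_mem_iff hρ₁ hNm).trans ?_)
        refine forall₂_congr fun μ _ => forall_congr' fun l => ?_
        rw [Finset.sum_comm]
        rfl
      tfae_have 2 → 4 := fun h => by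
        obtain ⟨g, hg, hg'⟩ := hbc (hbb.1 h)
        refine ⟨g, ⟨hg, (hC g).2 hg'⟩, fun g' h' => ?_⟩
        exact tmul_tensorOf_injective hs0 (((hC g').1 h'.2).symm.trans hg')
      -- For the transposed matrix, `∑ S(a_{qp}) a_{pi} = δ_{qi}` is the inverse that fits
      -- contraction of first letters, so cyclicity is not needed in this direction.
      tfae_have 4 → 2 := fun ⟨g, hg, _⟩ => hbb.2 <|
        coaction_relSpace_mem_of_left_inverse hρ₁ (Y := fun q p => HopfAlgebra.antipode k (a q p))
          (fun q i => by
            rw [sum_antipode_mul (comul_right hc hρ) (counit_right hc hρ)]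
            simp only [eq_comm]) hNm ((hC g).1 hg.2)
      tfae_have 4 ↔ 6 := existsUnique_congr fun g => and_congr_right fun _ =>
        (hC g).trans (hCE g)
      tfae_have 5 ↔ 6 := existsUnique_congr fun g => and_congr_right fun _ => hDE g
      tfae_finish
    · obtain ⟨g, hg, hg'⟩ := hbc (hb ρ' h')
      have hE := (hCE g).1 hg'
      refine ⟨g, hg, (hC g).2 hg', (hDE g).2 hE, hE, fun j hj => ?_, fun D => ?_⟩
      · rw [hE j, smul_smul, inv_mul_cancel₀ hj, one_smul]
      · have hcod := codeterminant_iff hρ₁ hf hN hNm hm hK hA hg'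
          (r := (Algebra.TensorProduct.comm k _ K).toAlgHom.comp ρ') (fun x => by
            rw [hρ₁', ← comm_rTensor, ← h'.2]
            rfl) D
        have hD : IsRightHomCodet (superAug v (coeff v.dualBasis f) hN hNm) ρ'.toLinearMap d D ↔
            D = HopfAlgebra.antipode k g := by
          refine Iff.trans ?_ hcod
          simp only [IsRightHomCodet, rightBarCoaction_eq]
          rfl
        rw [hD]
        constructor
        · rintro rfl
          exact ⟨hg.antipode_mul_cancel, hg.mul_antipode_cancel⟩
        · rintro ⟨h1, -⟩
          calc D = D * (g * HopfAlgebra.antipode k g) := by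
                rw [hg.mul_antipode_cancel, mul_one]
            _ = HopfAlgebra.antipode k g := by rw [← mul_assoc, h1, one_mul]
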